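/- **Theorem 2.1.** Let $\mathcal W$ be a holomorphic $d$-web on a complex surface $M$, given on an open covering $(U_i)$ by holomorphic $d$-symmetric $1$-forms $\omega_i$ with isolated zeros, which are multiples of each other by nowhere vanishing holomorphic functions on overlaps and which factor, at generic points, into $d$ pairwise linearly independent $1$-forms. The discriminant $\Delta(\mathcal W)$ is the set of points where this factorization fails. Away from $\Delta(\mathcal W)$, write locally $\omega_i=\prod_{r=1}^d\theta_r$ with holomorphic $1$-forms $\theta_r$, and $\theta_r\wedge\theta_s=\delta_{rs}\,\mathrm dx\wedge\mathrm dy$. For $r<s<t$, let $\eta_{rst}$ be the unique $1$-form with $$\mathrm d(\delta_{st}\theta_r)=\eta_{rst}\wedge\delta_{st}\theta_r,\qquad \mathrm d(\delta_{tr}\theta_s)=\eta_{rst}\wedge\delta_{tr}\theta_s,\qquad \mathrm d(\delta_{rs}\theta_t)=\eta_{rst}\wedge\delta_{rs}\theta_t .$$ The fundamental form is $\eta(\mathcal W)=\sum_{r<s<t}\eta_{rst}$; it depends only on $\omega_i$, and replacing $\omega_i$ by $g\,\omega_i$ with $g$ holomorphic and nowhere zero adds a constant multiple of $\mathrm dg/g$.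 The curvature is $K(\mathcal W)=\mathrm d\eta(\mathcal W)$. For a curve $D$, "along $D$" means near the generic points of $D$. Let $D$ be an irreducible component of $\Delta(\mathcal W)$ such that $\mathcal W$ is smooth along $D$: for every generic point $m\in D$, the characteristic surface of $\mathcal W$ in $\mathbb P T^*M$ (given in local coordinates $(x,y)$, at the cotangent direction $[q\,\mathrm dy-p\,\mathrm dx]$, by $\sum_{k=0}^d a_k(x,y)\,q^kp^{d-k}=0$ when $\omega_i=\sum_{k=0}^d a_k\,(\mathrm dx)^k(\mathrm dy)^{d-k}$) is smooth at every point over $m$. Then $\eta(\mathcal W)$ has at most simple poles along $D$. More precisely, choose local coordinates $(x,y)$ on $M$ with $D=\{y=0\}$, and let $F(x,y,p)=\sum_{k=0}^d a_k(x,y)p^{d-k}=0$, $p=\mathrm dy/\mathrm dx$, be an equation defining $\mathcal W$, that is, $\sum_k a_k\,(\mathrm dx)^k(\mathrm dy)^{d-k}$ is a nowhere vanishing holomorphic multiple of the forms $\omega_i$. Let $V$ be a nonempty connected open set of values of $x$ such that $V\times\{0\}$ lies in the coordinate domain, and suppose that for $x\in V$ $$F(x,0,p)=a_0(x)\prod_{\alpha=1}^n\bigl(p-\varphi_\alpha(x)\bigr)^{\nu_\alpha},\qquad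 a_0(x):=a_0(x,0),$$ with holomorphic functions $\varphi_\alpha$ on $V$, $\varphi_\alpha\not\equiv\varphi_\beta$ for $\alpha\ne\beta$, and integers $\nu_\alpha\ge1$. For $\nu_\alpha\ge2$ put $$\psi_\alpha=\frac1{\nu_\alpha}\left[(\nu_\alpha-2)\left(d-\varphi_\alpha\frac{\partial_p\partial_yF(x,0,\varphi_\alpha)}{\partial_yF(x,0,\varphi_\alpha)}\right)-2(\nu_\alpha+1)\sum_{\beta\ne\alpha}\frac{\nu_\beta\varphi_\beta}{\varphi_\alpha-\varphi_\beta}\right]$$ (a meromorphic function of $x\in V$; terms with $\nu_\alpha=1$ are absent below). Then, for $\eta(\mathcal W)$ computed from $F$, the form $$\eta(\mathcal W)-\frac1{6y}\sum_{\alpha=1}^n(\nu_\alpha-1)\Bigl(\psi_\alpha(x)\bigl(\mathrm dy-\varphi_\alpha(x)\,\mathrm dx\bigr)+(\nu_\alpha-2)\,\mathrm dy\Bigr)$$ extends holomorphically near $(x,0)$ for all $x\in V$ outside a discrete closed subset of $V$. In particular, $K(\mathcal W)$ is holomorphic along $D$ if and only if, on $V$, $$\sum_{\alpha=1}^n(\nu_\alpha-1)\varphi_\alpha\psi_\alpha\equiv0\qquad\text{and}\qquad\sum_{\alpha=1}^n(\nu_\alpha-1)\psi_\alpha'\equiv0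 .$$ -/

import Mathlib

open Filter Topology Manifold ContDiff

noncomputable section

namespace PlanarWeb

/-- Coordinates `(x, y)` on an open subset of a complex surface; also used for tangent vectors
written as `(dx(v), dy(v))`. -/
abbrev Plane := ℂ × ℂ

/-! ### Differential forms in coordinates -/

/-- Holomorphic-coordinate `1`-forms: `A dx + B dy` is `z ↦ A z • dx + B z • dy`. -/
abbrev Form := Plane → (Plane →L[ℂ] ℂ)

/-- The coordinate form `dx`. -/
abbrev dx : Plane →L[ℂ] ℂ := ContinuousLinearMap.fst ℂ ℂ ℂ

/-- The coordinate form `dy`. -/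
abbrev dy : Plane →L[ℂ] ℂ := ContinuousLinearMap.snd ℂ ℂ ℂ

/-- The coefficient of `dx ∧ dy` in `α ∧ β`. -/
def wedge (α β : Plane →L[ℂ] ℂ) : ℂ := α (1, 0) * β (0, 1) - α (0, 1) * β (1, 0)

/-- The coefficient of `dx ∧ dy` in the exterior derivative of `α`
(for `α = A dx + B dy` it is `∂B/∂x - ∂A/∂y`). -/
def extd (α : Form) (z : Plane) : ℂ :=
  fderiv ℂ α z (1, 0) (0, 1) - fderiv ℂ α z (0, 1) (1, 0)

/-- The symmetric `d`-form `∑ k, a k (dx)^k (dy)^(d-k)`, as a function of the point and of a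
tangent vector there. -/
def symForm (d : ℕ) (a : ℕ → Plane → ℂ) (z v : Plane) : ℂ :=
  ∑ k ∈ Finset.range (d + 1), a k z * v.1 ^ k * v.2 ^ (d - k)

/-- The polynomial `F(x,y,p) = ∑ k, a k (x,y) p^(d-k)`, where `p = dy/dx`. -/
def webPoly (d : ℕ) (a : ℕ → Plane → ℂ) (x y p : ℂ) : ℂ :=
  ∑ k ∈ Finset.range (d + 1), a k (x, y) * p ^ (d - k)

/-! ### Fundamental form and curvature, in coordinates -/

/-- `c` is the value at `z` of the fundamental form of the `3`-web defined by `α, β, γ`: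
`d(δ_{βγ} α) = c ∧ δ_{βγ} α`, and cyclically. -/
def IsTripleFormAt (α β γ : Form) (z : Plane) (c : Plane →L[ℂ] ℂ) : Prop :=
  extd (fun w => wedge (β w) (γ w) • α w) z = wedge c (wedge (β z) (γ z) • α z) ∧
  extd (fun w => wedge (γ w) (α w) • β w) z = wedge c (wedge (γ z) (α z) • β z) ∧
  extd (fun w => wedge (α w) (β w) • γ w) z = wedge c (wedge (α z) (β z) • γ z)

/-- `c` is the value at `z` of the fundamental form of the web defined near `z` by the symmetric
`d`-form `σ`: near `z`, `σ` is a product of `d` holomorphic `1`-forms, pairwise independent at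
`z`, and `c` is the sum of the values at `z` of the fundamental forms of the `3`-subwebs. -/
def IsFundamentalFormAt (d : ℕ) (σ : Plane → Plane → ℂ) (z : Plane) (c : Plane →L[ℂ] ℂ) : Prop :=
  ∃ L : Fin d → Form,
    (∀ r, AnalyticAt ℂ (L r) z) ∧
    (∀ r s, r ≠ s → wedge (L r z) (L s z) ≠ 0) ∧
    (∀ᶠ w in 𝓝 z, ∀ v, σ w v = ∏ r, L r w v) ∧
    ∃ η : Fin d → Fin d → Fin d → (Plane →L[ℂ] ℂ),
      (∀ r s t, r < s → s < t → IsTripleFormAt (L r) (L s) (L t) z (η r s t)) ∧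
      c = ∑ r, ∑ s ∈ Finset.Ioi r, ∑ t ∈ Finset.Ioi s, η r s t

open Classical in
/-- The fundamental form of the web defined by `σ`. It depends on `σ` only (not on the
factorization), and is meaningful off the discriminant. Multiplying `σ` by a nowhere vanishing
holomorphic function `g` adds a constant multiple of `dg/g` to it. -/
def fundamentalForm (d : ℕ) (σ : Plane → Plane → ℂ) : Form := fun z =>
  if h : ∃ c, IsFundamentalFormAt d σ z c then h.choose else 0

/-- The coefficient of `dx ∧ dy` in the curvature, the exterior derivative of the fundamental
form. -/
def curvature (d : ℕ) (σ : Plane → Plane → ℂ) (z : Plane) : ℂ := extd (fundamentalForm d σ) z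

/-- `f`, defined off `S`, extends holomorphically to a neighbourhood of `z₀`. -/
def ExtendsAt {G : Type*} [NormedAddCommGroup G] [NormedSpace ℂ G]
    (S : Set Plane) (f : Plane → G) (z₀ : Plane) : Prop :=
  ∃ h : Plane → G, AnalyticAt ℂ h z₀ ∧ ∀ᶠ z in 𝓝 z₀, z ∉ S → f z = h z

/-! ### Webs on a complex surface -/

/-- `q` is a product of `d` pairwise linearly independent linear forms. -/
def SplitsDistinct (d : ℕ) {T : Type*} [AddCommGroup T] [Module ℂ T] (q : T → ℂ) : Prop :=
  ∃ ℓ : Fin d → Module.Dual ℂ T, (∀ v, q v = ∏ r, ℓ r v) ∧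
    ∀ r s, r ≠ s → LinearIndependent ℂ ![ℓ r, ℓ s]

section Surface

variable {d : ℕ} {ι M : Type*} [TopologicalSpace M] [ChartedSpace Plane M]

/-- The expression, in the coordinates `e`, of a function on tangent vectors of `M`. -/
def localExpr (σ : (m : M) → TangentSpace 𝓘(ℂ, Plane) m → ℂ) (e : OpenPartialHomeomorph M Plane)
    (z v : Plane) : ℂ :=
  σ (e.symm z) (mfderiv 𝓘(ℂ, Plane) 𝓘(ℂ, Plane) e.symm z v)

variable (d ι M) in
/-- A (global, holomorphic) `d`-web on the complex surface `M`. A symmetric `d`-form is given as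
the function `(m, v) ↦ ω(m)(v, …, v)` on tangent vectors. -/
structure Web where
  /-- the open covering -/
  dom : ι → Set M
  isOpen_dom : ∀ i, IsOpen (dom i)
  covers : ∀ m, ∃ i, m ∈ dom i
  /-- the symmetric `d`-forms -/
  form : ι → (m : M) → TangentSpace 𝓘(ℂ, Plane) m → ℂ
  holomorphic : ∀ i, ∀ e ∈ IsManifold.maximalAtlas 𝓘(ℂ, Plane) ω M, ∃ a : ℕ → Plane → ℂ,
    (∀ k, AnalyticOnNhd ℂ (a k) (e.target ∩ e.symm ⁻¹' dom i)) ∧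
    ∀ z ∈ e.target ∩ e.symm ⁻¹' dom i, ∀ v, localExpr (form i) e z v = symForm d a z v
  isolated_zeros : ∀ i, ∀ m ∈ dom i, ∀ᶠ m' in 𝓝[≠] m, ∃ v, form i m' v ≠ 0
  compatible : ∀ i j, ∃ g : M → ℂ, ContMDiffOn 𝓘(ℂ, Plane) 𝓘(ℂ, ℂ) ω g (dom i ∩ dom j) ∧
    ∀ m ∈ dom i ∩ dom j, g m ≠ 0 ∧ ∀ v, form i m v = g m * form j m v
  generic_splits : ∀ i, dom i ⊆ closure {m | m ∈ dom i ∧ SplitsDistinct d (form i m)}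

namespace Web

variable (W : Web d ι M)

/-- The (support of the) discriminant: the points where a defining form is not a product of `d`
pairwise linearly independent linear forms. -/
def discriminant : Set M := {m | ∃ i, m ∈ W.dom i ∧ ¬ SplitsDistinct d (W.form i m)}

/-- The discriminant in the coordinates `e`. -/
def discrIn (e : OpenPartialHomeomorph M Plane) : Set Plane := e.symm ⁻¹' W.discriminant

/-- `F(x,y,dy/dx) = 0` defines `W` in the coordinates `e`, where `F = ∑ k, a k p^(d-k)`:
the symmetric form `∑ k, a k (dx)^k (dy)^(d-k)` is holomorphic and, locally, a nowhere vanishing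
holomorphic multiple of the forms defining `W`. -/
def IsEquation (e : OpenPartialHomeomorph M Plane) (a : ℕ → Plane → ℂ) : Prop :=
  (∀ k, AnalyticOnNhd ℂ (a k) e.target) ∧
  ∀ i, ∃ g : Plane → ℂ, AnalyticOnNhd ℂ g (e.target ∩ e.symm ⁻¹' W.dom i) ∧
    ∀ z ∈ e.target ∩ e.symm ⁻¹' W.dom i,
      g z ≠ 0 ∧ ∀ v, symForm d a z v = g z * localExpr (W.form i) e z v

/-- The characteristic surface of `W` is smooth at every point of the fibre over `m`.
A cotangent direction `[q dy - p dx]` at a point corresponds to its kernel, spanned by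
`v = (q, p)`, so that the characteristic surface has the homogeneous equation
`localExpr (W.form i) e z v = 0` in `(z, [v])`. -/
def SmoothOver (m : M) : Prop :=
  ∀ e ∈ IsManifold.maximalAtlas 𝓘(ℂ, Plane) ω M, m ∈ e.source → ∀ i, m ∈ W.dom i →
    ∀ v : Plane, v ≠ 0 → localExpr (W.form i) e (e m) v = 0 →
      fderiv ℂ (fun u : Plane × Plane => localExpr (W.form i) e u.1 u.2) (e m, v) ≠ 0

/-- `W` is smooth along `D`. -/
def SmoothAlong (D : Set M) : Prop := D ⊆ closure {m | m ∈ D ∧ W.SmoothOver m}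

/-- Near generic points of `D`, in coordinates where `D = {y = 0}`, the fundamental form `η`
of `W` has at most a simple pole: `y η` is holomorphic. -/
def FundamentalFormSimplePolesAlong (D : Set M) : Prop :=
  D ⊆ closure {m | m ∈ D ∧ ∃ e ∈ IsManifold.maximalAtlas 𝓘(ℂ, Plane) ω M, m ∈ e.source ∧
    (∀ m' ∈ e.source, m' ∈ D ↔ (e m').2 = 0) ∧
    ∀ i, m ∈ W.dom i →
      ExtendsAt (W.discrIn e) (fun z => z.2 • fundamentalForm d (localExpr (W.form i) e) z) (e m)}

/-- The curvature of `W` is holomorphic along `D`: it extends holomorphically near the generic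
points of `D`. -/
def CurvatureHolomorphicAlong (D : Set M) : Prop :=
  D ⊆ closure {m | m ∈ D ∧ ∀ e ∈ IsManifold.maximalAtlas 𝓘(ℂ, Plane) ω M, m ∈ e.source →
    ∀ i, m ∈ W.dom i →
      ExtendsAt (W.discrIn e) (curvature d (localExpr (W.form i) e)) (e m)}

end Web

/-- The regular points of a subset `Δ` of `M` that has codimension one: the points near which it
is `{y = 0}` for suitable coordinates. -/
def regularLocus (Δ : Set M) : Set M :=
  {m | m ∈ Δ ∧ ∃ e ∈ IsManifold.maximalAtlas 𝓘(ℂ, Plane) ω M, m ∈ e.source ∧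
    ∀ m' ∈ e.source, m' ∈ Δ ↔ (e m').2 = 0}

/-- `D` is an irreducible component of the analytic curve `Δ`: the closure of a connected
component of the regular locus of `Δ`. -/
def IsIrreducibleComponent (Δ D : Set M) : Prop :=
  ∃ m ∈ regularLocus Δ, D = closure (connectedComponentIn (regularLocus Δ) m)

end Surface

/-! ### The functions `ψ_α` and the residue -/

/-- `ψ_α(x)`, meaningful when `2 ≤ ν α`. -/
def psi (d : ℕ) (a : ℕ → Plane → ℂ) {n : ℕ} (φ : Fin n → ℂ → ℂ) (ν : Fin n → ℕ) (α : Fin n)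
    (x : ℂ) : ℂ :=
  1 / (ν α : ℂ) *
    (((ν α : ℂ) - 2) *
        ((d : ℂ) - φ α x *
          (deriv (fun p => deriv (fun y => webPoly d a x y p) 0) (φ α x) /
            deriv (fun y => webPoly d a x y (φ α x)) 0)) -
      2 * ((ν α : ℂ) + 1) *
        ∑ β ∈ Finset.univ.erase α, (ν β : ℂ) * φ β x / (φ α x - φ β x))

/-- `∑ α, (ν_α - 1) (ψ_α(x) (dy - φ_α(x) dx) + (ν_α - 2) dy)`. -/
def residue (d : ℕ) (a : ℕ → Plane → ℂ) {n : ℕ} (φ : Fin n → ℂ → ℂ) (ν : Fin n → ℕ)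
    (x : ℂ) : Plane →L[ℂ] ℂ :=
  ∑ α, ((ν α : ℂ) - 1) • (psi d a φ ν α x • (dy - φ α x • dx) + ((ν α : ℂ) - 2) • dy)

end PlanarWeb

end

noncomputable section

namespace PlanarWeb

/-! ### Parametric integrals and holomorphic functions of two variables -/

/-! Where the coefficient a₀ of (dy)^d does not vanish, the factors of the web are multiples of dy -
p dx, with p running over the roots of F. The fundamental form of a 3-web is a cyclic sum of terms,
each of which differentiates a single slope (`isTripleFormAt_slope`). Summation over all triples
therefore collapses to a sum over single roots: (d-1)(d-2)/2 times da₀/a₀ plus, for each root, a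
rational expression in the partial derivatives of F at that root
(`IsFundamentalFormAt.eq_sum_roots`). The factorization is no longer visible there, so the form is
well defined.

Near a point of D = {y = 0} the roots gather in small discs around the φ_α. The sum of k(p)/F'(p)
over simple roots in a disc is a contour integral of k/F (`circleIntegral_inv_eval_mul`), hence
holomorphic in (x, y), also across y = 0, as soon as k is (`analyticAt_trace`). Around a simple φ_α
the contribution has this form directly. Around φ_α of multiplicity ν ≥ 2, smoothness of the
characteristic surface gives ∂F/∂y ≠ 0 (`deriv_webPoly_ne_zero_of_smooth`). Write F = s^ν P + y f
with s = p - φ_α and f ≠ 0. At a root, y = -s^ν P/f, and this factor y absorbs the denominators: y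
times the contribution is a sum of k/F' whose dy-part has k = P s^(ν-2) N with N holomorphic. So the
pole is simple, and since k/F = N/s² on y = 0, its residue is a derivative of N at φ_α. This
derivative is where ψ_α comes from (`hasDerivAt_tangency`, `exists_analyticAt_rootSum_tangency`);
`exists_analyticAt_sub_residue` adds up the clusters.

The local argument needs a₀ ≠ 0, constant multiplicities and transversality. On V these are
nonvanishing conditions on holomorphic functions that are not identically zero, so they fail on a
discrete set only (`Web.eventually_equimultipleAt`). For the bare statement about simple poles no
equation is given: a shear preserving D makes a₀ nonzero, and a point with the maximal number of
distinct roots supplies the φ_α (`exists_generic_factorization`).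

For the curvature, the derivative of (A dx + B dy)/(6y), with A and B depending on x only, is (B'/y
+ A/y²)/6 (`extd_pole`), which is holomorphic exactly when A = 0 and B' = 0. Extension of the
curvature does not depend on charts or units, and it propagates from one point of a component of the
regular locus to all others by Cauchy integrals in y and the identity theorem in x
(`extends_of_extends`, `Web.curvatureExtendsAt_of_mem_component`). Vanishing of A and B' propagates
over V because ψ_α is meromorphic there. -/

@[fun_prop]
theorem _root_.AnalyticAt.prod_fst {E F G : Type*} [NormedAddCommGroup E] [NormedSpace ℂ E]
    [NormedAddCommGroup F] [NormedSpace ℂ F] [NormedAddCommGroup G] [NormedSpace ℂ G]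
    {f : E → F × G} {z : E} (h : AnalyticAt ℂ f z) : AnalyticAt ℂ (fun w => (f w).1) z :=
  AnalyticAt.fun_comp (g := Prod.fst) analyticAt_fst h

@[fun_prop]
theorem _root_.AnalyticAt.prod_snd {E F G : Type*} [NormedAddCommGroup E] [NormedSpace ℂ E]
    [NormedAddCommGroup F] [NormedSpace ℂ F] [NormedAddCommGroup G] [NormedSpace ℂ G]
    {f : E → F × G} {z : E} (h : AnalyticAt ℂ f z) : AnalyticAt ℂ (fun w => (f w).2) z :=
  AnalyticAt.fun_comp (g := Prod.snd) analyticAt_snd h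

/-- Viewing a family over a compact parameter space as one map into `C(X, ℂ)` makes the one-variable
theory of Banach-valued functions available for parametric statements. Only points of `K` matter;
elsewhere a discontinuous `g z` is replaced by zero. -/
theorem continuousOn_curry {Z X : Type*} [TopologicalSpace Z] [TopologicalSpace X]
    {g : Z → X → ℂ} {K : Set Z}
    (hc : ContinuousOn (Function.uncurry g) (K ×ˢ Set.univ)) :
    ∃ Φ : Z → C(X, ℂ), ContinuousOn Φ K ∧ ∀ z ∈ K, ∀ s, Φ z s = g z s := by
  classical
  have hcz : ∀ z ∈ K, Continuous (g z) := fun z hz => by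
    rw [← continuousOn_univ]
    exact hc.comp (f := fun s => (z, s)) (by fun_prop) (fun s _ => ⟨hz, trivial⟩)
  refine ⟨fun z => if h : Continuous (g z) then ⟨g z, h⟩ else 0, ?_, fun z hz s => by
    simp [hcz z hz]⟩
  rw [continuousOn_iff_continuous_domRestrict]
  refine ContinuousMap.continuous_of_continuous_uncurry _ ?_
  have h1 : Continuous fun p : K × X => Function.uncurry g (p.1.1, p.2) :=
    hc.comp_continuous (f := fun p : K × X => ((p.1 : Z), p.2)) (by fun_prop)
      (fun p => ⟨p.1.2, trivial⟩)
  refine h1.congr fun p => ?_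
  simp [Function.uncurry, hcz p.1 p.1.2]

theorem circleIntegral_evalCLM {X : Type*} [TopologicalSpace X] [CompactSpace X]
    {Φ : ℂ → C(X, ℂ)} {c : ℂ} {r : ℝ} (h : CircleIntegrable Φ c r) (s : X) :
    (∮ z in C(c, r), Φ z) s = ∮ z in C(c, r), Φ z s := by
  have := (ContinuousLinearMap.intervalIntegral_comp_comm (ContinuousMap.evalCLM ℂ s) h.out)
  simpa [circleIntegral] using this.symm

/-- The Cauchy integral of a continuous `C(X, ℂ)`-valued map is a power series, and evaluation at
`s` commutes with the integral, so the scalar Cauchy formula identifies its values with `g`.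
Holomorphy for each `s` thus becomes analyticity uniformly in `s`. -/
theorem analyticAt_curry {X : Type*} [TopologicalSpace X] [CompactSpace X]
    {g : ℂ → X → ℂ} {x₀ : ℂ} {r : ℝ} (hr : 0 < r)
    (hc : ContinuousOn (Function.uncurry g) (Metric.closedBall x₀ r ×ˢ Set.univ))
    (hd : ∀ s, DifferentiableOn ℂ (fun x => g x s) (Metric.closedBall x₀ r)) :
    ∃ Φ : ℂ → C(X, ℂ), AnalyticAt ℂ Φ x₀ ∧ ∀ x ∈ Metric.ball x₀ r, ∀ s, Φ x s = g x s := by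
  obtain ⟨Φ, hΦ, hΦg⟩ := continuousOn_curry hc
  have hint : CircleIntegrable Φ x₀ r :=
    (hΦ.mono Metric.sphere_subset_closedBall).circleIntegrable hr.le
  lift r to NNReal using hr.le
  refine ⟨_, (hasFPowerSeriesOn_cauchy_integral hint hr).analyticAt, fun x hx s => ?_⟩
  have hint2 : CircleIntegrable (fun z => (z - x)⁻¹ • Φ z) x₀ r := by
    refine ContinuousOn.circleIntegrable hr.le ?_
    refine ContinuousOn.smul (ContinuousOn.inv₀ (continuous_id.sub continuous_const).continuousOn ?_)
      (hΦ.mono Metric.sphere_subset_closedBall)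
    intro z hz h
    replace h : z - x = 0 := h
    rw [sub_eq_zero] at h
    subst h
    simp only [Metric.mem_sphere, Metric.mem_ball] at hz hx
    exact absurd hz hx.ne
  have h2 := (hd s).circleIntegral_sub_inv_smul hx
  rw [ContinuousMap.smul_apply, circleIntegral_evalCLM hint2]
  have h3 : (∮ z in C(x₀, r), ((z - x)⁻¹ • Φ z) s) = ∮ z in C(x₀, r), (z - x)⁻¹ • g z s := by
    refine circleIntegral.integral_congr hr.le fun z hz => ?_
    simp [hΦg z (Metric.sphere_subset_closedBall hz) s]
  rw [h3, h2, smul_smul, inv_mul_cancel₀ Complex.two_pi_I_ne_zero, one_smul]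

/-- Integration over an interval, as a functional on continuous functions. -/
def integralCLM (a b : ℝ) (hab : a ≤ b) : C(Set.Icc a b, ℂ) →L[ℂ] ℂ :=
  LinearMap.mkContinuous
    { toFun := fun φ => ∫ θ in a..b, Set.IccExtend hab φ θ
      map_add' := fun φ ψ => by
        rw [← intervalIntegral.integral_add]
        · rfl
        · exact (φ.continuous.Icc_extend' (h := hab)).intervalIntegrable _ _
        · exact (ψ.continuous.Icc_extend' (h := hab)).intervalIntegrable _ _
      map_smul' := fun c φ => by
        rw [RingHom.id_apply, ← intervalIntegral.integral_smul]
        rfl } |b - a| (fun φ => by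
      rw [mul_comm]
      exact intervalIntegral.norm_integral_le_of_norm_le_const
        fun θ _ => φ.norm_coe_le_norm _)

theorem integralCLM_apply {a b : ℝ} (hab : a ≤ b) (φ : C(Set.Icc a b, ℂ)) {h : ℝ → ℂ}
    (hh : ∀ θ : Set.Icc a b, φ θ = h θ) : integralCLM a b hab φ = ∫ θ in a..b, h θ := by
  change ∫ θ in a..b, Set.IccExtend hab φ θ = _
  refine intervalIntegral.integral_congr fun θ hθ => ?_
  rw [Set.uIcc_of_le hab] at hθ
  simp only [Set.IccExtend_of_mem hab _ hθ, hh]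

/-- Inversion is analytic on the units of the Banach algebra `C(X, ℂ)`, and the units are the
nowhere vanishing functions. This provides the Cauchy kernel as an analytic function of its centre.
-/
theorem analyticAt_inverse_sub {X : Type*} [TopologicalSpace X] [CompactSpace X] (u : C(X, ℂ))
    {y₀ : ℂ} (h : ∀ s, u s ≠ y₀) :
    ∃ κ : ℂ → C(X, ℂ), AnalyticAt ℂ κ y₀ ∧ ∀ᶠ y in 𝓝 y₀, ∀ s, κ y s = (u s - y)⁻¹ := by
  let f : ℂ → C(X, ℂ) := fun y => u - algebraMap ℂ C(X, ℂ) y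
  have hf : AnalyticAt ℂ f y₀ :=
    analyticAt_const.sub (ContinuousLinearMap.analyticAt (algebraMapCLM ℂ C(X, ℂ)) y₀)
  have hunit : ∀ y, (∀ s, u s ≠ y) → IsUnit (f y) := fun y hy => by
    rw [ContinuousMap.isUnit_iff_forall_ne_zero]
    intro s
    simpa [f, sub_eq_zero] using hy s
  obtain ⟨v, hv⟩ := hunit y₀ h
  refine ⟨fun y => Ring.inverse (f y), ?_, ?_⟩
  · have := analyticAt_inverse (𝕜 := ℂ) v
    rw [hv] at this
    exact AnalyticAt.fun_comp this hf
  · have h1 : ∀ᶠ y in 𝓝 y₀, IsUnit (f y) := hf.continuousAt.eventually_mem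
      (Units.isOpen.mem_nhds (hunit y₀ h))
    filter_upwards [h1] with y hy s
    have h2 := congrArg (fun g : C(X, ℂ) => g s) (Ring.inverse_mul_cancel _ hy)
    simp only [ContinuousMap.mul_apply, ContinuousMap.one_apply] at h2
    exact eq_inv_of_mul_eq_one_left h2

/-- Osgood's lemma in two variables. -/
theorem analyticAt_of_separately {f : ℂ × ℂ → ℂ} {z₀ : ℂ × ℂ} {r : ℝ} (hr : 0 < r)
    (hc : ContinuousOn f (Metric.ball z₀ r))
    (h1 : ∀ z ∈ Metric.ball z₀ r, DifferentiableAt ℂ (fun x => f (x, z.2)) z.1)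
    (h2 : ∀ z ∈ Metric.ball z₀ r, DifferentiableAt ℂ (fun y => f (z.1, y)) z.2) :
    AnalyticAt ℂ f z₀ := by
  obtain ⟨x₀, y₀⟩ := z₀
  have hr2 : 0 < r / 2 := by positivity
  have hmem : ∀ {x y : ℂ}, x ∈ Metric.closedBall x₀ (r / 2) → y ∈ Metric.closedBall y₀ (r / 2) →
      (x, y) ∈ Metric.ball (x₀, y₀) r := fun {x y} hx hy => by
    rw [← ball_prod_same]
    exact ⟨Metric.closedBall_subset_ball (by linarith) hx,
      Metric.closedBall_subset_ball (by linarith) hy⟩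
  let u : C(Set.Icc 0 (2 * Real.pi), ℂ) :=
    ⟨fun θ => circleMap y₀ (r / 2) θ, (continuous_circleMap _ _).comp continuous_subtype_val⟩
  let w : C(Set.Icc 0 (2 * Real.pi), ℂ) :=
    ⟨fun θ => deriv (circleMap y₀ (r / 2)) θ, by
      simp only [deriv_circleMap]
      exact ((continuous_circleMap _ _).comp continuous_subtype_val).mul continuous_const⟩
  have hcirc : ∀ θ, circleMap y₀ (r / 2) θ ∈ Metric.closedBall y₀ (r / 2) := fun θ =>
    Metric.sphere_subset_closedBall (circleMap_mem_sphere _ hr2.le θ)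
  obtain ⟨Φ, hΦ, hΦf⟩ := analyticAt_curry (x₀ := x₀) (r := r / 2)
    (g := fun x (θ : Set.Icc 0 (2 * Real.pi)) => f (x, circleMap y₀ (r / 2) θ)) hr2
    (by
      refine hc.comp (f := fun p : ℂ × Set.Icc 0 (2 * Real.pi) =>
        (p.1, circleMap y₀ (r / 2) p.2)) ?_ fun p hp => hmem hp.1 (hcirc _)
      exact (continuous_fst.prodMk ((continuous_circleMap _ _).comp
        (continuous_subtype_val.comp continuous_snd))).continuousOn)
    (fun θ x hx => (h1 _ (hmem hx (hcirc θ))).differentiableWithinAt)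
  obtain ⟨κ, hκ, hκu⟩ := analyticAt_inverse_sub u (y₀ := y₀) (fun θ h => by
    exact circleMap_ne_center (R := r / 2) hr2.ne' h)
  let I := integralCLM 0 (2 * Real.pi) Real.two_pi_pos.le
  -- In Cauchy's formula in `y`, the variable `x` enters through `Φ` only and `y` through `κ` only;
  -- the integral itself is a continuous linear functional.
  have hF : AnalyticAt ℂ (fun z : ℂ × ℂ => (2 * Real.pi * Complex.I : ℂ)⁻¹ *
      I (w * κ z.2 * Φ z.1)) (x₀, y₀) := by
    refine analyticAt_const.mul ((I.analyticAt _).fun_comp ?_)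
    exact (analyticAt_const.mul (AnalyticAt.fun_comp (g := κ) hκ analyticAt_snd)).mul
      (AnalyticAt.fun_comp (g := Φ) hΦ analyticAt_fst)
  refine hF.congr ?_
  have hb1 : ∀ᶠ z : ℂ × ℂ in 𝓝 (x₀, y₀), z.1 ∈ Metric.ball x₀ (r / 2) :=
    continuous_fst.continuousAt.eventually_mem (Metric.ball_mem_nhds _ hr2)
  have hb2 : ∀ᶠ z : ℂ × ℂ in 𝓝 (x₀, y₀), z.2 ∈ Metric.ball y₀ (r / 2) :=
    continuous_snd.continuousAt.eventually_mem (Metric.ball_mem_nhds _ hr2)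
  have hk2 : ∀ᶠ z : ℂ × ℂ in 𝓝 (x₀, y₀), ∀ s, κ z.2 s = (u s - z.2)⁻¹ :=
    (continuous_snd.continuousAt (x := (x₀, y₀))).eventually hκu
  filter_upwards [hb1, hb2, hk2] with z hz1 hz2 hz3
  have hd : DifferentiableOn ℂ (fun y => f (z.1, y)) (Metric.closedBall y₀ (r / 2)) :=
    fun y hy => (h2 (z.1, y) (hmem (Metric.ball_subset_closedBall hz1) hy)).differentiableWithinAt
  have := hd.circleIntegral_sub_inv_smul hz2
  rw [integralCLM_apply (h := fun θ => deriv (circleMap y₀ (r / 2)) θ •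
    ((circleMap y₀ (r / 2) θ - z.2)⁻¹ • f (z.1, circleMap y₀ (r / 2) θ)))]
  · rw [circleIntegral] at this
    rw [this, smul_eq_mul, inv_mul_cancel_left₀ Complex.two_pi_I_ne_zero]
  · intro θ
    rw [ContinuousMap.mul_apply, ContinuousMap.mul_apply, hz3, hΦf _ hz1]
    simp [u, w, mul_assoc]

/-- Osgood's lemma applies: currying gives joint continuity of the integral, and `analyticAt_curry`
gives holomorphy in each variable separately. -/
theorem analyticAt_intervalIntegral {h : ℂ × ℂ → ℝ → ℂ} {z₀ : ℂ × ℂ} {a b r : ℝ} (hab : a ≤ b)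
    (hr : 0 < r)
    (hc : ContinuousOn (Function.uncurry h) (Metric.ball z₀ r ×ˢ Set.Icc a b))
    (hd : ∀ θ ∈ Set.Icc a b, ∀ z ∈ Metric.ball z₀ r, DifferentiableAt ℂ (fun z => h z θ) z) :
    AnalyticAt ℂ (fun z => ∫ θ in a..b, h z θ) z₀ := by
  have hc' : ContinuousOn (Function.uncurry fun z (θ : Set.Icc a b) => h z θ)
      (Metric.ball z₀ r ×ˢ Set.univ) :=
    hc.comp (f := fun p : (ℂ × ℂ) × Set.Icc a b => (p.1, (p.2 : ℝ))) (by fun_prop)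
      (fun p hp => ⟨hp.1, p.2.2⟩)
  refine analyticAt_of_separately hr ?_ ?_ ?_
  · obtain ⟨Φ, hΦ, hΦh⟩ := continuousOn_curry hc'
    refine ((integralCLM a b hab).continuous.comp_continuousOn hΦ).congr fun z hz => ?_
    exact (integralCLM_apply hab _ (hΦh z hz)).symm
  · rintro ⟨x, y⟩ hz
    obtain ⟨ε, hε, hsub⟩ := Metric.isOpen_iff.1 Metric.isOpen_ball _ hz
    have hin : ∀ x' ∈ Metric.closedBall x (ε / 2), (x', y) ∈ Metric.ball z₀ r := fun x' hx' => by
      refine hsub ?_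
      rw [← ball_prod_same]
      exact ⟨Metric.closedBall_subset_ball (by linarith) hx', Metric.mem_ball_self hε⟩
    obtain ⟨Φ, hΦ, hΦh⟩ := analyticAt_curry (X := Set.Icc a b) (x₀ := x) (r := ε / 2)
      (g := fun x' θ => h (x', y) θ) (by positivity)
      (hc'.comp (f := fun p : ℂ × Set.Icc a b => ((p.1, y), p.2)) (by fun_prop)
        (fun p hp => ⟨hin _ hp.1, trivial⟩))
      (fun θ x' hx' => (DifferentiableAt.fun_comp' (g := fun z => h z θ) (f := fun x' => (x', y)) x'
        (hd θ θ.2 _ (hin x' hx')) (differentiableAt_id.prodMk (differentiableAt_const y))).differentiableWithinAt)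
    refine DifferentiableAt.congr_of_eventuallyEq
      ((integralCLM a b hab).differentiableAt.comp x hΦ.differentiableAt) ?_
    filter_upwards [Metric.ball_mem_nhds x (half_pos hε)] with x' hx'
    exact (integralCLM_apply hab _ (hΦh x' hx')).symm
  · rintro ⟨x, y⟩ hz
    obtain ⟨ε, hε, hsub⟩ := Metric.isOpen_iff.1 Metric.isOpen_ball _ hz
    have hin : ∀ y' ∈ Metric.closedBall y (ε / 2), (x, y') ∈ Metric.ball z₀ r := fun x' hx' => by
      refine hsub ?_
      rw [← ball_prod_same]
      exact ⟨Metric.mem_ball_self hε, Metric.closedBall_subset_ball (by linarith) hx'⟩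
    obtain ⟨Φ, hΦ, hΦh⟩ := analyticAt_curry (X := Set.Icc a b) (x₀ := y) (r := ε / 2)
      (g := fun y' θ => h (x, y') θ) (by positivity)
      (hc'.comp (f := fun p : ℂ × Set.Icc a b => ((x, p.1), p.2)) (by fun_prop)
        (fun p hp => ⟨hin _ hp.1, trivial⟩))
      (fun θ y' hy' => (DifferentiableAt.fun_comp' (g := fun z => h z θ) (f := fun y' => (x, y')) y'
        (hd θ θ.2 _ (hin y' hy')) ((differentiableAt_const x).prodMk differentiableAt_id)).differentiableWithinAt)
    refine DifferentiableAt.congr_of_eventuallyEq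
      ((integralCLM a b hab).differentiableAt.comp y hΦ.differentiableAt) ?_
    filter_upwards [Metric.ball_mem_nhds y (half_pos hε)] with y' hy'
    exact (integralCLM_apply hab _ (hΦh y' hy')).symm

/-- A circle integral depends analytically on two parameters. -/
theorem analyticAt_circleIntegral {g : (ℂ × ℂ) × ℂ → ℂ} {z₀ : ℂ × ℂ} {c : ℂ} {ρ : ℝ}
    (hρ : 0 ≤ ρ) (hg : ∀ s ∈ Metric.sphere c ρ, AnalyticAt ℂ g (z₀, s)) :
    AnalyticAt ℂ (fun z => ∮ s in C(c, ρ), g (z, s)) z₀ := by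
  -- The analyticity locus is open and the circle is compact, so analyticity holds on a product
  -- neighbourhood.
  obtain ⟨u, v, hu, -, hzu, hsv, huv⟩ := generalized_tube_lemma (isCompact_singleton (x := z₀))
    (isCompact_sphere c ρ) (isOpen_analyticAt ℂ g) (by
      rintro ⟨z, s⟩ ⟨hz, hs⟩
      rw [Set.mem_singleton_iff] at hz
      subst hz
      exact hg s hs)
  obtain ⟨r, hr, hru⟩ := Metric.isOpen_iff.1 hu z₀ (hzu rfl)
  have hmem : ∀ z ∈ Metric.ball z₀ r, ∀ θ, AnalyticAt ℂ g (z, circleMap c ρ θ) := fun z hz θ =>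
    huv ⟨hru hz, hsv (circleMap_mem_sphere _ hρ θ)⟩
  refine analyticAt_intervalIntegral Real.two_pi_pos.le hr ?_ ?_
  · rintro ⟨z, θ⟩ ⟨hz, -⟩
    refine ContinuousAt.continuousWithinAt ?_
    simp only [deriv_circleMap, smul_eq_mul]
    refine ContinuousAt.mul (Continuous.continuousAt ?_) ?_
    · exact ((continuous_circleMap _ _).comp continuous_snd).mul continuous_const
    · exact ContinuousAt.comp' (g := g) (f := fun p : (ℂ × ℂ) × ℝ => (p.1, circleMap c ρ p.2))
        (hmem z hz θ).continuousAt
        (continuous_fst.prodMk ((continuous_circleMap _ _).comp continuous_snd)).continuousAt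
  · intro θ _ z hz
    have h1 : DifferentiableAt ℂ (fun z => g (z, circleMap c ρ θ)) z :=
      DifferentiableAt.fun_comp' (g := g) (f := fun z => (z, circleMap c ρ θ)) z
        (hmem z hz θ).differentiableAt (differentiableAt_id.prodMk (differentiableAt_const _))
    exact h1.const_smul (deriv (circleMap c ρ) θ)

/-- Division of `f(x,y) - f(x,0)` by `y`. -/
theorem exists_analyticAt_sub_eq_mul {f : ℂ × ℂ → ℂ} {x₀ : ℂ} (hf : AnalyticAt ℂ f (x₀, 0)) :
    ∃ g : ℂ × ℂ → ℂ, AnalyticAt ℂ g (x₀, 0) ∧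
      ∀ᶠ z in 𝓝 (x₀, (0 : ℂ)), f z - f (z.1, 0) = z.2 * g z := by
  obtain ⟨r, hr, hsub⟩ := Metric.eventually_nhds_iff_ball.1 hf.eventually_analyticAt
  have hr2 : 0 < r / 2 := by positivity
  rw [← ball_prod_same] at hsub
  -- The kernel comes from 1/(w - y) - 1/w = y / (w (w - y)): the Cauchy formula at `y` minus the
  -- one at 0 has the factor `y`.
  refine ⟨fun z => (2 * Real.pi * Complex.I : ℂ)⁻¹ *
    ∮ w in C(0, r / 2), w⁻¹ * (w - z.2)⁻¹ * f (z.1, w), ?_, ?_⟩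
  · refine analyticAt_const.mul (analyticAt_circleIntegral
      (g := fun p : (ℂ × ℂ) × ℂ => p.2⁻¹ * (p.2 - p.1.2)⁻¹ * f (p.1.1, p.2)) hr2.le
      fun s hs => ?_)
    have hs0 : s ≠ 0 := by
      rintro rfl
      simp only [Metric.mem_sphere, dist_self] at hs
      exact hr2.ne hs
    refine (AnalyticAt.mul (analyticAt_snd.inv hs0) (AnalyticAt.inv (by fun_prop)
      (by simpa using hs0))).mul ?_
    refine AnalyticAt.fun_comp (g := f) (f := fun p : (ℂ × ℂ) × ℂ => (p.1.1, p.2)) ?_ (by fun_prop)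
    exact hsub _ ⟨Metric.mem_ball_self hr,
      Metric.sphere_subset_closedBall.trans (Metric.closedBall_subset_ball (by linarith)) hs⟩
  · filter_upwards [prod_mem_nhds (Metric.ball_mem_nhds x₀ hr)
      (Metric.ball_mem_nhds (0 : ℂ) hr2)] with z hz
    have hd : DifferentiableOn ℂ (fun w => f (z.1, w)) (Metric.closedBall 0 (r / 2)) :=
      fun w hw => (DifferentiableAt.fun_comp' (g := f) (f := fun w => (z.1, w)) w
        (hsub (z.1, w) ⟨hz.1, Metric.closedBall_subset_ball (by linarith) hw⟩).differentiableAt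
        ((differentiableAt_const _).prodMk differentiableAt_id)).differentiableWithinAt
    have h0 := hd.circleIntegral_sub_inv_smul (Metric.mem_ball_self hr2)
    have h1 := hd.circleIntegral_sub_inv_smul hz.2
    have hns : ∀ w ∈ Metric.sphere (0 : ℂ) (r / 2), w ≠ 0 ∧ w - z.2 ≠ 0 := fun w hw => by
      constructor
      · rintro rfl
        simp only [Metric.mem_sphere, dist_self] at hw
        exact hr2.ne hw
      · intro h
        rw [sub_eq_zero] at h
        subst h
        exact absurd hw (Metric.mem_ball.1 hz.2).ne
    have hci : ∀ c ∈ Metric.ball (0 : ℂ) (r / 2),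
        CircleIntegrable (fun w => (w - c)⁻¹ • f (z.1, w)) 0 (r / 2) := fun c hc => by
      refine ContinuousOn.circleIntegrable hr2.le (ContinuousOn.smul (ContinuousOn.inv₀
        (continuous_id.sub continuous_const).continuousOn ?_)
        (hd.continuousOn.mono Metric.sphere_subset_closedBall))
      intro w hw h
      replace h : w - c = 0 := h
      rw [sub_eq_zero] at h
      subst h
      exact absurd hw (Metric.mem_ball.1 hc).ne
    have h2 : z.2 * (∮ w in C(0, r / 2), w⁻¹ * (w - z.2)⁻¹ * f (z.1, w)) =
        (∮ w in C(0, r / 2), (w - z.2)⁻¹ • f (z.1, w)) -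
          ∮ w in C(0, r / 2), (w - 0)⁻¹ • f (z.1, w) := by
      rw [← circleIntegral.integral_sub (hci _ hz.2) (hci _ (Metric.mem_ball_self hr2)),
        ← circleIntegral.integral_const_mul]
      refine circleIntegral.integral_congr hr2.le fun w hw => ?_
      obtain ⟨hw0, hwz⟩ := hns w hw
      simp only [smul_eq_mul, sub_zero]
      field_simp
      ring
    rw [mul_left_comm, h2, h0, h1, ← smul_sub, smul_eq_mul,
      inv_mul_cancel_left₀ Complex.two_pi_I_ne_zero]

/-- A function holomorphic on the product of a connected open set and a punctured disc which
extends across the puncture somewhere extends across it everywhere. -/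
theorem extends_of_extends {f : ℂ × ℂ → ℂ} {U : Set ℂ} {R : ℝ}
    (hU : IsOpen U) (hUc : IsPreconnected U) (hR : 0 < R)
    (hf : ∀ x ∈ U, ∀ y, y ≠ 0 → ‖y‖ < R → AnalyticAt ℂ f (x, y)) {x₁ : ℂ} (hx₁ : x₁ ∈ U)
    (h₁ : ∃ h, AnalyticAt ℂ h (x₁, (0 : ℂ)) ∧ ∀ᶠ z in 𝓝 (x₁, (0 : ℂ)), z.2 ≠ 0 → f z = h z)
    {x₀ : ℂ} (hx₀ : x₀ ∈ U) :
    ∃ h, AnalyticAt ℂ h (x₀, (0 : ℂ)) ∧ ∀ᶠ z in 𝓝 (x₀, (0 : ℂ)), z.2 ≠ 0 → f z = h z := by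
  have hr : 0 < R / 2 := by positivity
  -- The integration circle stays away from the puncture, so `H` is holomorphic across y = 0
  -- unconditionally. What must be shown is that `f` equals `H`.
  set H : ℂ × ℂ → ℂ := fun z => (2 * Real.pi * Complex.I : ℂ)⁻¹ *
    ∮ w in C(0, R / 2), (w - z.2)⁻¹ * f (z.1, w) with hH
  have hHan : ∀ x ∈ U, ∀ y, ‖y‖ < R / 2 → AnalyticAt ℂ H (x, y) := by
    intro x hx y hy
    refine analyticAt_const.mul (analyticAt_circleIntegral
      (g := fun p : (ℂ × ℂ) × ℂ => (p.2 - p.1.2)⁻¹ * f (p.1.1, p.2)) hr.le fun s hs => ?_)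
    have hs' : ‖s‖ = R / 2 := by simpa using hs
    refine AnalyticAt.mul (AnalyticAt.inv (by fun_prop) ?_) ?_
    · intro h
      rw [sub_eq_zero] at h
      simp only at h
      rw [h] at hs'
      exact hy.ne hs'
    · refine AnalyticAt.fun_comp (g := f) (f := fun p : (ℂ × ℂ) × ℂ => (p.1.1, p.2)) ?_
        (by fun_prop)
      refine hf x hx s ?_ (by rw [hs']; linarith)
      rw [← norm_pos_iff, hs']
      exact hr
  -- For fixed `y`, equality is established near `x₁`, where the extension exists, and carried over
  -- `U` by the identity theorem in `x`.
  have key : ∀ y : ℂ, y ≠ 0 → ‖y‖ < R / 2 → ∀ x ∈ U, f (x, y) = H (x, y) := by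
    intro y hy0 hyR
    have hslice : ∀ x : ℂ, AnalyticAt ℂ (fun x : ℂ => (x, y)) x := fun x => by fun_prop
    have e1 : AnalyticOnNhd ℂ (fun x => f (x, y)) U := fun x hx =>
      AnalyticAt.fun_comp (g := f) (f := fun x : ℂ => (x, y)) (hf x hx y hy0 (by linarith)) (hslice x)
    have e2 : AnalyticOnNhd ℂ (fun x => H (x, y)) U := fun x hx =>
      AnalyticAt.fun_comp (g := H) (f := fun x : ℂ => (x, y)) (hHan x hx y hyR) (hslice x)
    refine e1.eqOn_of_preconnected_of_eventuallyEq e2 hUc hx₁ ?_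
    obtain ⟨h, hh, hfh⟩ := h₁
    obtain ⟨V, hV, W, hW, hVW⟩ := mem_nhds_prod_iff.1 (hh.eventually_analyticAt.and hfh)
    have hVW' : ∀ x ∈ V, ∀ y ∈ W, AnalyticAt ℂ h (x, y) ∧ (y ≠ 0 → f (x, y) = h (x, y)) :=
      fun x hx y hy => hVW ⟨hx, hy⟩
    filter_upwards [hV, hU.mem_nhds hx₁] with x hx hxU
    classical
    -- The slice of `f` with its puncture filled by the extension; it is holomorphic on the whole
    -- disc, so Cauchy's formula applies to it.
    set q : ℂ → ℂ := Function.update (fun w => f (x, w)) 0 (h (x, 0)) with hq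
    have hqd : DifferentiableOn ℂ q (Metric.closedBall 0 (R / 2)) := by
      intro w hw
      refine DifferentiableAt.differentiableWithinAt ?_
      by_cases hw0 : w = 0
      · subst hw0
        have hd : DifferentiableAt ℂ (fun w => h (x, w)) 0 :=
          DifferentiableAt.fun_comp' (g := h) (f := fun w => (x, w)) 0
            (hVW' x hx 0 (mem_of_mem_nhds hW)).1.differentiableAt
            ((differentiableAt_const _).prodMk differentiableAt_id)
        refine hd.congr_of_eventuallyEq ?_
        filter_upwards [hW] with w hw
        by_cases hw0 : w = 0
        · subst hw0; simp [hq]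
        · simp [hq, hw0, (hVW' x hx w hw).2 hw0]
      · have hd : DifferentiableAt ℂ (fun w => f (x, w)) w :=
          DifferentiableAt.fun_comp' (g := f) (f := fun w => (x, w)) w
            (hf x hxU w hw0 (by
              rw [mem_closedBall_zero_iff] at hw
              linarith)).differentiableAt
            ((differentiableAt_const _).prodMk differentiableAt_id)
        refine hd.congr_of_eventuallyEq ?_
        filter_upwards [isOpen_ne.mem_nhds hw0] with v hv
        simp [hq, hv]
    have hc := hqd.circleIntegral_sub_inv_smul (w := y) (by simpa using hyR)
    have hint : (∮ w in C(0, R / 2), (w - y)⁻¹ * f (x, w)) =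
        ∮ w in C(0, R / 2), (w - y)⁻¹ • q w := by
      refine circleIntegral.integral_congr hr.le fun w hw => ?_
      have hw0 : w ≠ 0 := by
        rintro rfl
        simp only [Metric.mem_sphere, dist_self] at hw
        exact hr.ne hw
      simp [hq, hw0]
    simp only [hH]
    rw [hint, hc, smul_eq_mul, inv_mul_cancel_left₀ Complex.two_pi_I_ne_zero, hq]
    simp [hy0]
  refine ⟨H, hHan x₀ hx₀ 0 (by simpa using hr), ?_⟩
  filter_upwards [prod_mem_nhds (hU.mem_nhds hx₀) (Metric.ball_mem_nhds (0 : ℂ) hr)] with z hz hz0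
  exact key z.2 hz0 (by simpa using hz.2) z.1 hz.1

end PlanarWeb
end

noncomputable section

namespace PlanarWeb

/-! ### Polynomials with analytic coefficients -/

open Polynomial in
/-- A family of polynomials of bounded degree with coefficients analytic at `z₀`. -/
structure AnalyticFamily (Q : Plane → Polynomial ℂ) (z₀ : Plane) : Prop where
  bound : ∃ N, ∀ z, (Q z).natDegree ≤ N
  coeff : ∀ i, AnalyticAt ℂ (fun z => (Q z).coeff i) z₀

namespace AnalyticFamily

open Polynomial

variable {Q : Plane → ℂ[X]} {z₀ : Plane}

theorem derivative (h : AnalyticFamily Q z₀) :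
    AnalyticFamily (fun z => Polynomial.derivative (Q z)) z₀ where
  bound := by
    obtain ⟨N, hN⟩ := h.bound
    exact ⟨N, fun z => (natDegree_derivative_le _).trans ((Nat.sub_le _ _).trans (hN z))⟩
  coeff i := by
    simp only [coeff_derivative]
    exact (h.coeff _).mul analyticAt_const

/-- The uniform degree bound turns evaluation into a sum over a fixed finite range of analytic
terms. -/
theorem eval (h : AnalyticFamily Q z₀) (p : ℂ) :
    AnalyticAt ℂ (fun q : Plane × ℂ => (Q q.1).eval q.2) (z₀, p) := by
  obtain ⟨N, hN⟩ := h.bound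
  have : (fun q : Plane × ℂ => (Q q.1).eval q.2) =
      fun q : Plane × ℂ => ∑ i ∈ Finset.range (N + 1), (Q q.1).coeff i * q.2 ^ i := by
    funext q
    exact eval_eq_sum_range' (Nat.lt_succ_of_le (hN _)) _
  rw [this]
  refine Finset.analyticAt_fun_sum _ fun i _ => AnalyticAt.mul ?_ (by fun_prop)
  exact AnalyticAt.fun_comp (g := fun z => (Q z).coeff i) (f := Prod.fst) (h.coeff i) analyticAt_fst

theorem eval_comp (h : AnalyticFamily Q z₀) {φ : Plane → ℂ} (hφ : AnalyticAt ℂ φ z₀) :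
    AnalyticAt ℂ (fun z => (Q z).eval (φ z)) z₀ :=
  AnalyticAt.fun_comp (g := fun q : Plane × ℂ => (Q q.1).eval q.2) (f := fun z => (z, φ z))
    (h.eval _) (analyticAt_id.prod hφ)

theorem eventually_eval_ne (h : AnalyticFamily Q z₀) {K : Set ℂ} (hK : IsCompact K)
    (hne : ∀ p ∈ K, (Q z₀).eval p ≠ 0) : ∀ᶠ z in 𝓝 z₀, ∀ p ∈ K, (Q z).eval p ≠ 0 := by
  refine hK.eventually_forall_of_forall_eventually fun p hp => ?_
  exact (h.eval p).continuousAt.eventually_ne (hne p hp)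

end AnalyticFamily

section Trace

open Polynomial

theorem circleIntegrable_sub_inv_mul {c p : ℂ} {ρ : ℝ} {k : ℂ → ℂ} (hρ : 0 ≤ ρ)
    (hk : ContinuousOn k (Metric.sphere c ρ)) (hp : p ∉ Metric.sphere c ρ) :
    CircleIntegrable (fun s => (s - p)⁻¹ * k s) c ρ := by
  refine ContinuousOn.circleIntegrable hρ (ContinuousOn.mul (ContinuousOn.inv₀
    (continuous_id.sub continuous_const).continuousOn ?_) hk)
  intro w hw h
  replace h : w - p = 0 := h
  rw [sub_eq_zero] at h
  subst h
  exact hp hw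

theorem circleIntegral_sub_inv_mul {c p : ℂ} {ρ : ℝ} {k : ℂ → ℂ} (hρ : 0 < ρ)
    (hk : DifferentiableOn ℂ k (Metric.closedBall c ρ)) (hp : p ∉ Metric.sphere c ρ) :
    (2 * Real.pi * Complex.I : ℂ)⁻¹ * (∮ s in C(c, ρ), (s - p)⁻¹ * k s) =
      open Classical in if p ∈ Metric.ball c ρ then k p else 0 := by
  split_ifs with hb
  · have := hk.circleIntegral_sub_inv_smul hb
    simp only [smul_eq_mul] at this
    rw [this, inv_mul_cancel_left₀ Complex.two_pi_I_ne_zero]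
  · have hd : DifferentiableOn ℂ (fun s => (s - p)⁻¹ * k s) (Metric.closedBall c ρ) := by
      refine DifferentiableOn.mul (DifferentiableOn.inv (by fun_prop) ?_) hk
      intro s hs h
      rw [sub_eq_zero] at h
      subst h
      simp only [Metric.mem_closedBall, Metric.mem_sphere, Metric.mem_ball] at hs hp hb
      exact hp (le_antisymm hs (not_lt.1 hb))
    have := (hd.diffContOnCl_ball le_rfl).circleIntegral_eq_zero hρ.le
    rw [this, mul_zero]

/-- Partial fractions, read off from Lagrange interpolation of the constant 1 at the roots, whose
weights are the reciprocals of the derivative of the nodal polynomial. Positive degree is needed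
since interpolation at no nodes gives 0. -/
theorem inv_eval_eq_sum {Q : ℂ[X]} (hd : 0 < Q.natDegree) (hQ : Q.roots.Nodup) {s : ℂ}
    (hs : Q.eval s ≠ 0) :
    (Q.eval s)⁻¹ = ∑ p ∈ Q.roots.toFinset, (Q.derivative.eval p)⁻¹ * (s - p)⁻¹ := by
  have hQ0 : Q ≠ 0 := by rintro rfl; simp at hs
  have hsplit := IsAlgClosed.splits Q
  have hprod : Q = C Q.leadingCoeff * Lagrange.nodal Q.roots.toFinset id := by
    conv_lhs => rw [hsplit.eq_prod_roots]
    rw [Lagrange.nodal_eq, Finset.prod_eq_multiset_prod, Multiset.toFinset_val,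
      Multiset.dedup_eq_self.2 hQ]
    rfl
  have hl : Q.leadingCoeff ≠ 0 := leadingCoeff_ne_zero.2 hQ0
  have hne : Q.roots.toFinset.Nonempty := by
    rw [Multiset.toFinset_nonempty, ← Multiset.card_pos, ← hsplit.natDegree_eq_card_roots]
    exact hd
  have hsr : ∀ i ∈ Q.roots.toFinset, s ≠ id i := by
    intro i hi h
    rw [Multiset.mem_toFinset, mem_roots hQ0] at hi
    exact hs (by rw [h]; exact hi)
  have h1 := Lagrange.eval_interpolate_not_at_node (s := Q.roots.toFinset) (v := id) 1 hsr
  rw [Lagrange.interpolate_one Function.injective_id.injOn hne, eval_one] at h1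
  have hes : Q.eval s = Q.leadingCoeff * eval s (Lagrange.nodal Q.roots.toFinset id) := by
    conv_lhs => rw [hprod]
    simp
  have hes0 : eval s (Lagrange.nodal Q.roots.toFinset id) ≠ 0 := fun h => hs (by simp [hes, h])
  have h2 : (eval s (Lagrange.nodal Q.roots.toFinset id))⁻¹ = ∑ i ∈ Q.roots.toFinset,
      Lagrange.nodalWeight Q.roots.toFinset id i * (s - i)⁻¹ := by
    refine inv_eq_of_mul_eq_one_right ?_
    simpa using h1.symm
  rw [hes, mul_inv, h2, Finset.mul_sum]
  refine Finset.sum_congr rfl fun i hi => ?_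
  have hder : Q.derivative.eval i =
      Q.leadingCoeff * (Lagrange.nodal Q.roots.toFinset id).derivative.eval i := by
    conv_lhs => rw [hprod]
    simp
  rw [hder, Lagrange.nodalWeight_eq_eval_derivative_nodal hi, mul_inv, mul_assoc]
  rfl

/-- The sum of `k / Q'` over the (simple) roots of `Q` in a disc, as a contour integral. -/
theorem circleIntegral_inv_eval_mul {Q : ℂ[X]} (hd : 0 < Q.natDegree) (hQ : Q.roots.Nodup)
    {c : ℂ} {ρ : ℝ} {k : ℂ → ℂ} (hρ : 0 < ρ) (hk : DifferentiableOn ℂ k (Metric.closedBall c ρ))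
    (hs : ∀ s ∈ Metric.sphere c ρ, Q.eval s ≠ 0) :
    (2 * Real.pi * Complex.I : ℂ)⁻¹ * (∮ s in C(c, ρ), (Q.eval s)⁻¹ * k s) =
      open Classical in ∑ p ∈ Q.roots.toFinset with p ∈ Metric.ball c ρ,
        (Q.derivative.eval p)⁻¹ * k p := by
  classical
  have hQ0 : Q ≠ 0 := by rintro rfl; simp at hd
  have hroot : ∀ p ∈ Q.roots.toFinset, p ∉ Metric.sphere c ρ := fun p hp hps =>
    hs p hps (by rwa [Multiset.mem_toFinset, mem_roots hQ0] at hp)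
  have h1 : (∮ s in C(c, ρ), (Q.eval s)⁻¹ * k s) =
      ∮ s in C(c, ρ), ∑ p ∈ Q.roots.toFinset, (Q.derivative.eval p)⁻¹ * ((s - p)⁻¹ * k s) := by
    refine circleIntegral.integral_congr hρ.le fun s hss => ?_
    rw [inv_eval_eq_sum hd hQ (hs s hss), Finset.sum_mul]
    exact Finset.sum_congr rfl fun p _ => mul_assoc _ _ _
  have hint : ∀ p ∈ Q.roots.toFinset, CircleIntegrable (fun s => (s - p)⁻¹ * k s) c ρ :=
    fun p hp => circleIntegrable_sub_inv_mul hρ.le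
      (hk.continuousOn.mono Metric.sphere_subset_closedBall) (hroot p hp)
  have hint' : ∀ p ∈ Q.roots.toFinset,
      CircleIntegrable (fun s => (Q.derivative.eval p)⁻¹ * ((s - p)⁻¹ * k s)) c ρ :=
    fun p hp => (hint p hp).const_smul
  rw [h1, circleIntegral.integral_fun_sum hint', Finset.mul_sum,
    Finset.sum_filter]
  refine Finset.sum_congr rfl fun p hp => ?_
  rw [circleIntegral.integral_const_mul, mul_left_comm,
    circleIntegral_sub_inv_mul hρ hk (hroot p hp)]
  split_ifs <;> simp

/-- The sum of `k` over the roots of `Q` in a disc, as a contour integral. -/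
theorem circleIntegral_logDeriv_mul {Q : ℂ[X]} {c : ℂ} {ρ : ℝ} {k : ℂ → ℂ} (hρ : 0 < ρ)
    (hk : DifferentiableOn ℂ k (Metric.closedBall c ρ))
    (hs : ∀ s ∈ Metric.sphere c ρ, Q.eval s ≠ 0) :
    (2 * Real.pi * Complex.I : ℂ)⁻¹ * (∮ s in C(c, ρ), Q.derivative.eval s / Q.eval s * k s) =
      open Classical in ((Q.roots.filter (· ∈ Metric.ball c ρ)).map k).sum := by
  classical
  have hQ0 : Q ≠ 0 := by
    rintro rfl
    refine hs (c + ρ) ?_ (by simp)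
    simp [abs_of_pos hρ]
  have hroot : ∀ p ∈ Q.roots.toFinset, p ∉ Metric.sphere c ρ := fun p hp hps =>
    hs p hps (by rwa [Multiset.mem_toFinset, mem_roots hQ0] at hp)
  have h1 : (∮ s in C(c, ρ), Q.derivative.eval s / Q.eval s * k s) =
      ∮ s in C(c, ρ), ∑ p ∈ Q.roots.toFinset, (Q.roots.count p : ℂ) * ((s - p)⁻¹ * k s) := by
    refine circleIntegral.integral_congr hρ.le fun s hss => ?_
    rw [(IsAlgClosed.splits Q).eval_derivative_div_eval_of_ne_zero (hs s hss),
      Finset.sum_multiset_map_count, Finset.sum_mul]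
    refine Finset.sum_congr rfl fun p _ => ?_
    simp [mul_assoc]
  have hint : ∀ p ∈ Q.roots.toFinset, CircleIntegrable (fun s => (s - p)⁻¹ * k s) c ρ :=
    fun p hp => circleIntegrable_sub_inv_mul hρ.le
      (hk.continuousOn.mono Metric.sphere_subset_closedBall) (hroot p hp)
  have hint' : ∀ p ∈ Q.roots.toFinset,
      CircleIntegrable (fun s => (Q.roots.count p : ℂ) * ((s - p)⁻¹ * k s)) c ρ :=
    fun p hp => (hint p hp).const_smul
  rw [h1, circleIntegral.integral_fun_sum hint', Finset.mul_sum,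
    Finset.sum_multiset_map_count, Multiset.toFinset_filter, Finset.sum_filter]
  refine Finset.sum_congr rfl fun p hp => ?_
  rw [circleIntegral.integral_const_mul, mul_left_comm,
    circleIntegral_sub_inv_mul hρ hk (hroot p hp)]
  split_ifs with hb
  · simp only [nsmul_eq_mul]
    rw [Multiset.count_filter_of_pos hb]
  · simp

variable {Q : Plane → ℂ[X]} {z₀ : Plane}

theorem analyticAt_circleIntegral_logDeriv (h : AnalyticFamily Q z₀) {c : ℂ} {ρ : ℝ}
    {k : ℂ → ℂ} (hρ : 0 < ρ) (hk : ∀ s, AnalyticAt ℂ k s)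
    (hs : ∀ s ∈ Metric.sphere c ρ, (Q z₀).eval s ≠ 0) :
    AnalyticAt ℂ (fun z => (2 * Real.pi * Complex.I : ℂ)⁻¹ *
      (∮ s in C(c, ρ), (Q z).derivative.eval s / (Q z).eval s * k s)) z₀ := by
  refine analyticAt_const.mul (analyticAt_circleIntegral (g := fun q : Plane × ℂ =>
    (Q q.1).derivative.eval q.2 / (Q q.1).eval q.2 * k q.2) hρ.le fun s hss => ?_)
  exact ((h.derivative.eval s).div (h.eval s) (hs s hss)).mul
    (AnalyticAt.fun_comp (g := k) (f := Prod.snd) (hk s) analyticAt_snd)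

open Classical in
/-- The number of roots in a disc is locally constant. -/
theorem eventually_card_roots_eq (h : AnalyticFamily Q z₀) {c : ℂ} {ρ : ℝ} (hρ : 0 < ρ)
    (hs : ∀ s ∈ Metric.sphere c ρ, (Q z₀).eval s ≠ 0) :
    ∀ᶠ z in 𝓝 z₀, ((Q z).roots.filter (· ∈ Metric.ball c ρ)).card =
      ((Q z₀).roots.filter (· ∈ Metric.ball c ρ)).card := by
  have han := analyticAt_circleIntegral_logDeriv h hρ (k := fun _ => 1)
    (fun _ => analyticAt_const) hs
  have hcount : ∀ z, (∀ s ∈ Metric.sphere c ρ, (Q z).eval s ≠ 0) →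
      (2 * Real.pi * Complex.I : ℂ)⁻¹ *
        (∮ s in C(c, ρ), (Q z).derivative.eval s / (Q z).eval s * 1) =
      (((Q z).roots.filter (· ∈ Metric.ball c ρ)).card : ℂ) := fun z hz => by
    rw [circleIntegral_logDeriv_mul hρ (differentiableOn_const _) hz]
    simp
  -- The contour integral is continuous and takes integer values, so a variation below 1 is none at
  -- all.
  have h1 := Metric.continuousAt_iff'.1 han.continuousAt 1 one_pos
  filter_upwards [h1, h.eventually_eval_ne (isCompact_sphere c ρ) hs] with z hz1 hz2
  rw [hcount z hz2, hcount z₀ hs, dist_eq_norm] at hz1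
  have h3 : ‖((((Q z).roots.filter (· ∈ Metric.ball c ρ)).card : ℤ) -
      (((Q z₀).roots.filter (· ∈ Metric.ball c ρ)).card : ℤ) : ℤ)‖ < 1 := by
    rw [← Int.norm_cast_real, ← Complex.norm_real]
    push_cast
    exact hz1
  rw [Int.norm_eq_abs] at h3
  have h4 : |((((Q z).roots.filter (· ∈ Metric.ball c ρ)).card : ℤ) -
      (((Q z₀).roots.filter (· ∈ Metric.ball c ρ)).card : ℤ) : ℤ)| < 1 := by exact_mod_cast h3
  rw [Int.abs_lt_one_iff] at h4
  omega

open Classical in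
/-- If all the roots in a disc coincide, they depend analytically on the parameters. -/
theorem exists_analyticAt_root (h : AnalyticFamily Q z₀) {c : ℂ} {ρ : ℝ} (hρ : 0 < ρ)
    (hs : ∀ s ∈ Metric.sphere c ρ, (Q z₀).eval s ≠ 0)
    (hn : ((Q z₀).roots.filter (· ∈ Metric.ball c ρ)).card ≠ 0) :
    ∃ φ : Plane → ℂ, AnalyticAt ℂ φ z₀ ∧ ∀ᶠ z in 𝓝 z₀, ∀ p,
      (∀ q ∈ (Q z).roots.filter (· ∈ Metric.ball c ρ), q = p) → φ z = p := by
  set N := ((Q z₀).roots.filter (· ∈ Metric.ball c ρ)).card with hN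
  -- The mean of the roots in the disc, which is the common root when they coincide.
  refine ⟨fun z => (N : ℂ)⁻¹ * ((2 * Real.pi * Complex.I : ℂ)⁻¹ *
      (∮ s in C(c, ρ), (Q z).derivative.eval s / (Q z).eval s * s)),
    analyticAt_const.mul (analyticAt_circleIntegral_logDeriv h hρ (k := fun s => s)
      (fun _ => analyticAt_id) hs), ?_⟩
  filter_upwards [eventually_card_roots_eq h hρ hs,
    h.eventually_eval_ne (isCompact_sphere c ρ) hs] with z hz1 hz2 p hp
  rw [circleIntegral_logDeriv_mul (k := fun s => s) hρ differentiableOn_id hz2,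
    Multiset.eq_replicate.2 ⟨hz1, hp⟩, Multiset.map_replicate, Multiset.sum_replicate, nsmul_eq_mul,
    inv_mul_cancel_left₀ (by exact_mod_cast hn)]

open Classical in
theorem exists_pos_radius (T : Finset ℂ) : ∃ ρ > 0, ∀ p ∈ T, ∀ q ∈ T, p ≠ q →
    2 * ρ < dist p q := by
  have h : ∀ᶠ ρ : ℝ in 𝓝[>] 0, ∀ p ∈ T, ∀ q ∈ T, p ≠ q → 2 * ρ < dist p q := by
    rw [Filter.eventually_all_finset]
    intro p _
    rw [Filter.eventually_all_finset]
    intro q _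
    by_cases hpq : p = q
    · simp [hpq]
    · have : Tendsto (fun ρ : ℝ => 2 * ρ) (𝓝[>] 0) (𝓝 (2 * 0)) :=
        (continuous_const.mul continuous_id).continuousAt.tendsto.mono_left nhdsWithin_le_nhds
      rw [mul_zero] at this
      filter_upwards [this.eventually_lt_const (dist_pos.2 hpq)] with ρ hρ _ using hρ
  obtain ⟨ρ, h1, h2⟩ := (h.and self_mem_nhdsWithin).exists
  exact ⟨ρ, h2, h1⟩

open Classical in
/-- At a generic point, the roots of a one-parameter family of polynomials are holomorphic
functions with constant multiplicities. -/
theorem exists_generic_factorization {U : Set ℂ} (hUne : U.Nonempty) (hU : IsOpen U) (d : ℕ)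
    (hfam : ∀ x ∈ U, AnalyticFamily Q (x, 0)) (hdeg : ∀ x ∈ U, (Q (x, 0)).natDegree = d)
    (h0 : ∀ x ∈ U, Q (x, 0) ≠ 0) :
    ∃ x₀ ∈ U, ∃ (n : ℕ) (φ : Fin n → ℂ → ℂ) (ν : Fin n → ℕ),
      (∀ α, AnalyticAt ℂ (φ α) x₀) ∧ (∀ α, 1 ≤ ν α) ∧ (∀ α β, α ≠ β → φ α x₀ ≠ φ β x₀) ∧
      ∀ᶠ x in 𝓝 x₀, Q (x, 0) = C (Q (x, 0)).leadingCoeff * ∏ α, (X - C (φ α x)) ^ ν α := by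
  -- A point with the maximal number of distinct roots. Nearby, each disc keeps at least one root,
  -- and maximality forbids a second distinct one, so clusters cannot split.
  obtain ⟨x₀, hx₀, hmax⟩ : ∃ x₀ ∈ U, ∀ x ∈ U,
      (Q (x, 0)).roots.toFinset.card ≤ (Q (x₀, 0)).roots.toFinset.card := by
    have hfin : ((fun x => (Q (x, 0)).roots.toFinset.card) '' U).Finite := by
      refine (Set.finite_Iic d).subset ?_
      rintro _ ⟨x, hx, rfl⟩
      exact (Multiset.toFinset_card_le _).trans ((card_roots' _).trans (hdeg x hx).le)
    obtain ⟨_, ⟨x₀, hx₀, rfl⟩, hm⟩ := Set.exists_max_image _ id hfin (hUne.image _)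
    exact ⟨x₀, hx₀, fun x hx => hm _ ⟨x, hx, rfl⟩⟩
  set T := (Q (x₀, 0)).roots.toFinset with hT
  obtain ⟨ρ, hρ, hsep⟩ := exists_pos_radius T
  have hTroot : ∀ p, p ∈ T ↔ (Q (x₀, 0)).eval p = 0 := fun p => by
    rw [hT, Multiset.mem_toFinset, mem_roots (h0 x₀ hx₀)]
    rfl
  have hs : ∀ p ∈ T, ∀ s ∈ Metric.sphere p ρ, (Q (x₀, 0)).eval s ≠ 0 := fun p hp s hs h => by
    have hsT := (hTroot s).2 h
    have hd : dist p s = ρ := by rw [dist_comm]; exact hs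
    have hps : p ≠ s := by
      rintro rfl
      rw [dist_self] at hd
      exact hρ.ne hd
    have := hsep p hp s hsT hps
    rw [hd] at this
    linarith
  set N : ℂ → ℕ := fun p => ((Q (x₀, 0)).roots.filter (· ∈ Metric.ball p ρ)).card with hN
  have hNpos : ∀ p ∈ T, 0 < N p := fun p hp => by
    rw [hN, Multiset.card_pos_iff_exists_mem]
    exact ⟨p, Multiset.mem_filter.2 ⟨Multiset.mem_toFinset.1 hp, Metric.mem_ball_self hρ⟩⟩
  have hφ : ∀ p ∈ T, ∃ φ : Plane → ℂ, AnalyticAt ℂ φ (x₀, 0) ∧ ∀ᶠ z in 𝓝 ((x₀, 0) : Plane), ∀ q,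
      (∀ q' ∈ (Q z).roots.filter (· ∈ Metric.ball p ρ), q' = q) → φ z = q := fun p hp =>
    exists_analyticAt_root (hfam x₀ hx₀) hρ (hs p hp) (hNpos p hp).ne'
  choose! φ hφan hφroot using hφ
  have hcard : ∀ᶠ z in 𝓝 ((x₀, 0) : Plane), ∀ p ∈ T,
      ((Q z).roots.filter (· ∈ Metric.ball p ρ)).card = N p := by
    rw [Filter.eventually_all_finset]
    exact fun p hp => eventually_card_roots_eq (hfam x₀ hx₀) hρ (hs p hp)
  have hφroot' : ∀ᶠ z in 𝓝 ((x₀, 0) : Plane), ∀ p ∈ T, ∀ q,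
      (∀ q' ∈ (Q z).roots.filter (· ∈ Metric.ball p ρ), q' = q) → φ p z = q := by
    rw [Filter.eventually_all_finset]
    exact hφroot
  have hline : ContinuousAt (fun x : ℂ => ((x, 0) : Plane)) x₀ := by fun_prop
  have hloc : ∀ᶠ x in 𝓝 x₀, ∀ p ∈ T, (φ p (x, 0)) ∈ Metric.ball p ρ ∧
      (Q (x, 0)).roots.filter (· ∈ Metric.ball p ρ) = Multiset.replicate (N p) (φ p (x, 0)) ∧
      ∀ q ∈ (Q (x, 0)).roots, ∃ p ∈ T, q ∈ Metric.ball p ρ := by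
    filter_upwards [hline.eventually hcard, hline.eventually hφroot', hU.mem_nhds hx₀]
      with x hx1 hx2 hxU
    have hex : ∀ p ∈ T, ∃ q, q ∈ (Q (x, 0)).roots ∧ q ∈ Metric.ball p ρ := fun p hp => by
      have : 0 < ((Q (x, 0)).roots.filter (· ∈ Metric.ball p ρ)).card := by
        rw [hx1 p hp]
        exact hNpos p hp
      obtain ⟨q, hq⟩ := Multiset.card_pos_iff_exists_mem.1 this
      exact ⟨q, Multiset.mem_filter.1 hq⟩
    choose! f hf1 hf2 using hex
    have hdisj : ∀ p ∈ T, ∀ p' ∈ T, ∀ q, q ∈ Metric.ball p ρ → q ∈ Metric.ball p' ρ → p = p' := by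
      intro p hp p' hp' q hq hq'
      by_contra hne
      have h1 := hsep p hp p' hp' hne
      have h2 := dist_triangle_left p p' q
      rw [Metric.mem_ball] at hq hq'
      linarith
    have hinj : Set.InjOn f T := fun p hp p' hp' h =>
      hdisj p hp p' hp' (f p) (hf2 p hp) (h ▸ hf2 p' hp')
    -- One root chosen in each of the disjoint discs already gives the maximal number of distinct
    -- roots, so there are no others.
    have himg : T.image f = (Q (x, 0)).roots.toFinset := by
      refine Finset.eq_of_subset_of_card_le ?_ ?_
      · intro q hq
        obtain ⟨p, hp, rfl⟩ := Finset.mem_image.1 hq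
        exact Multiset.mem_toFinset.2 (hf1 p hp)
      · rw [Finset.card_image_of_injOn hinj]
        exact hmax x hxU
    have hcover : ∀ q ∈ (Q (x, 0)).roots, ∃ p ∈ T, q = f p := fun q hq => by
      rw [← Multiset.mem_toFinset, ← himg] at hq
      obtain ⟨p, hp, rfl⟩ := Finset.mem_image.1 hq
      exact ⟨p, hp, rfl⟩
    have hall : ∀ p ∈ T, ∀ q ∈ (Q (x, 0)).roots.filter (· ∈ Metric.ball p ρ), q = f p := by
      intro p hp q hq
      obtain ⟨hq1, hq2⟩ := Multiset.mem_filter.1 hq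
      obtain ⟨p', hp', rfl⟩ := hcover q hq1
      rw [hdisj p hp p' hp' _ hq2 (hf2 p' hp')]
    intro p hp
    have hpf := hx2 p hp (f p) (hall p hp)
    refine ⟨hpf ▸ hf2 p hp, ?_, fun q hq => ?_⟩
    · rw [hpf]
      exact Multiset.eq_replicate.2 ⟨hx1 p hp, hall p hp⟩
    · obtain ⟨p, hp, rfl⟩ := hcover q hq
      exact ⟨p, hp, hf2 p hp⟩
  have hφ0 : ∀ p ∈ T, φ p (x₀, 0) = p := fun p hp => by
    have h1 := (hloc.self_of_nhds p hp).2.1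
    have h2 : p ∈ (Q (x₀, 0)).roots.filter (· ∈ Metric.ball p ρ) :=
      Multiset.mem_filter.2 ⟨Multiset.mem_toFinset.1 hp, Metric.mem_ball_self hρ⟩
    rw [h1] at h2
    exact (Multiset.eq_of_mem_replicate h2).symm
  let e := T.equivFin.symm
  refine ⟨x₀, hx₀, T.card, fun α x => φ (e α) (x, 0), fun α => N (e α), fun α => ?_,
    fun α => hNpos _ (e α).2, fun α β hαβ h => ?_, ?_⟩
  · exact AnalyticAt.fun_comp (g := φ (e α)) (f := fun x : ℂ => ((x, 0) : Plane))
      (hφan _ (e α).2) (by fun_prop)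
  · simp only [hφ0 _ (e _).2] at h
    exact hαβ (e.injective (Subtype.ext h))
  · filter_upwards [hloc, hU.mem_nhds hx₀] with x hx hxU
    have hroots : (Q (x, 0)).roots.toFinset = T.image fun p => φ p (x, 0) := by
      ext q
      rw [Multiset.mem_toFinset, Finset.mem_image]
      constructor
      · intro hq
        by_cases hTe : T.Nonempty
        · obtain ⟨p₁, hp₁⟩ := hTe
          obtain ⟨p, hp, hqp⟩ := (hx p₁ hp₁).2.2 q hq
          refine ⟨p, hp, ?_⟩
          have : q ∈ (Q (x, 0)).roots.filter (· ∈ Metric.ball p ρ) :=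
            Multiset.mem_filter.2 ⟨hq, hqp⟩
          rw [(hx p hp).2.1] at this
          exact (Multiset.eq_of_mem_replicate this).symm
        -- If there is no root at `x₀`, maximality excludes roots at `x` as well.
        · exfalso
          rw [Finset.not_nonempty_iff_eq_empty] at hTe
          have h1 : (Q (x, 0)).roots.toFinset.card ≤ 0 := by
            simpa [hTe] using hmax x hxU
          rw [Nat.le_zero, Finset.card_eq_zero, Multiset.toFinset_eq_empty] at h1
          simp [h1] at hq
      · rintro ⟨p, hp, rfl⟩
        have : φ p (x, 0) ∈ (Q (x, 0)).roots.filter (· ∈ Metric.ball p ρ) := by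
          rw [(hx p hp).2.1]
          exact Multiset.mem_replicate.2 ⟨(hNpos p hp).ne', rfl⟩
        exact (Multiset.mem_filter.1 this).1
    have hinj : Set.InjOn (fun p => φ p (x, 0)) T := fun p hp p' hp' h => by
      by_contra hne
      have h1 := hsep p hp p' hp' hne
      have h2 := dist_triangle_left p p' (φ p (x, 0))
      have h3 := (hx p hp).1
      have h4 := (hx p' hp').1
      simp only at h
      rw [← h] at h4
      rw [Metric.mem_ball] at h3 h4
      linarith
    have hmult : ∀ p ∈ T, (Q (x, 0)).rootMultiplicity (φ p (x, 0)) = N p := fun p hp => by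
      rw [← count_roots, ← Multiset.count_filter_of_pos (hx p hp).1, (hx p hp).2.1,
        Multiset.count_replicate_self]
    conv_lhs => rw [(IsAlgClosed.splits (Q (x, 0))).eq_prod_roots]
    rw [prod_multiset_root_eq_finset_root, hroots, Finset.prod_image hinj]
    congr 1
    rw [← Finset.prod_coe_sort, ← e.prod_comp]
    exact Finset.prod_congr rfl fun α _ => by rw [hmult _ (e α).2]

end Trace

end PlanarWeb
end

noncomputable section

namespace PlanarWeb

/-! ### Exterior calculus in coordinates -/

theorem clm_ext {α β : Plane →L[ℂ] ℂ} (h1 : α (1, 0) = β (1, 0)) (h2 : α (0, 1) = β (0, 1)) :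
    α = β := by
  ext
  · simpa using h1
  · simpa using h2

theorem clm_apply (α : Plane →L[ℂ] ℂ) (v : Plane) : α v = v.1 * α (1, 0) + v.2 * α (0, 1) := by
  have : v = v.1 • ((1, 0) : Plane) + v.2 • ((0, 1) : Plane) := by ext <;> simp
  conv_lhs => rw [this, map_add, map_smul, map_smul]
  rfl

theorem extd_congr {α β : Form} {z : Plane} (h : α =ᶠ[𝓝 z] β) : extd α z = extd β z := by
  simp only [extd, h.fderiv_eq]

theorem extd_smul {u : Plane → ℂ} {α : Form} {z : Plane} (hu : DifferentiableAt ℂ u z)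
    (hα : DifferentiableAt ℂ α z) :
    extd (fun w => u w • α w) z = wedge (fderiv ℂ u z) (α z) + u z * extd α z := by
  simp only [extd, wedge, fderiv_fun_smul hu hα]
  simp
  ring

theorem extd_add {α β : Form} {z : Plane} (hα : DifferentiableAt ℂ α z)
    (hβ : DifferentiableAt ℂ β z) :
    extd (fun w => α w + β w) z = extd α z + extd β z := by
  simp only [extd, fderiv_fun_add hα hβ]
  simp
  ring

theorem extd_const_smul {α : Form} {z : Plane} (c : ℂ) (hα : DifferentiableAt ℂ α z) :
    extd (fun w => c • α w) z = c * extd α z := by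
  simp only [extd, fderiv_fun_const_smul hα]
  simp
  ring

theorem extd_fderiv {u : Plane → ℂ} {z : Plane} (hu : AnalyticAt ℂ u z) :
    extd (fderiv ℂ u) z = 0 := by
  have h : IsSymmSndFDerivAt ℂ u z :=
    (hu.contDiffAt (n := 2)).isSymmSndFDerivAt (by simp)
  simp only [extd, h.eq (1, 0) (0, 1), sub_self]

/-- Logarithmic differentials are closed. -/
theorem extd_dlog {g : Plane → ℂ} {z : Plane} (hg : AnalyticAt ℂ g z) (h0 : g z ≠ 0) :
    extd (fun w => (g w)⁻¹ • fderiv ℂ g w) z = 0 := by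
  rw [extd_smul (u := fun w => (g w)⁻¹) (hg.fun_inv h0).differentiableAt hg.fderiv.differentiableAt, extd_fderiv hg,
    mul_zero, add_zero]
  have : fderiv ℂ (fun w => (g w)⁻¹) z = (-((g z) ^ 2)⁻¹) • fderiv ℂ g z :=
    ((hasDerivAt_inv h0).comp_hasFDerivAt z hg.differentiableAt.hasFDerivAt).fderiv
  rw [this]
  simp only [wedge, FunLike.coe_smul, Pi.smul_apply, smul_eq_mul]
  ring

theorem wedge_differentiableAt {α β : Plane → Plane →L[ℂ] ℂ} {z : Plane} (hα : DifferentiableAt ℂ α z)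
    (hβ : DifferentiableAt ℂ β z) : DifferentiableAt ℂ (fun w => wedge (α w) (β w)) z := by
  unfold wedge
  fun_prop

@[fun_prop]
theorem _root_.AnalyticAt.clm_apply_const {E F G : Type*} [NormedAddCommGroup E] [NormedSpace ℂ E]
    [NormedAddCommGroup F] [NormedSpace ℂ F] [NormedAddCommGroup G] [NormedSpace ℂ G]
    {α : E → F →L[ℂ] G} {z : E} (hα : AnalyticAt ℂ α z) (v : F) :
    AnalyticAt ℂ (fun w => α w v) z :=
  AnalyticAt.fun_comp (g := fun L : F →L[ℂ] G => L v)
    ((ContinuousLinearMap.apply ℂ G v).analyticAt _) hα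

theorem wedge_analyticAt {α β : Plane → Plane →L[ℂ] ℂ} {z : Plane} (hα : AnalyticAt ℂ α z)
    (hβ : AnalyticAt ℂ β z) : AnalyticAt ℂ (fun w => wedge (α w) (β w)) z := by
  unfold wedge
  fun_prop

theorem extd_analyticAt {α : Plane → Plane →L[ℂ] ℂ} {z : Plane} (hα : AnalyticAt ℂ α z) :
    AnalyticAt ℂ (extd α) z := by
  have h := hα.fderiv
  unfold extd
  fun_prop

/-- A value of a `1`-form is determined by its exterior products with two independent forms. -/
theorem eq_of_wedge_eq {c c' A B : Plane →L[ℂ] ℂ} (hAB : wedge A B ≠ 0)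
    (h1 : wedge c A = wedge c' A) (h2 : wedge c B = wedge c' B) : c = c' := by
  unfold wedge at *
  refine clm_ext ?_ ?_
  · refine mul_right_cancel₀ hAB ?_
    linear_combination B (1, 0) * (-h1) + A (1, 0) * h2
  · refine mul_right_cancel₀ hAB ?_
    linear_combination B (0, 1) * (-h1) + A (0, 1) * h2

/-- The fundamental form of a `3`-web. -/
def tripleForm (α β γ : Form) : Form := fun z =>
  (wedge (wedge (β z) (γ z) • α z) (wedge (γ z) (α z) • β z))⁻¹ •
    (extd (fun w => wedge (γ w) (α w) • β w) z • (wedge (β z) (γ z) • α z) -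
      extd (fun w => wedge (β w) (γ w) • α w) z • (wedge (γ z) (α z) • β z))

/-- The three normalized forms of a 3-web have sum zero. Hence two of the three equations for its
fundamental form imply the third. -/
theorem wedge_cyclic (α β γ : Plane →L[ℂ] ℂ) :
    wedge α β • γ = -(wedge β γ • α + wedge γ α • β) := by
  refine clm_ext ?_ ?_ <;> simp [wedge] <;> ring

theorem wedge_smul_smul (a b : ℂ) (α β : Plane →L[ℂ] ℂ) :
    wedge (a • α) (b • β) = a * b * wedge α β := by
  simp [wedge]
  ring

theorem isTripleFormAt_unique {α β γ : Form} {z : Plane} (h1 : wedge (α z) (β z) ≠ 0)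
    (h2 : wedge (β z) (γ z) ≠ 0) (h3 : wedge (γ z) (α z) ≠ 0) {c c' : Plane →L[ℂ] ℂ}
    (h : IsTripleFormAt α β γ z c) (h' : IsTripleFormAt α β γ z c') : c = c' := by
  refine eq_of_wedge_eq (A := wedge (β z) (γ z) • α z) (B := wedge (γ z) (α z) • β z) ?_ ?_ ?_
  · rw [wedge_smul_smul]
    exact mul_ne_zero (mul_ne_zero h2 h3) h1
  · rw [← h.1, ← h'.1]
  · rw [← h.2.1, ← h'.2.1]

/-- Cramer's rule solves the first two equations, because the normalized forms are independent; the
third follows from `wedge_cyclic`. -/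
theorem isTripleFormAt_tripleForm {α β γ : Form} {z : Plane} (hα : DifferentiableAt ℂ α z)
    (hβ : DifferentiableAt ℂ β z) (hγ : DifferentiableAt ℂ γ z) (h1 : wedge (α z) (β z) ≠ 0)
    (h2 : wedge (β z) (γ z) ≠ 0) (h3 : wedge (γ z) (α z) ≠ 0) :
    IsTripleFormAt α β γ z (tripleForm α β γ z) := by
  set A : Form := fun w => wedge (β w) (γ w) • α w with hA
  set B : Form := fun w => wedge (γ w) (α w) • β w with hB
  have hAB : wedge (A z) (B z) ≠ 0 := by
    rw [hA, hB, wedge_smul_smul]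
    exact mul_ne_zero (mul_ne_zero h2 h3) h1
  have hAd : DifferentiableAt ℂ A z := (wedge_differentiableAt hβ hγ).smul hα
  have hBd : DifferentiableAt ℂ B z := (wedge_differentiableAt hγ hα).smul hβ
  have hc : tripleForm α β γ z =
      (wedge (A z) (B z))⁻¹ • (extd B z • A z - extd A z • B z) := rfl
  have e1 : extd A z = wedge (tripleForm α β γ z) (A z) := by
    rw [hc]
    have : wedge ((wedge (A z) (B z))⁻¹ • (extd B z • A z - extd A z • B z)) (A z) =
        (wedge (A z) (B z))⁻¹ * (wedge (A z) (B z) * extd A z) := by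
      simp [wedge]
      ring
    rw [this, inv_mul_cancel_left₀ hAB]
  have e2 : extd B z = wedge (tripleForm α β γ z) (B z) := by
    rw [hc]
    have : wedge ((wedge (A z) (B z))⁻¹ • (extd B z • A z - extd A z • B z)) (B z) =
        (wedge (A z) (B z))⁻¹ * (wedge (A z) (B z) * extd B z) := by
      simp [wedge]
      ring
    rw [this, inv_mul_cancel_left₀ hAB]
  refine ⟨e1, e2, ?_⟩
  have hC : (fun w => wedge (α w) (β w) • γ w) = fun w => (-1 : ℂ) • (A w + B w) := by
    funext w
    rw [wedge_cyclic]
    exact (neg_one_smul ℂ _).symm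
  rw [hC, extd_const_smul _ (hAd.fun_add hBd), extd_add hAd hBd, e1, e2, wedge_cyclic]
  simp only [hA, hB, wedge, FunLike.coe_neg, FunLike.coe_add, Pi.neg_apply, Pi.add_apply]
  ring

theorem tripleForm_analyticAt {α β γ : Form} {z : Plane} (hα : AnalyticAt ℂ α z)
    (hβ : AnalyticAt ℂ β z) (hγ : AnalyticAt ℂ γ z) (h1 : wedge (α z) (β z) ≠ 0)
    (h2 : wedge (β z) (γ z) ≠ 0) (h3 : wedge (γ z) (α z) ≠ 0) :
    AnalyticAt ℂ (tripleForm α β γ) z := by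
  have hA := (wedge_analyticAt hβ hγ).fun_smul hα
  have hB := (wedge_analyticAt hγ hα).fun_smul hβ
  refine ((wedge_analyticAt hA hB).inv ?_).fun_smul
    (((extd_analyticAt hB).fun_smul hA).fun_sub ((extd_analyticAt hA).fun_smul hB))
  rw [wedge_smul_smul]
  exact mul_ne_zero (mul_ne_zero h2 h3) h1

/-! ### Change of factorization and of coordinates -/

theorem extd_triple_smul {A : Form} {g : Plane → ℂ} {z : Plane} {c : Plane →L[ℂ] ℂ}
    (hA : DifferentiableAt ℂ A z) (hg : DifferentiableAt ℂ g z) (h0 : g z ≠ 0)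
    (h : extd A z = wedge c (A z)) :
    extd (fun w => g w • A w) z = wedge (c + (g z)⁻¹ • fderiv ℂ g z) (g z • A z) := by
  rw [extd_smul hg hA, h]
  simp [wedge]
  field_simp
  ring

theorem dlog_mul {f g : Plane → ℂ} {z : Plane} (hf : DifferentiableAt ℂ f z)
    (hg : DifferentiableAt ℂ g z) (hf0 : f z ≠ 0) (hg0 : g z ≠ 0) :
    (f z * g z)⁻¹ • fderiv ℂ (fun w => f w * g w) z =
      (f z)⁻¹ • fderiv ℂ f z + (g z)⁻¹ • fderiv ℂ g z := by
  rw [fderiv_fun_mul hf hg, smul_add, smul_smul, smul_smul, add_comm]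
  congr 2 <;> field_simp

/-- All three normalized forms are multiplied by the same function `u v w`, and so all three
equations are corrected by its logarithmic differential. -/
theorem IsTripleFormAt.smul {α β γ : Form} {z : Plane} {c : Plane →L[ℂ] ℂ} {u v w : Plane → ℂ}
    (h : IsTripleFormAt α β γ z c) (hα : DifferentiableAt ℂ α z)
    (hβ : DifferentiableAt ℂ β z) (hγ : DifferentiableAt ℂ γ z) (hu : DifferentiableAt ℂ u z)
    (hv : DifferentiableAt ℂ v z) (hw : DifferentiableAt ℂ w z) (hu0 : u z ≠ 0) (hv0 : v z ≠ 0)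
    (hw0 : w z ≠ 0) :
    IsTripleFormAt (fun t => u t • α t) (fun t => v t • β t) (fun t => w t • γ t) z
      (c + ((u z)⁻¹ • fderiv ℂ u z + (v z)⁻¹ • fderiv ℂ v z + (w z)⁻¹ • fderiv ℂ w z)) := by
  have hg : DifferentiableAt ℂ (fun t => u t * v t * w t) z := (hu.fun_mul hv).fun_mul hw
  have hg0 : u z * v z * w z ≠ 0 := mul_ne_zero (mul_ne_zero hu0 hv0) hw0
  have hdl : (u z)⁻¹ • fderiv ℂ u z + (v z)⁻¹ • fderiv ℂ v z + (w z)⁻¹ • fderiv ℂ w z =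
      (u z * v z * w z)⁻¹ • fderiv ℂ (fun t => u t * v t * w t) z := by
    rw [dlog_mul (hu.fun_mul hv) hw (mul_ne_zero hu0 hv0) hw0, dlog_mul hu hv hu0 hv0]
  rw [hdl]
  have key : ∀ (a b e : Plane → ℂ) (A B C : Form), (∀ t, a t * b t * e t = u t * v t * w t) →
      (fun t => wedge (b t • B t) (e t • C t) • (a t • A t)) =
        fun t => (u t * v t * w t) • (wedge (B t) (C t) • A t) := by
    intro a b e A B C hab
    funext t
    rw [wedge_smul_smul, smul_smul, smul_smul, ← hab]
    congr 1
    ring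
  refine ⟨?_, ?_, ?_⟩
  · have k := key u v w α β γ fun t => rfl
    rw [k, extd_triple_smul ((wedge_differentiableAt hβ hγ).fun_smul hα) hg hg0 h.1]
    exact congrArg _ (congrFun k z).symm
  · have k := key v w u β γ α fun t => by ring
    rw [k, extd_triple_smul ((wedge_differentiableAt hγ hα).fun_smul hβ) hg hg0 h.2.1]
    exact congrArg _ (congrFun k z).symm
  · have k := key w u v γ α β fun t => by ring
    rw [k, extd_triple_smul ((wedge_differentiableAt hα hβ).fun_smul hγ) hg hg0 h.2.2]
    exact congrArg _ (congrFun k z).symm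

/-- The determinant of an endomorphism of the plane. -/
def jac (T : Plane →L[ℂ] Plane) : ℂ := (T (1, 0)).1 * (T (0, 1)).2 - (T (0, 1)).1 * (T (1, 0)).2

theorem jac_analyticAt {τ : Plane → Plane} {z : Plane} (hτ : AnalyticAt ℂ τ z) :
    AnalyticAt ℂ (fun w => jac (fderiv ℂ τ w)) z := by
  have := hτ.fderiv
  unfold jac
  fun_prop

theorem wedge_comp (α β : Plane →L[ℂ] ℂ) (T : Plane →L[ℂ] Plane) :
    wedge (α.comp T) (β.comp T) = jac T * wedge α β := by
  simp only [wedge, jac, ContinuousLinearMap.comp_apply]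
  rw [clm_apply α (T (1, 0)), clm_apply α (T (0, 1)), clm_apply β (T (1, 0)),
    clm_apply β (T (0, 1))]
  ring

/-- The pull-back of a form. -/
def pullback (τ : Plane → Plane) (α : Form) : Form := fun w => (α (τ w)).comp (fderiv ℂ τ w)

theorem pullback_analyticAt {τ : Plane → Plane} {α : Form} {z : Plane} (hτ : AnalyticAt ℂ τ z)
    (hα : AnalyticAt ℂ α (τ z)) : AnalyticAt ℂ (pullback τ α) z :=
  AnalyticAt.comp₂ (h := fun p : (Plane →L[ℂ] ℂ) × (Plane →L[ℂ] Plane) => p.1.comp p.2)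
    (isBoundedBilinearMap_comp.contDiff.contDiffAt (n := ω)).analyticAt
    (hα.fun_comp hτ) hτ.fderiv

theorem pullback_differentiableAt {τ : Plane → Plane} {α : Form} {z : Plane}
    (hτ : AnalyticAt ℂ τ z) (hα : DifferentiableAt ℂ α (τ z)) :
    DifferentiableAt ℂ (pullback τ α) z :=
  (hα.fun_comp' z hτ.differentiableAt).clm_comp hτ.fderiv.differentiableAt

/-- The terms with second derivatives of `τ` cancel by symmetry; the remaining alternating
expression is the determinant. -/
theorem extd_pullback {τ : Plane → Plane} {α : Form} {z : Plane} (hτ : AnalyticAt ℂ τ z)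
    (hα : DifferentiableAt ℂ α (τ z)) :
    extd (pullback τ α) z = jac (fderiv ℂ τ z) * extd α (τ z) := by
  have h1 : DifferentiableAt ℂ (fun w => α (τ w)) z := hα.fun_comp' z hτ.differentiableAt
  have h2 : fderiv ℂ (fun w => α (τ w)) z = (fderiv ℂ α (τ z)).comp (fderiv ℂ τ z) :=
    fderiv_fun_comp z hα hτ.differentiableAt
  have hsymm : IsSymmSndFDerivAt ℂ τ z :=
    (hτ.contDiffAt (n := 2)).isSymmSndFDerivAt (by simp)
  have h3 : ∀ u v, fderiv ℂ (pullback τ α) z u v =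
      α (τ z) (fderiv ℂ (fderiv ℂ τ) z u v) + fderiv ℂ α (τ z) (fderiv ℂ τ z u) (fderiv ℂ τ z v) := by
    intro u v
    unfold pullback
    rw [fderiv_clm_comp h1 hτ.fderiv.differentiableAt, h2]
    simp
  simp only [extd, h3, hsymm.eq (1, 0) (0, 1), jac]
  generalize hT : fderiv ℂ τ z = T
  generalize hB : fderiv ℂ α (τ z) = B
  have hb : ∀ u v : Plane, B u v = u.1 * (B (1, 0) v) + u.2 * (B (0, 1) v) := fun u v => by
    have : u = u.1 • ((1, 0) : Plane) + u.2 • ((0, 1) : Plane) := by ext <;> simp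
    conv_lhs => rw [this, map_add, map_smul, map_smul]
    rfl
  rw [hb (T (1, 0)), hb (T (0, 1)), clm_apply (B (1, 0)) (T (0, 1)),
    clm_apply (B (0, 1)) (T (0, 1)), clm_apply (B (1, 0)) (T (1, 0)),
    clm_apply (B (0, 1)) (T (1, 0))]
  ring

/-- The coefficient of dx ∧ dy is not invariant: each wedge gains the Jacobian as a factor. A
pulled-back normalized form is therefore rescaled by the Jacobian, whence the extra logarithmic
differential. -/
theorem IsTripleFormAt.pullback {α β γ : Form} {τ : Plane → Plane} {z : Plane}
    {c : Plane →L[ℂ] ℂ} (h : IsTripleFormAt α β γ (τ z) c) (hτ : AnalyticAt ℂ τ z)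
    (hJ : jac (fderiv ℂ τ z) ≠ 0) (hα : DifferentiableAt ℂ α (τ z))
    (hβ : DifferentiableAt ℂ β (τ z)) (hγ : DifferentiableAt ℂ γ (τ z)) :
    IsTripleFormAt (pullback τ α) (pullback τ β) (pullback τ γ) z (c.comp (fderiv ℂ τ z) +
      (jac (fderiv ℂ τ z))⁻¹ • fderiv ℂ (fun w => jac (fderiv ℂ τ w)) z) := by
  have key : ∀ A B C : Form, DifferentiableAt ℂ A (τ z) → DifferentiableAt ℂ B (τ z) →
      DifferentiableAt ℂ C (τ z) →
      extd (fun w => wedge (B w) (C w) • A w) (τ z) = wedge c (wedge (B (τ z)) (C (τ z)) • A (τ z)) →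
      extd (fun w => wedge (PlanarWeb.pullback τ B w) (PlanarWeb.pullback τ C w) •
        PlanarWeb.pullback τ A w) z = wedge (c.comp (fderiv ℂ τ z) +
          (jac (fderiv ℂ τ z))⁻¹ • fderiv ℂ (fun w => jac (fderiv ℂ τ w)) z)
          (wedge (PlanarWeb.pullback τ B z) (PlanarWeb.pullback τ C z) •
            PlanarWeb.pullback τ A z) := by
    intro A B C hA hB hC hABC
    have e : (fun w => wedge (PlanarWeb.pullback τ B w) (PlanarWeb.pullback τ C w) •
        PlanarWeb.pullback τ A w) = fun w => jac (fderiv ℂ τ w) •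
          PlanarWeb.pullback τ (fun w => wedge (B w) (C w) • A w) w := by
      funext w
      simp only [PlanarWeb.pullback, wedge_comp, mul_smul, ContinuousLinearMap.smul_comp]
    have hd := (wedge_differentiableAt hB hC).fun_smul hA
    have e2 : extd (PlanarWeb.pullback τ (fun w => wedge (B w) (C w) • A w)) z =
        wedge (c.comp (fderiv ℂ τ z))
          (PlanarWeb.pullback τ (fun w => wedge (B w) (C w) • A w) z) := by
      rw [extd_pullback hτ hd, hABC, PlanarWeb.pullback, wedge_comp]
    rw [e, extd_triple_smul (pullback_differentiableAt hτ hd)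
      (jac_analyticAt hτ).differentiableAt hJ e2]
    exact congrArg _ (congrFun e z).symm
  exact ⟨key α β γ hα hβ hγ h.1, key β γ α hβ hγ hα h.2.1, key γ α β hγ hα hβ h.2.2⟩

end PlanarWeb
end

noncomputable section

namespace PlanarWeb

/-! ### Sums over triples -/

section Triples

variable {d : ℕ} {E : Type*} [AddCommGroup E]

theorem sum_rotate (h : Fin d → Fin d → Fin d → E) :
    ∑ r, ∑ s, ∑ t, h r s t = ∑ r, ∑ s, ∑ t, h t r s := by
  calc _ = ∑ s, ∑ r, ∑ t, h r s t := Finset.sum_comm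
    _ = ∑ s, ∑ t, ∑ r, h r s t := Finset.sum_congr rfl fun _ _ => Finset.sum_comm

theorem sum_swap (h : Fin d → Fin d → Fin d → E) :
    ∑ r, ∑ s, ∑ t, h r s t = ∑ r, ∑ s, ∑ t, h r t s :=
  Finset.sum_congr rfl fun _ _ => Finset.sum_comm

theorem sum_triples_eq_ite (h : Fin d → Fin d → Fin d → E) :
    ∑ r, ∑ s ∈ Finset.Ioi r, ∑ t ∈ Finset.Ioi s, h r s t =
      ∑ r, ∑ s, ∑ t, if r < s ∧ s < t then h r s t else 0 := by
  refine Finset.sum_congr rfl fun r _ => ?_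
  have : Finset.Ioi r = Finset.univ.filter (r < ·) := by ext; simp
  rw [this, Finset.sum_filter]
  refine Finset.sum_congr rfl fun s _ => ?_
  split_ifs with hrs
  · have : Finset.Ioi s = Finset.univ.filter (s < ·) := by ext; simp
    rw [this, Finset.sum_filter]
    simp [hrs]
  · simp [hrs]

theorem ite_distinct_eq (x : E) (r s t : Fin d) : (if r ≠ s ∧ r ≠ t ∧ s ≠ t then x else 0) =
    (if r < s ∧ s < t then x else 0) + (if r < t ∧ t < s then x else 0) +
    ((if s < t ∧ t < r then x else 0) + (if t < s ∧ s < r then x else 0)) +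
    ((if t < r ∧ r < s then x else 0) + (if s < r ∧ r < t then x else 0)) := by
  rcases lt_trichotomy r s with h1 | rfl | h1
  · rcases lt_trichotomy s t with h2 | rfl | h2
    · simp [h1, h2, h1.ne, h2.ne, h1.not_gt, h2.not_gt, (h1.trans h2).ne, (h1.trans h2).not_gt]
    · simp [h1, h1.not_gt]
    · rcases lt_trichotomy r t with h3 | rfl | h3 
      · simp [h1, h2, h3, h1.ne, h2.ne', h3.ne, h1.not_gt, h2.not_gt, h3.not_gt]
      · simp [h1, h1.not_gt]
      · simp [h1, h2, h3, h1.ne, h2.ne', h3.ne', h1.not_gt, h2.not_gt, h3.not_gt]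
  · rcases lt_trichotomy r t with h2 | rfl | h2 
    · simp [h2, h2.not_gt]
    · simp
    · simp [h2, h2.not_gt]
  · rcases lt_trichotomy s t with h2 | rfl | h2
    · rcases lt_trichotomy r t with h3 | rfl | h3 
      · simp [h1, h2, h3, h1.ne', h2.ne, h3.ne, h1.not_gt, h2.not_gt, h3.not_gt]
      · simp [h1, h1.not_gt]
      · simp [h1, h2, h3, h1.ne', h2.ne, h3.ne', h1.not_gt, h2.not_gt, h3.not_gt]
    · simp [h1, h1.not_gt]
    · simp [h1, h2, h1.ne', h2.ne', h1.not_gt, h2.not_gt, (h2.trans h1).ne', (h2.trans h1).not_gt]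

/-- Among the six orderings of three distinct indices, the three cyclic ones occur on the left; the
symmetry of `g` in its last two arguments accounts for the others, and for the factor 1/2. -/
theorem sum_triples_eq [Module ℂ E] (g : Fin d → Fin d → Fin d → E)
    (hg : ∀ r s t, g r s t = g r t s) :
    ∑ r, ∑ s ∈ Finset.Ioi r, ∑ t ∈ Finset.Ioi s, (g r s t + g s t r + g t r s) =
      (1 / 2 : ℂ) • ∑ r, ∑ s ∈ Finset.univ.erase r, ∑ t ∈ (Finset.univ.erase r).erase s,
        g r s t := by
  have hR : ∑ r, ∑ s ∈ Finset.univ.erase r, ∑ t ∈ (Finset.univ.erase r).erase s, g r s t =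
      ∑ r, ∑ s, ∑ t, if r ≠ s ∧ r ≠ t ∧ s ≠ t then g r s t else 0 := by
    refine Finset.sum_congr rfl fun r _ => ?_
    have : Finset.univ.erase r = Finset.univ.filter (r ≠ ·) := by ext; simp [eq_comm]
    rw [this, Finset.sum_filter]
    refine Finset.sum_congr rfl fun s _ => ?_
    split_ifs with hrs
    · have : (Finset.univ.filter (r ≠ ·)).erase s =
          Finset.univ.filter (fun t => r ≠ t ∧ s ≠ t) := by
        ext t
        simp only [Finset.mem_erase, Finset.mem_filter, Finset.mem_univ, true_and]
        rw [and_comm, ne_comm (a := t)]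
      rw [this, Finset.sum_filter]
      simp [hrs]
    · simp [hrs]
  rw [hR]
  simp_rw [ite_distinct_eq, Finset.sum_add_distrib]
  rw [sum_triples_eq_ite, sum_triples_eq_ite, sum_triples_eq_ite]
  set A1 := ∑ r, ∑ s, ∑ t, if r < s ∧ s < t then g r s t else 0 with hA1
  have e1 : (∑ r, ∑ s, ∑ t, if r < t ∧ t < s then g r s t else 0) = A1 := by
    rw [sum_swap]
    simp_rw [← hg]
    exact hA1
  have e2 : (∑ r, ∑ s, ∑ t, if s < t ∧ t < r then g r s t else 0) =
      ∑ r, ∑ s, ∑ t, if r < s ∧ s < t then g t r s else 0 := sum_rotate _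
  have e3 : (∑ r, ∑ s, ∑ t, if t < s ∧ s < r then g r s t else 0) =
      ∑ r, ∑ s, ∑ t, if r < s ∧ s < t then g t r s else 0 := by
    rw [sum_swap, ← e2]
    exact Finset.sum_congr rfl fun r _ => Finset.sum_congr rfl fun s _ =>
      Finset.sum_congr rfl fun t _ => by rw [hg r t s]
  have e4 : (∑ r, ∑ s, ∑ t, if t < r ∧ r < s then g r s t else 0) =
      ∑ r, ∑ s, ∑ t, if r < s ∧ s < t then g s t r else 0 := by
    rw [sum_rotate, sum_rotate]
  have e5 : (∑ r, ∑ s, ∑ t, if s < r ∧ r < t then g r s t else 0) =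
      ∑ r, ∑ s, ∑ t, if r < s ∧ s < t then g s t r else 0 := by
    rw [sum_swap, ← e4]
    exact Finset.sum_congr rfl fun r _ => Finset.sum_congr rfl fun s _ =>
      Finset.sum_congr rfl fun t _ => by rw [hg r t s]
  rw [e1, e2, e3, e4, e5, ← two_smul ℂ, ← two_smul ℂ, ← two_smul ℂ, ← smul_add, ← smul_add,
    smul_smul]
  norm_num
  abel

end Triples

/-! ### Derivatives of a product of linear factors -/

section Roots

open Polynomial

/-- Logarithmic differentiation. Together with `derivatives_at_root` it expresses the power sums of
1/(p_r - p_s) through F', F'', F''' at the root p_r. -/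
theorem derivative_prod_sub {ι : Type*} (U : Finset ι) (p : ι → ℂ) (x a : ℂ)
    (h : ∀ s ∈ U, x ≠ p s) :
    (C a * ∏ s ∈ U, (X - C (p s))).derivative.eval x =
        (C a * ∏ s ∈ U, (X - C (p s))).eval x * ∑ s ∈ U, 1 / (x - p s) ∧
      (C a * ∏ s ∈ U, (X - C (p s))).derivative.derivative.eval x =
        (C a * ∏ s ∈ U, (X - C (p s))).eval x *
          ((∑ s ∈ U, 1 / (x - p s)) ^ 2 - ∑ s ∈ U, (1 / (x - p s)) ^ 2) := by
  classical
  induction U using Finset.induction_on with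
  | empty => simp
  | insert i U hi ih =>
    obtain ⟨ih1, ih2⟩ := ih fun s hs => h s (Finset.mem_insert_of_mem hs)
    have hx : x - p i ≠ 0 := sub_ne_zero.2 (h i (Finset.mem_insert_self _ _))
    have e : C a * ∏ s ∈ insert i U, (X - C (p s)) =
        (X - C (p i)) * (C a * ∏ s ∈ U, (X - C (p s))) := by
      rw [Finset.prod_insert hi]
      ring
    rw [e, Finset.sum_insert hi, Finset.sum_insert hi]
    generalize hK : C a * ∏ s ∈ U, (X - C (p s)) = K at ih1 ih2 ⊢
    constructor
    · simp only [derivative_mul, derivative_sub, derivative_X, derivative_C, sub_zero, one_mul,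
        eval_add, eval_mul, eval_sub, eval_X, eval_C, ih1]
      field_simp
    · simp only [derivative_mul, derivative_sub, derivative_X, derivative_C, sub_zero, one_mul,
        eval_add, eval_mul, eval_sub, eval_X, eval_C, derivative_add, ih1, ih2]
      field_simp
      ring

theorem derivatives_at_root (H : ℂ[X]) (x : ℂ) :
    ((X - C x) * H).derivative.eval x = H.eval x ∧
      ((X - C x) * H).derivative.derivative.eval x = 2 * H.derivative.eval x ∧
      ((X - C x) * H).derivative.derivative.derivative.eval x =
        3 * H.derivative.derivative.eval x := by
  refine ⟨?_, ?_, ?_⟩ <;> simp <;> ring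

end Roots

/-! ### The fundamental form in terms of the slopes -/

/-- Contribution of the slope `p` (with partial derivatives `px`, `py`) and of two other slopes
to the fundamental form of a `3`-web. -/
def slopeTerm (px py p q r : ℂ) : Plane →L[ℂ] ℂ :=
  -((px + p * py) * (1 / (p - q) * (1 / (p - r)))) • (dy - p • dx) +
    (py * (1 / (p - q) + 1 / (p - r))) • (dy - p • dx) + py • dx

theorem slopeTerm_symm (px py p q r : ℂ) : slopeTerm px py p q r = slopeTerm px py p r q := by
  unfold slopeTerm
  rw [mul_comm (1 / (p - q)), add_comm (1 / (p - q))]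

theorem slope_differentiableAt {p : Plane → ℂ} {z : Plane} (hp : DifferentiableAt ℂ p z) :
    DifferentiableAt ℂ (fun w => dy - p w • dx) z :=
  (differentiableAt_const dy).sub (hp.smul_const dx)

theorem extd_slope {p : Plane → ℂ} {z : Plane} (hp : DifferentiableAt ℂ p z) :
    extd (fun w => dy - p w • dx) z = fderiv ℂ p z (0, 1) := by
  have : fderiv ℂ (fun w => dy - p w • dx) z = -(fderiv ℂ p z).smulRight dx := by
    refine HasFDerivAt.fderiv ?_
    have := (hasFDerivAt_const dy z).fun_sub (hp.hasFDerivAt.smul_const dx)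
    simpa using this
  simp [extd, this]

theorem wedge_slope (q r : ℂ) : wedge (dy - q • dx) (dy - r • dx) = r - q := by
  simp [wedge]
  ring

theorem extd_triple_slope {p q r : Plane → ℂ} {z : Plane} (hp : DifferentiableAt ℂ p z)
    (hq : DifferentiableAt ℂ q z) (hr : DifferentiableAt ℂ r z) :
    extd (fun w => wedge (dy - q w • dx) (dy - r w • dx) • (dy - p w • dx)) z =
      (fderiv ℂ r z (1, 0) - fderiv ℂ q z (1, 0)) +
        p z * (fderiv ℂ r z (0, 1) - fderiv ℂ q z (0, 1)) +
        (r z - q z) * fderiv ℂ p z (0, 1) := by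
  simp_rw [wedge_slope]
  rw [extd_smul (hr.fun_sub hq) (slope_differentiableAt hp), extd_slope hp, fderiv_fun_sub hr hq]
  simp [wedge]
  ring

/-- A direct computation. The point is the shape of the answer: each summand involves derivatives of
one slope only and is symmetric in the other two, so the sum over all triples can be carried out
root by root. -/
theorem isTripleFormAt_slope {p q r : Plane → ℂ} {z : Plane} (hp : DifferentiableAt ℂ p z)
    (hq : DifferentiableAt ℂ q z) (hr : DifferentiableAt ℂ r z) (hpq : p z ≠ q z)
    (hpr : p z ≠ r z) (hqr : q z ≠ r z) :
    IsTripleFormAt (fun w => dy - p w • dx) (fun w => dy - q w • dx) (fun w => dy - r w • dx) z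
      (slopeTerm (fderiv ℂ p z (1, 0)) (fderiv ℂ p z (0, 1)) (p z) (q z) (r z) +
        slopeTerm (fderiv ℂ q z (1, 0)) (fderiv ℂ q z (0, 1)) (q z) (r z) (p z) +
        slopeTerm (fderiv ℂ r z (1, 0)) (fderiv ℂ r z (0, 1)) (r z) (p z) (q z)) := by
  unfold IsTripleFormAt
  rw [extd_triple_slope hp hq hr, extd_triple_slope hq hr hp, extd_triple_slope hr hp hq]
  simp only [wedge_slope]
  generalize fderiv ℂ p z (1, 0) = px
  generalize fderiv ℂ p z (0, 1) = py
  generalize fderiv ℂ q z (1, 0) = qx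
  generalize fderiv ℂ q z (0, 1) = qy
  generalize fderiv ℂ r z (1, 0) = rx
  generalize fderiv ℂ r z (0, 1) = ry
  generalize p z = P at *
  generalize q z = Q at *
  generalize r z = R at *
  have h1 : P - Q ≠ 0 := sub_ne_zero.2 hpq
  have h2 : P - R ≠ 0 := sub_ne_zero.2 hpr
  have h3 : Q - R ≠ 0 := sub_ne_zero.2 hqr
  have h4 : Q - P ≠ 0 := sub_ne_zero.2 hpq.symm
  have h5 : R - P ≠ 0 := sub_ne_zero.2 hpr.symm
  have h6 : R - Q ≠ 0 := sub_ne_zero.2 hqr.symm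
  have e4 : Q - P = -(P - Q) := by ring
  have e5 : R - P = -(P - R) := by ring
  have e6 : R - Q = -(Q - R) := by ring
  refine ⟨?_, ?_, ?_⟩ <;>
  · simp [wedge, slopeTerm]
    rw [e4, e5, e6]
    field_simp
    ring

end PlanarWeb
end

noncomputable section

namespace PlanarWeb

/-! ### Fundamental forms: transformation rules and uniqueness -/

theorem IsTripleFormAt.congr {α β γ α' β' γ' : Form} {z : Plane} {c : Plane →L[ℂ] ℂ}
    (h : IsTripleFormAt α β γ z c) (hα : α =ᶠ[𝓝 z] α') (hβ : β =ᶠ[𝓝 z] β')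
    (hγ : γ =ᶠ[𝓝 z] γ') : IsTripleFormAt α' β' γ' z c := by
  have key : ∀ {A B C A' B' C' : Form}, A =ᶠ[𝓝 z] A' → B =ᶠ[𝓝 z] B' → C =ᶠ[𝓝 z] C' →
      extd (fun w => wedge (B w) (C w) • A w) z = wedge c (wedge (B z) (C z) • A z) →
      extd (fun w => wedge (B' w) (C' w) • A' w) z = wedge c (wedge (B' z) (C' z) • A' z) := by
    intro A B C A' B' C' hA hB hC h
    rw [← hA.eq_of_nhds, ← hB.eq_of_nhds, ← hC.eq_of_nhds, ← h]
    refine extd_congr ?_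
    filter_upwards [hA, hB, hC] with w h1 h2 h3
    rw [h1, h2, h3]
  exact ⟨key hα hβ hγ h.1, key hβ hγ hα h.2.1, key hγ hα hβ h.2.2⟩

/-- Near `z`, `σ` is a product of `d` holomorphic forms which are pairwise independent at `z`. -/
def LocallySplits (d : ℕ) (σ : Plane → Plane → ℂ) (z : Plane) : Prop :=
  ∃ L : Fin d → Form, (∀ r, AnalyticAt ℂ (L r) z) ∧
    (∀ r s, r ≠ s → wedge (L r z) (L s z) ≠ 0) ∧ ∀ᶠ w in 𝓝 z, ∀ v, σ w v = ∏ r, L r w v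

variable {d : ℕ} {σ σ' : Plane → Plane → ℂ} {z : Plane} {c : Plane →L[ℂ] ℂ}

theorem IsFundamentalFormAt.locallySplits (h : IsFundamentalFormAt d σ z c) :
    LocallySplits d σ z := by
  obtain ⟨L, h1, h2, h3, -⟩ := h
  exact ⟨L, h1, h2, h3⟩

theorem isFundamentalFormAt_of_factorization {L : Fin d → Form} (hL : ∀ r, AnalyticAt ℂ (L r) z)
    (hind : ∀ r s, r ≠ s → wedge (L r z) (L s z) ≠ 0)
    (hσ : ∀ᶠ w in 𝓝 z, ∀ v, σ w v = ∏ r, L r w v) :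
    IsFundamentalFormAt d σ z (∑ r, ∑ s ∈ Finset.Ioi r, ∑ t ∈ Finset.Ioi s,
      tripleForm (L r) (L s) (L t) z) :=
  ⟨L, hL, hind, hσ, fun r s t => tripleForm (L r) (L s) (L t) z, fun r s t hrs hst =>
    isTripleFormAt_tripleForm (hL r).differentiableAt (hL s).differentiableAt
      (hL t).differentiableAt (hind _ _ hrs.ne) (hind _ _ hst.ne) (hind _ _ (hrs.trans hst).ne'),
    rfl⟩

theorem LocallySplits.exists_isFundamentalFormAt (h : LocallySplits d σ z) :
    ∃ c, IsFundamentalFormAt d σ z c := by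
  obtain ⟨L, h1, h2, h3⟩ := h
  exact ⟨_, isFundamentalFormAt_of_factorization h1 h2 h3⟩

theorem LocallySplits.eventually (h : LocallySplits d σ z) :
    ∀ᶠ w in 𝓝 z, LocallySplits d σ w := by
  obtain ⟨L, h1, h2, h3⟩ := h
  have e1 : ∀ᶠ w in 𝓝 z, ∀ r, AnalyticAt ℂ (L r) w :=
    Filter.eventually_all.2 fun r => (h1 r).eventually_analyticAt
  have e2 : ∀ᶠ w in 𝓝 z, ∀ r s, r ≠ s → wedge (L r w) (L s w) ≠ 0 := by
    refine Filter.eventually_all.2 fun r => Filter.eventually_all.2 fun s => ?_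
    by_cases hrs : r = s
    · simp [hrs]
    · filter_upwards [(wedge_analyticAt (h1 r) (h1 s)).continuousAt.eventually_ne (h2 r s hrs)]
        with w hw _ using hw
  filter_upwards [e1, e2, h3.eventually_nhds] with w w1 w2 w3
  exact ⟨L, w1, w2, w3⟩

theorem LocallySplits.congr (h : LocallySplits d σ z) (hσ : ∀ᶠ w in 𝓝 z, ∀ v, σ w v = σ' w v) :
    LocallySplits d σ' z := by
  obtain ⟨L, h1, h2, h3⟩ := h
  refine ⟨L, h1, h2, ?_⟩
  filter_upwards [h3, hσ] with w h4 h5 v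
  rw [← h5, h4]

theorem clm_zero_smul (α : Plane →L[ℂ] ℂ) : (0 : ℂ) • α = 0 := zero_smul ℂ α

theorem clm_sum_smul {ι : Type*} (U : Finset ι) (k : ι → ℂ) (α : Plane →L[ℂ] ℂ) :
    (∑ i ∈ U, k i) • α = ∑ i ∈ U, k i • α :=
  Finset.sum_smul (f := k) (s := U) (x := α)

theorem clm_add_smul (a b : ℂ) (α : Plane →L[ℂ] ℂ) : (a + b) • α = a • α + b • α :=
  add_smul a b α

theorem sum_triples_add_smul (η : Fin d → Fin d → Fin d → Plane →L[ℂ] ℂ)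
    (k : Fin d → Fin d → Fin d → ℂ) (D : Plane →L[ℂ] ℂ) :
    ∑ r, ∑ s ∈ Finset.Ioi r, ∑ t ∈ Finset.Ioi s, (η r s t + k r s t • D) =
      ∑ r, ∑ s ∈ Finset.Ioi r, ∑ t ∈ Finset.Ioi s, η r s t +
        (∑ r, ∑ s ∈ Finset.Ioi r, ∑ t ∈ Finset.Ioi s, k r s t) • D := by
  simp only [Finset.sum_add_distrib, clm_sum_smul]

/-- The number of `3`-subwebs. -/
def tripleCount (d : ℕ) : ℂ :=
  ∑ r : Fin d, ∑ s ∈ Finset.Ioi r, ∑ t ∈ Finset.Ioi s, (1 : ℂ)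

/-- The number of `3`-subwebs that contain the `i`-th foliation. -/
def unitWeight (i : Fin d) : ℂ :=
  ∑ r : Fin d, ∑ s ∈ Finset.Ioi r, ∑ t ∈ Finset.Ioi s, ((if r = i then (1 : ℂ) else 0) +
    (if s = i then (1 : ℂ) else 0) + (if t = i then (1 : ℂ) else 0))

/-- Every 3-subweb contributes the same logarithmic differential of the Jacobian. It is closed, so
the curvature will be covariant. -/
theorem IsFundamentalFormAt.pullback {τ : Plane → Plane} (h : IsFundamentalFormAt d σ (τ z) c)
    (hτ : AnalyticAt ℂ τ z) (hJ : jac (fderiv ℂ τ z) ≠ 0)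
    (hσ : ∀ᶠ w in 𝓝 z, ∀ v, σ' w v = σ (τ w) (fderiv ℂ τ w v)) :
    IsFundamentalFormAt d σ' z (c.comp (fderiv ℂ τ z) +
      tripleCount d • (jac (fderiv ℂ τ z))⁻¹ • fderiv ℂ (fun w => jac (fderiv ℂ τ w)) z) := by
  obtain ⟨L, h1, h2, h3, η, hη, rfl⟩ := h
  refine ⟨fun r => PlanarWeb.pullback τ (L r), fun r => pullback_analyticAt hτ (h1 r), ?_, ?_,
    fun r s t => (η r s t).comp (fderiv ℂ τ z) + (1 : ℂ) •
      (jac (fderiv ℂ τ z))⁻¹ • fderiv ℂ (fun w => jac (fderiv ℂ τ w)) z, ?_, ?_⟩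
  · intro r s hrs
    change wedge ((L r (τ z)).comp _) ((L s (τ z)).comp _) ≠ 0
    rw [wedge_comp]
    exact mul_ne_zero hJ (h2 r s hrs)
  · filter_upwards [hσ, hτ.continuousAt.eventually h3] with w e1 e2 v
    rw [e1, e2]
    rfl
  · intro r s t hrs hst
    rw [one_smul]
    exact (hη r s t hrs hst).pullback hτ hJ (h1 r).differentiableAt
      (h1 s).differentiableAt (h1 t).differentiableAt
  · refine Eq.trans ?_ (sum_triples_add_smul _ (fun _ _ _ => 1) _).symm
    simp only [ContinuousLinearMap.finsetSum_comp, tripleCount]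

theorem LocallySplits.pullback {τ : Plane → Plane} (h : LocallySplits d σ (τ z))
    (hτ : AnalyticAt ℂ τ z) (hJ : jac (fderiv ℂ τ z) ≠ 0)
    (hσ : ∀ᶠ w in 𝓝 z, ∀ v, σ' w v = σ (τ w) (fderiv ℂ τ w v)) : LocallySplits d σ' z := by
  obtain ⟨c, hc⟩ := h.exists_isFundamentalFormAt
  exact (hc.pullback hτ hJ hσ).locallySplits

theorem fderiv_ite_const {r : Fin d} {i : Fin d} {g : Plane → ℂ} (z : Plane) :
    ((if r = i then g z else 1))⁻¹ • fderiv ℂ (fun w => if r = i then g w else 1) z =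
      (if r = i then (1 : ℂ) else 0) • ((g z)⁻¹ • fderiv ℂ g z) := by
  split_ifs
  · rw [one_smul]
  · rw [clm_zero_smul, fderiv_fun_const]
    exact smul_zero (A := Plane →L[ℂ] ℂ) ((1 : ℂ)⁻¹)

/-- Multiplying the symmetric form by a unit adds a constant multiple of its logarithmic
differential to the fundamental form. -/
theorem IsFundamentalFormAt.mul (i : Fin d) {g : Plane → ℂ} (h : IsFundamentalFormAt d σ z c)
    (hg : AnalyticAt ℂ g z) (h0 : g z ≠ 0)
    (hσ : ∀ᶠ w in 𝓝 z, ∀ v, σ' w v = g w * σ w v) :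
    IsFundamentalFormAt d σ' z (c +
      unitWeight i • (g z)⁻¹ • fderiv ℂ g z) := by
  obtain ⟨L, h1, h2, h3, η, hη, rfl⟩ := h
  -- The whole unit is loaded on the `i`-th factor.
  set u : Fin d → Plane → ℂ := fun r w => if r = i then g w else 1 with hu
  have hua : ∀ r, AnalyticAt ℂ (u r) z := fun r => by
    by_cases hr : r = i
    · simpa [hu, hr] using hg
    · simpa [hu, hr] using analyticAt_const
  have hu0 : ∀ r, u r z ≠ 0 := fun r => by
    by_cases hr : r = i <;> simp [hu, hr, h0]
  refine ⟨fun r w => u r w • L r w, fun r => (hua r).smul (h1 r), ?_, ?_,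
    fun r s t => η r s t + (((u r z)⁻¹ • fderiv ℂ (u r) z + (u s z)⁻¹ • fderiv ℂ (u s) z) +
      (u t z)⁻¹ • fderiv ℂ (u t) z), ?_, ?_⟩
  · intro r s hrs
    rw [wedge_smul_smul]
    exact mul_ne_zero (mul_ne_zero (hu0 r) (hu0 s)) (h2 r s hrs)
  · filter_upwards [hσ, h3] with w e1 e2 v
    rw [e1, e2]
    simp only [FunLike.coe_smul, Pi.smul_apply, smul_eq_mul, Finset.prod_mul_distrib]
    congr 1
    simp [hu]
  · exact fun r s t hrs hst => (hη r s t hrs hst).smul (h1 r).differentiableAt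
      (h1 s).differentiableAt (h1 t).differentiableAt (hua r).differentiableAt
      (hua s).differentiableAt (hua t).differentiableAt (hu0 r) (hu0 s) (hu0 t)
  · refine (sum_triples_add_smul _ _ _).symm.trans ?_
    refine Finset.sum_congr rfl fun r _ => Finset.sum_congr rfl fun s _ => Finset.sum_congr rfl
      fun t _ => ?_
    simp only [hu]
    rw [clm_add_smul, clm_add_smul, fderiv_ite_const, fderiv_ite_const, fderiv_ite_const]

theorem dlog_prod {ι : Type*} (U : Finset ι) {b : ι → Plane → ℂ}
    (hb : ∀ i, AnalyticAt ℂ (b i) z) (h0 : ∀ i, b i z ≠ 0) :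
    (∏ i ∈ U, b i z)⁻¹ • fderiv ℂ (fun w => ∏ i ∈ U, b i w) z =
      ∑ i ∈ U, (b i z)⁻¹ • fderiv ℂ (b i) z := by
  classical
  induction U using Finset.induction_on with
  | empty => simp
  | insert i U hi ih =>
    simp only [Finset.prod_insert hi, Finset.sum_insert hi]
    rw [dlog_mul (g := fun w => ∏ i ∈ U, b i w) (hb i).differentiableAt
      (Finset.analyticAt_fun_prod U fun j _ => hb j).differentiableAt (h0 i)
      (Finset.prod_ne_zero_iff.2 fun j _ => h0 j), ih]

/-- Sums over ordered pairs of distinct indices reduced to power sums. It serves with v_s = 1/(p_r -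
p_s), which leaves only quantities computable from F at the root p_r. -/
theorem sum_pairs {ι : Type*} [DecidableEq ι] (U : Finset ι) (v : ι → ℂ) (A B : ℂ)
    (θ κ : Plane →L[ℂ] ℂ) :
    ∑ s ∈ U, ∑ t ∈ U.erase s, ((A * (v s * v t)) • θ + (B * (v s + v t)) • θ + κ) =
      (A * ((∑ s ∈ U, v s) ^ 2 - ∑ s ∈ U, v s ^ 2)) • θ +
        (B * (2 * ((U.card : ℂ) - 1) * ∑ s ∈ U, v s)) • θ +
        ((U.card : ℂ) * ((U.card : ℂ) - 1)) • κ := by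
  have h1 : ∀ s ∈ U, ∑ t ∈ U.erase s, ((A * (v s * v t)) • θ + (B * (v s + v t)) • θ + κ) =
      (A * (v s * (∑ t ∈ U, v t) - v s ^ 2)) • θ +
        (B * (((U.card : ℂ) - 2) * v s + ∑ t ∈ U, v t)) • θ + ((U.card : ℂ) - 1) • κ := by
    intro s hs
    rw [Finset.sum_erase_eq_sub hs]
    simp only [Finset.sum_add_distrib, ← clm_sum_smul, ← Finset.mul_sum, Finset.sum_const,
      ← Nat.cast_smul_eq_nsmul ℂ]
    module
  rw [Finset.sum_congr rfl h1]
  simp only [Finset.sum_add_distrib, ← clm_sum_smul, ← Finset.mul_sum, Finset.sum_const,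
    Finset.sum_sub_distrib, ← Finset.sum_mul, ← Nat.cast_smul_eq_nsmul ℂ]
  module

/-- The contribution of a root `p` of `F` to the fundamental form, in terms of the partial
derivatives of `F` at that root. -/
def rootTerm (d : ℕ) (Fx Fy p F₁ F₂ F₃ : ℂ) : Plane →L[ℂ] ℂ :=
  ((Fx + p * Fy) * F₃ / (6 * F₁ ^ 2) - ((d : ℂ) - 2) * Fy * F₂ / (2 * F₁ ^ 2)) • (dy - p • dx) -
    (((d : ℂ) - 1) * ((d : ℂ) - 2) / 2 * Fy / F₁) • dx

open Polynomial in
/-- The fundamental form as a sum over the roots of `F = σ(1, p)`. -/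
theorem IsFundamentalFormAt.eq_sum_roots (h : IsFundamentalFormAt d σ z c) (h0 : σ z (0, 1) ≠ 0)
    {G : ℂ[X]} (hG : ∀ p, G.eval p = σ z (1, p)) :
    c = (((d : ℂ) - 1) * ((d : ℂ) - 2) / 2) •
        ((σ z (0, 1))⁻¹ • fderiv ℂ (fun w => σ w (0, 1)) z) +
      ∑ p ∈ G.roots.toFinset, rootTerm d (fderiv ℂ (fun w => σ w (1, p)) z (1, 0))
        (fderiv ℂ (fun w => σ w (1, p)) z (0, 1)) p (G.derivative.eval p)
        (G.derivative.derivative.eval p) (G.derivative.derivative.derivative.eval p) := by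
  obtain ⟨L, hL, hind, hσ, η, hη, rfl⟩ := h
  -- Each factor is written as b_r (dy - p_r dx); since a₀ is the product of the b_r, none of them
  -- vanishes at `z`.
  set b : Fin d → Plane → ℂ := fun r w => L r w (0, 1) with hb
  have hσz := hσ.self_of_nhds
  have hb0 : ∀ r, b r z ≠ 0 := by
    rw [hσz] at h0
    exact fun r => Finset.prod_ne_zero_iff.1 h0 r (Finset.mem_univ r)
  have hban : ∀ r, AnalyticAt ℂ (b r) z := fun r => (hL r).clm_apply_const _
  set p : Fin d → Plane → ℂ := fun r w => -(L r w (1, 0)) / b r w with hp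
  have hpan : ∀ r, AnalyticAt ℂ (p r) z := fun r =>
    ((hL r).clm_apply_const _).fun_neg.fun_div (hban r) (hb0 r)
  have hform : ∀ r w, b r w ≠ 0 → L r w = b r w • (dy - p r w • dx) := fun r w hw => by
    refine clm_ext ?_ ?_
    · simp [hp]
      field_simp
    · simp [hb]
  have hLeq : ∀ r, (fun w => b r w • (dy - p r w • dx)) =ᶠ[𝓝 z] L r := fun r => by
    filter_upwards [(hban r).continuousAt.eventually_ne (hb0 r)] with w hw
    exact (hform r w hw).symm
  have hpne : ∀ r s, r ≠ s → p r z ≠ p s z := fun r s hrs h => hind r s hrs (by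
    rw [hform r z (hb0 r), hform s z (hb0 s), wedge_smul_smul, wedge_slope, h, sub_self, mul_zero])
  set D : Fin d → Plane →L[ℂ] ℂ := fun r => (b r z)⁻¹ • fderiv ℂ (b r) z with hD
  set S : Fin d → Fin d → Fin d → Plane →L[ℂ] ℂ := fun r s t =>
    slopeTerm (fderiv ℂ (p r) z (1, 0)) (fderiv ℂ (p r) z (0, 1)) (p r z) (p s z) (p t z) with hS
  -- The b_r contribute logarithmic differentials, distributed evenly so that the summand attached
  -- to `r` stays symmetric in `s` and `t`.
  have hηeq : ∀ r s t, r < s → s < t →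
      η r s t = (S r s t + D r) + (S s t r + D s) + (S t r s + D t) := by
    intro r s t hrs hst
    have h1 := ((isTripleFormAt_slope (hpan r).differentiableAt (hpan s).differentiableAt
      (hpan t).differentiableAt (hpne _ _ hrs.ne) (hpne _ _ (hrs.trans hst).ne)
      (hpne _ _ hst.ne)).smul (slope_differentiableAt (hpan r).differentiableAt)
      (slope_differentiableAt (hpan s).differentiableAt)
      (slope_differentiableAt (hpan t).differentiableAt) (hban r).differentiableAt
      (hban s).differentiableAt (hban t).differentiableAt (hb0 r) (hb0 s) (hb0 t)).congr
      (hLeq r) (hLeq s) (hLeq t)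
    rw [isTripleFormAt_unique (hind _ _ hrs.ne) (hind _ _ hst.ne) (hind _ _ (hrs.trans hst).ne')
      (hη r s t hrs hst) h1]
    simp only [hS, hD]
    abel
  have hsum : ∑ r, ∑ s ∈ Finset.Ioi r, ∑ t ∈ Finset.Ioi s, η r s t =
      ∑ r, ∑ s ∈ Finset.Ioi r, ∑ t ∈ Finset.Ioi s,
        ((S r s t + D r) + (S s t r + D s) + (S t r s + D t)) :=
    Finset.sum_congr rfl fun r _ => Finset.sum_congr rfl fun s hs => Finset.sum_congr rfl
      fun t ht => hηeq r s t (Finset.mem_Ioi.1 hs) (Finset.mem_Ioi.1 ht)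
  rw [hsum, sum_triples_eq (fun r s t => S r s t + D r)
    (fun r _ _ => by simp only [hS]; rw [slopeTerm_symm])]
  have hσ01 : (fun w => σ w (0, 1)) =ᶠ[𝓝 z] fun w => ∏ r, b r w := by
    filter_upwards [hσ] with w hw using hw _
  rw [hσ01.fderiv_eq, hσ01.eq_of_nhds, dlog_prod _ hban hb0]
  have hGprod : G = C (∏ r, b r z) * ∏ r, (X - C (p r z)) := by
    refine Polynomial.funext fun q => ?_
    rw [hG, hσz, eval_mul, eval_C, eval_prod, ← Finset.prod_mul_distrib]
    refine Finset.prod_congr rfl fun r _ => ?_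
    rw [hform r z (hb0 r)]
    simp
  have ha0 : ∏ r, b r z ≠ 0 := Finset.prod_ne_zero_iff.2 fun r _ => hb0 r
  have hGroots : G.roots.toFinset = Finset.univ.image fun r => p r z := by
    have hG0 : G ≠ 0 := by
      rw [hGprod]
      exact mul_ne_zero (C_ne_zero.2 ha0) (Finset.prod_ne_zero_iff.2 fun r _ => X_sub_C_ne_zero _)
    ext q
    rw [Multiset.mem_toFinset, mem_roots hG0, IsRoot, hGprod, eval_mul, eval_C, eval_prod,
      mul_eq_zero, or_iff_right ha0, Finset.prod_eq_zero_iff]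
    simp only [Finset.mem_univ, true_and, eval_sub, eval_X, eval_C, sub_eq_zero, Finset.mem_image]
    exact ⟨fun ⟨a, h⟩ => ⟨a, h.symm⟩, fun ⟨a, h⟩ => ⟨a, h.symm⟩⟩
  rw [hGroots, Finset.sum_image fun r _ s _ hrs => by_contra fun hne => hpne r s hne hrs,
    Finset.smul_sum, Finset.smul_sum, ← Finset.sum_add_distrib]
  refine Finset.sum_congr rfl fun r _ => ?_
  set U := Finset.univ.erase r with hU
  -- The cofactor of p - p_r in F; its value at p_r is F'(p_r).
  set H : ℂ[X] := C (∏ r, b r z) * ∏ s ∈ U, (X - C (p s z)) with hH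
  have hGH : G = (X - C (p r z)) * H := by
    rw [hGprod, hH, ← Finset.mul_prod_erase _ (fun r => X - C (p r z)) (Finset.mem_univ r)]
    ring
  obtain ⟨g1, g2, g3⟩ := derivatives_at_root H (p r z)
  obtain ⟨k1, k2⟩ := derivative_prod_sub U (fun s => p s z) (p r z) (∏ r, b r z)
    fun s hs => hpne r s (Finset.ne_of_mem_erase hs).symm
  rw [← hGH] at g1 g2 g3
  rw [← hH] at k1 k2
  have hK : H.eval (p r z) ≠ 0 := by
    rw [hH, eval_mul, eval_C, eval_prod]
    refine mul_ne_zero ha0 (Finset.prod_ne_zero_iff.2 fun s hs => ?_)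
    simp [sub_ne_zero, hpne r s (Finset.ne_of_mem_erase hs).symm]
  -- Implicit differentiation: with the slope frozen at p_r(z), the differential of F in (x, y) is
  -- -F'(p_r) dp_r.
  have hF : fderiv ℂ (fun w => σ w (1, p r z)) z = -(H.eval (p r z)) • fderiv ℂ (p r) z := by
    have e : (fun w => σ w (1, p r z)) =ᶠ[𝓝 z]
        fun w => (p r z - p r w) * (b r w * ∏ s ∈ U, L s w (1, p r z)) := by
      filter_upwards [hσ, (hban r).continuousAt.eventually_ne (hb0 r)] with w hw hbw
      rw [hw, ← Finset.mul_prod_erase _ _ (Finset.mem_univ r), ← mul_assoc]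
      congr 1
      rw [hform r w hbw]
      simp
      ring
    rw [e.fderiv_eq, fderiv_fun_mul ((hpan r).differentiableAt.const_sub _)
      ((hban r).differentiableAt.fun_mul (Finset.analyticAt_fun_prod U fun s _ =>
        (hL s).clm_apply_const _).differentiableAt), sub_self, clm_zero_smul, zero_add,
      fderiv_const_sub, hH, eval_mul, eval_C, eval_prod, smul_neg, ← neg_smul]
    congr 2
    rw [← Finset.mul_prod_erase _ _ (Finset.mem_univ r), mul_assoc, ← Finset.prod_mul_distrib]
    congr 1
    refine Finset.prod_congr rfl fun s _ => ?_
    rw [hform s z (hb0 s)]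
    simp
  rw [hF, g1, g2, g3, k1, k2]
  have hcard : (U.card : ℂ) = (d : ℂ) - 1 := by
    rw [hU, Finset.card_erase_of_mem (Finset.mem_univ r), Finset.card_univ, Fintype.card_fin,
      Nat.cast_pred (Fin.pos r)]
  have hinner : ∑ s ∈ U, ∑ t ∈ U.erase s, (S r s t + D r) =
      ∑ s ∈ U, ∑ t ∈ U.erase s,
        ((-(fderiv ℂ (p r) z (1, 0) + p r z * fderiv ℂ (p r) z (0, 1)) *
            (1 / (p r z - p s z) * (1 / (p r z - p t z)))) • (dy - p r z • dx) +
          (fderiv ℂ (p r) z (0, 1) * (1 / (p r z - p s z) + 1 / (p r z - p t z))) •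
            (dy - p r z • dx) + (fderiv ℂ (p r) z (0, 1) • dx + D r)) := by
    refine Finset.sum_congr rfl fun s _ => Finset.sum_congr rfl fun t _ => ?_
    simp only [hS, slopeTerm, neg_mul]
    abel
  rw [hinner, sum_pairs U (fun s => 1 / (p r z - p s z))
    (-(fderiv ℂ (p r) z (1, 0) + p r z * fderiv ℂ (p r) z (0, 1))), hcard]
  generalize (∑ s ∈ U, 1 / (p r z - p s z)) = S1
  generalize (∑ s ∈ U, (1 / (p r z - p s z)) ^ 2) = S2
  generalize eval (p r z) H = K at *
  simp only [rootTerm, FunLike.coe_smul, Pi.smul_apply, smul_eq_mul]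
  generalize fderiv ℂ (p r) z (1, 0) = px
  generalize fderiv ℂ (p r) z (0, 1) = py
  -- With K = F'(p_r) one has F'' = 2 K S1 and F''' = 3 K (S1² - S2), while the derivatives of F in
  -- x and y are -K px and -K py. These substitutions turn `rootTerm` into the slope expression.
  have f1 : (-K * px + p r z * (-K * py)) * (3 * (K * (S1 ^ 2 - S2))) / (6 * K ^ 2) =
      -(px + p r z * py) * (S1 ^ 2 - S2) / 2 := by
    field_simp
    ring
  have f2 : ((d : ℂ) - 2) * (-K * py) * (2 * (K * S1)) / (2 * K ^ 2) = -((d : ℂ) - 2) * py * S1 := by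
    field_simp
  have f3 : ((d : ℂ) - 1) * ((d : ℂ) - 2) / 2 * (-K * py) / K =
      -(((d : ℂ) - 1) * ((d : ℂ) - 2) / 2 * py) := by
    field_simp
  rw [f1, f2, f3]
  module

/-- A shear exchanging the coordinates. -/
def shear (t : ℂ) : Plane →L[ℂ] Plane := dy.prod (dx + t • dy)

theorem jac_shear (t : ℂ) : jac (shear t) = -1 := by simp [jac, shear]

theorem fderiv_shear (t : ℂ) (w : Plane) : fderiv ℂ (shear t) w = shear t :=
  (shear t).fderiv

/-- The shear sends (0, 1) to (1, t), and a nonzero linear form vanishes at (1, t) for at most one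
`t`. -/
theorem exists_shear {L : Fin d → Plane →L[ℂ] ℂ} (hL : ∀ r, L r ≠ 0) :
    ∃ t : ℂ, ∀ r, L r (shear t (0, 1)) ≠ 0 := by
  have hfin : (⋃ r, {t : ℂ | L r (1, t) = 0}).Finite := by
    refine Set.finite_iUnion fun r => ?_
    by_cases hB : L r (0, 1) = 0
    · have hA : L r (1, 0) ≠ 0 := fun hA => hL r (clm_ext (by simpa using hA) (by simpa using hB))
      convert Set.finite_empty
      ext t
      simp only [Set.mem_ofPred_eq, Set.mem_empty_iff_false, iff_false]
      rw [clm_apply, hB]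
      simpa using hA
    · refine (Set.finite_singleton (-(L r (1, 0)) / L r (0, 1))).subset fun t ht => ?_
      simp only [Set.mem_ofPred_eq] at ht
      rw [clm_apply] at ht
      simp only [one_mul] at ht
      rw [Set.mem_singleton_iff, eq_div_iff hB]
      linear_combination ht
  obtain ⟨t, ht⟩ := hfin.exists_notMem
  refine ⟨t, fun r h => ht (Set.mem_iUnion.2 ⟨r, ?_⟩)⟩
  simpa [shear] using h

/-- After a shear the leading coefficient is nonzero, and `IsFundamentalFormAt.eq_sum_roots`
expresses the form through `σ` alone, whatever the factorization. -/
theorem IsFundamentalFormAt.unique {c' : Plane →L[ℂ] ℂ} (h : IsFundamentalFormAt d σ z c)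
    (h' : IsFundamentalFormAt d σ z c') : c = c' := by
  -- With fewer than two factors nothing prevents a factor from vanishing, so no shear is available;
  -- but there are no triples to sum over either.
  by_cases hd : d < 2
  · have hzero : ∀ {c}, IsFundamentalFormAt d σ z c → c = 0 := by
      rintro c ⟨L, -, -, -, η, -, rfl⟩
      refine Finset.sum_eq_zero fun r _ => ?_
      have : Finset.Ioi r = ∅ := by
        ext s
        simp only [Finset.mem_Ioi, Finset.notMem_empty, iff_false, not_lt]
        omega
      rw [this, Finset.sum_empty]
    rw [hzero h, hzero h']
  push Not at hd
  obtain ⟨L, hL, hind, hσ, -⟩ := id h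
  have hL0 : ∀ r, L r z ≠ 0 := fun r hr => by
    obtain ⟨s, hs⟩ : ∃ s : Fin d, r ≠ s := by
      have : Nontrivial (Fin d) := Fin.nontrivial_iff_two_le.2 hd
      exact (exists_ne r).imp fun _ => Ne.symm
    refine hind r s hs ?_
    simp [hr, wedge]
  obtain ⟨t, ht⟩ := exists_shear hL0
  set z' : Plane := (z.2 - t * z.1, z.1) with hz'
  have hTz : shear t z' = z := by
    ext <;> simp [shear, hz']
  set σ' : Plane → Plane → ℂ := fun w v => σ (shear t w) (shear t v) with hσ'
  have hpb : ∀ {c}, IsFundamentalFormAt d σ z c → IsFundamentalFormAt d σ' z' _ := fun {c} hc =>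
    IsFundamentalFormAt.pullback (τ := shear t) (z := z') (c := c) (σ := σ) (σ' := σ')
      (by rw [hTz]; exact hc) ((shear t).analyticAt _)
      (by rw [fderiv_shear, jac_shear]; exact neg_ne_zero.2 one_ne_zero)
      (Eventually.of_forall fun w v => by rw [fderiv_shear])
  have h0 : σ' z' (0, 1) ≠ 0 := by
    rw [hσ']
    simp only [hTz]
    rw [hσ.self_of_nhds]
    exact Finset.prod_ne_zero_iff.2 fun r _ => ht r
  let G : Polynomial ℂ := ∏ r, (Polynomial.C (L r z (shear t (1, 0))) +
    Polynomial.C (L r z (shear t (0, 1))) * Polynomial.X)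
  have hG : ∀ p, G.eval p = σ' z' (1, p) := fun p => by
    simp only [hσ', hTz]
    rw [hσ.self_of_nhds, Polynomial.eval_prod]
    refine Finset.prod_congr rfl fun r _ => ?_
    have := clm_apply ((L r z).comp (shear t)) (1, p)
    simp only [ContinuousLinearMap.comp_apply] at this
    rw [this]
    simp
    ring
  have e := ((hpb h).eq_sum_roots h0 hG).trans ((hpb h').eq_sum_roots h0 hG).symm
  -- The Jacobian correction is common to both sides. What remains is compared at the preimages of
  -- the basis vectors under the shear.
  rw [add_left_inj, fderiv_shear] at e
  ext
  · have := congrArg (fun A : Plane →L[ℂ] ℂ => A (-t, 1)) e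
    simpa [shear] using this
  · have := congrArg (fun A : Plane →L[ℂ] ℂ => A (1, 0)) e
    simpa [shear] using this

theorem IsFundamentalFormAt.fundamentalForm_eq (h : IsFundamentalFormAt d σ z c) :
    fundamentalForm d σ z = c := by
  have hex : ∃ c, IsFundamentalFormAt d σ z c := ⟨c, h⟩
  rw [fundamentalForm, dif_pos hex]
  exact hex.choose_spec.unique h

theorem LocallySplits.isFundamentalFormAt (h : LocallySplits d σ z) :
    IsFundamentalFormAt d σ z (fundamentalForm d σ z) := by
  obtain ⟨c, hc⟩ := h.exists_isFundamentalFormAt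
  rwa [hc.fundamentalForm_eq]

/-- The definition chooses a value at each point separately. One factorization serves all nearby
points, and by uniqueness the chosen values agree with the explicit sum of `tripleForm`. -/
theorem LocallySplits.analyticAt_fundamentalForm (h : LocallySplits d σ z) :
    AnalyticAt ℂ (fundamentalForm d σ) z := by
  obtain ⟨L, h1, h2, h3⟩ := h
  have han : AnalyticAt ℂ (fun w => ∑ r, ∑ s ∈ Finset.Ioi r, ∑ t ∈ Finset.Ioi s,
      tripleForm (L r) (L s) (L t) w) z := by
    refine Finset.analyticAt_fun_sum _ fun r _ => Finset.analyticAt_fun_sum _ fun s hs =>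
      Finset.analyticAt_fun_sum _ fun t ht => ?_
    rw [Finset.mem_Ioi] at hs ht
    exact tripleForm_analyticAt (h1 r) (h1 s) (h1 t) (h2 _ _ hs.ne) (h2 _ _ ht.ne)
      (h2 _ _ (hs.trans ht).ne')
  refine han.congr ?_
  have e1 : ∀ᶠ w in 𝓝 z, ∀ r, AnalyticAt ℂ (L r) w :=
    Filter.eventually_all.2 fun r => (h1 r).eventually_analyticAt
  have e2 : ∀ᶠ w in 𝓝 z, ∀ r s, r ≠ s → wedge (L r w) (L s w) ≠ 0 := by
    refine Filter.eventually_all.2 fun r => Filter.eventually_all.2 fun s => ?_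
    by_cases hrs : r = s
    · simp [hrs]
    · filter_upwards [(wedge_analyticAt (h1 r) (h1 s)).continuousAt.eventually_ne (h2 r s hrs)]
        with w hw _ using hw
  filter_upwards [e1, e2, h3.eventually_nhds] with w w1 w2 w3
  exact (isFundamentalFormAt_of_factorization w1 w2 w3).fundamentalForm_eq.symm

/-- The curvature is covariant, and does not change when the symmetric form is multiplied by a
unit. -/
theorem LocallySplits.curvature_pullback {τ : Plane → Plane} (h : LocallySplits d σ (τ z))
    (hτ : AnalyticAt ℂ τ z) (hJ : jac (fderiv ℂ τ z) ≠ 0)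
    (hσ : ∀ᶠ w in 𝓝 z, ∀ v, σ' w v = σ (τ w) (fderiv ℂ τ w v)) :
    curvature d σ' z = jac (fderiv ℂ τ z) * curvature d σ (τ z) := by
  have hJan := jac_analyticAt hτ
  have e : fundamentalForm d σ' =ᶠ[𝓝 z] fun w => PlanarWeb.pullback τ (fundamentalForm d σ) w +
      tripleCount d • ((jac (fderiv ℂ τ w))⁻¹ • fderiv ℂ (fun w => jac (fderiv ℂ τ w)) w) := by
    filter_upwards [hτ.continuousAt.eventually h.eventually, hτ.eventually_analyticAt,
      hJan.continuousAt.eventually_ne hJ, hσ.eventually_nhds] with w w1 w2 w3 w4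
    exact (w1.isFundamentalFormAt.pullback w2 w3 w4).fundamentalForm_eq
  have han := h.analyticAt_fundamentalForm
  have hdl := ((hJan.fun_inv hJ).fun_smul hJan.fderiv).differentiableAt
  rw [curvature, extd_congr e, extd_add (pullback_differentiableAt hτ han.differentiableAt)
    (hdl.fun_const_smul (tripleCount d)), extd_const_smul _ hdl, extd_dlog hJan hJ, mul_zero, add_zero,
    extd_pullback hτ han.differentiableAt]
  rfl

/-- The added logarithmic differential is closed. Positivity of `d` provides a factor to carry the
unit. -/
theorem LocallySplits.curvature_mul (hd : 0 < d) {g : Plane → ℂ} (h : LocallySplits d σ z)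
    (hg : AnalyticAt ℂ g z) (h0 : g z ≠ 0)
    (hσ : ∀ᶠ w in 𝓝 z, ∀ v, σ' w v = g w * σ w v) :
    curvature d σ' z = curvature d σ z := by
  have e : fundamentalForm d σ' =ᶠ[𝓝 z] fun w => fundamentalForm d σ w +
      unitWeight (⟨0, hd⟩ : Fin d) • ((g w)⁻¹ • fderiv ℂ g w) := by
    filter_upwards [h.eventually, hg.eventually_analyticAt,
      hg.continuousAt.eventually_ne h0, hσ.eventually_nhds] with w w1 w2 w3 w4
    exact (w1.isFundamentalFormAt.mul ⟨0, hd⟩ w2 w3 w4).fundamentalForm_eq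
  have han := h.analyticAt_fundamentalForm
  have hdl := ((hg.fun_inv h0).fun_smul hg.fderiv).differentiableAt
  rw [curvature, extd_congr e, extd_add han.differentiableAt
    (hdl.fun_const_smul (unitWeight (⟨0, hd⟩ : Fin d))), extd_const_smul _ hdl, extd_dlog hg h0, mul_zero, add_zero]
  rfl

end PlanarWeb
end

/-! ### Operations on analytic families of polynomials. -/

noncomputable section

namespace PlanarWeb

namespace AnalyticFamily

open Polynomial

variable {Q Q' : Plane → ℂ[X]} {z₀ : Plane}

theorem C {g : Plane → ℂ} (hg : AnalyticAt ℂ g z₀) :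
    AnalyticFamily (fun z => Polynomial.C (g z)) z₀ where
  bound := ⟨0, fun z => (natDegree_C _).le⟩
  coeff i := by
    simp only [coeff_C]
    split_ifs
    exacts [hg, analyticAt_const]

theorem const (q : ℂ[X]) : AnalyticFamily (fun _ => q) z₀ where
  bound := ⟨_, fun _ => le_rfl⟩
  coeff _ := analyticAt_const

theorem add (h : AnalyticFamily Q z₀) (h' : AnalyticFamily Q' z₀) :
    AnalyticFamily (fun z => Q z + Q' z) z₀ where
  bound := by
    obtain ⟨N, hN⟩ := h.bound
    obtain ⟨N', hN'⟩ := h'.bound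
    exact ⟨max N N', fun z => (natDegree_add_le _ _).trans (max_le_max (hN z) (hN' z))⟩
  coeff i := by
    simp only [coeff_add]
    exact (h.coeff i).add (h'.coeff i)

theorem mul (h : AnalyticFamily Q z₀) (h' : AnalyticFamily Q' z₀) :
    AnalyticFamily (fun z => Q z * Q' z) z₀ where
  bound := by
    obtain ⟨N, hN⟩ := h.bound
    obtain ⟨N', hN'⟩ := h'.bound
    exact ⟨N + N', fun z => natDegree_mul_le.trans (add_le_add (hN z) (hN' z))⟩
  coeff i := by
    simp only [coeff_mul]
    exact Finset.analyticAt_fun_sum _ fun j _ => (h.coeff _).mul (h'.coeff _)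

theorem pow (h : AnalyticFamily Q z₀) (n : ℕ) : AnalyticFamily (fun z => Q z ^ n) z₀ := by
  induction n with
  | zero => simpa using const 1
  | succ n ih => simpa only [pow_succ] using ih.mul h

theorem prod {ι : Type*} (U : Finset ι) {Q : ι → Plane → ℂ[X]}
    (h : ∀ i ∈ U, AnalyticFamily (Q i) z₀) : AnalyticFamily (fun z => ∏ i ∈ U, Q i z) z₀ := by
  classical
  induction U using Finset.induction_on with
  | empty => simpa using const 1
  | insert i U hi ih =>
    simp only [Finset.prod_insert hi]
    exact (h i (Finset.mem_insert_self _ _)).mul (ih fun j hj => h j (Finset.mem_insert_of_mem hj))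

theorem sum {ι : Type*} (U : Finset ι) {Q : ι → Plane → ℂ[X]}
    (h : ∀ i ∈ U, AnalyticFamily (Q i) z₀) : AnalyticFamily (fun z => ∑ i ∈ U, Q i z) z₀ := by
  classical
  induction U using Finset.induction_on with
  | empty => simpa using const 0
  | insert i U hi ih =>
    simp only [Finset.sum_insert hi]
    exact (h i (Finset.mem_insert_self _ _)).add (ih fun j hj => h j (Finset.mem_insert_of_mem hj))

theorem sub_C {g : Plane → ℂ} (hg : AnalyticAt ℂ g z₀) :
    AnalyticFamily (fun z => X - Polynomial.C (g z)) z₀ := by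
  simpa [sub_eq_add_neg] using (const X).add (C (z₀ := z₀) hg.fun_neg)

end AnalyticFamily

/-! ### The web as a polynomial in the slope; local splitting and traces. -/

section WebPolynomial

open Polynomial

/-- `F(x,y,p)` as a polynomial in `p`. -/
def webPolynomial (d : ℕ) (a : ℕ → Plane → ℂ) (z : Plane) : ℂ[X] :=
  ∑ k ∈ Finset.range (d + 1), C (a k z) * X ^ (d - k)

variable {d : ℕ} {a : ℕ → Plane → ℂ} {z : Plane}

theorem webPolynomial_eval (p : ℂ) :
    (webPolynomial d a z).eval p = webPoly d a z.1 z.2 p := by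
  simp [webPolynomial, webPoly, eval_finsetSum]

theorem webPolynomial_eval_eq_sum (p : ℂ) :
    (webPolynomial d a z).eval p = ∑ k ∈ Finset.range (d + 1), a k z * p ^ (d - k) := by
  simp [webPolynomial, eval_finsetSum]

theorem webPolynomial_eval_eq_symForm (p : ℂ) :
    (webPolynomial d a z).eval p = symForm d a z (1, p) := by
  simp [webPolynomial_eval, webPoly, symForm]

theorem symForm_zero_one : symForm d a z (0, 1) = a 0 z := by
  rw [symForm, Finset.sum_eq_single 0]
  · simp
  · intro k _ hk
    simp [hk]
  · simp

theorem symForm_smul (t : ℂ) (v : Plane) : symForm d a z (t • v) = t ^ d * symForm d a z v := by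
  rw [symForm, symForm, Finset.mul_sum]
  refine Finset.sum_congr rfl fun k hk => ?_
  have hk' : k ≤ d := Nat.lt_succ_iff.1 (Finset.mem_range.1 hk)
  simp only [Prod.smul_fst, Prod.smul_snd, smul_eq_mul, mul_pow]
  conv_rhs => rw [← Nat.add_sub_cancel' hk', pow_add, Nat.add_sub_cancel' hk']
  ring

theorem analyticFamily_webPolynomial (ha : ∀ k, AnalyticAt ℂ (a k) z) :
    AnalyticFamily (webPolynomial d a) z :=
  AnalyticFamily.sum _ fun k _ => (AnalyticFamily.C (ha k)).mul (AnalyticFamily.const _)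

theorem webPolynomial_natDegree_le : (webPolynomial d a z).natDegree ≤ d :=
  natDegree_sum_le_of_forall_le _ _ fun k _ =>
    (natDegree_C_mul_X_pow_le _ _).trans (Nat.sub_le _ _)

theorem webPolynomial_coeff : (webPolynomial d a z).coeff d = a 0 z := by
  rw [webPolynomial, finsetSum_coeff, Finset.sum_eq_single 0]
  · simp
  · intro k hk hk0
    have hk' : k ≤ d := Nat.lt_succ_iff.1 (Finset.mem_range.1 hk)
    rw [coeff_C_mul_X_pow, if_neg (by omega)]
  · simp

theorem webPolynomial_natDegree (h : a 0 z ≠ 0) : (webPolynomial d a z).natDegree = d :=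
  le_antisymm webPolynomial_natDegree_le (le_natDegree_of_ne_zero (by rwa [webPolynomial_coeff]))

theorem webPolynomial_leadingCoeff (h : a 0 z ≠ 0) :
    (webPolynomial d a z).leadingCoeff = a 0 z := by
  rw [leadingCoeff, webPolynomial_natDegree h, webPolynomial_coeff]

theorem webPolynomial_ne_zero (h : a 0 z ≠ 0) : webPolynomial d a z ≠ 0 := fun h0 => h (by
  rw [← webPolynomial_coeff (d := d) (a := a) (z := z), h0, coeff_zero])

/-- A homogeneous form is determined by its dehomogenization. -/
theorem symForm_eq_prod {φ : Fin d → ℂ}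
    (hQ : webPolynomial d a z = C (a 0 z) * ∏ r, (X - C (φ r))) (v : Plane) :
    symForm d a z v = a 0 z * ∏ r, (v.2 - φ r * v.1) := by
  by_cases hv : v.1 = 0
  · have : v = v.2 • ((0, 1) : Plane) := by ext <;> simp [hv]
    rw [hv]
    conv_lhs => rw [this]
    rw [symForm_smul, symForm_zero_one]
    simp [mul_comm]
  · have : v = v.1 • ((1, v.2 / v.1) : Plane) := by ext <;> simp [mul_div_cancel₀, hv]
    conv_lhs => rw [this]
    rw [symForm_smul, ← webPolynomial_eval_eq_symForm, hQ, eval_mul, eval_C, eval_prod,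
      mul_left_comm, ← Fin.prod_const, ← Finset.prod_mul_distrib]
    congr 1
    refine Finset.prod_congr rfl fun r _ => ?_
    simp only [eval_sub, eval_X, eval_C]
    field_simp

/-- A nonzero leading coefficient excludes vertical factors, so each factor is given up to scale by
its slope, and independence of two factors means that their slopes differ. -/
theorem webPolynomial_nodup_of_splitsDistinct (h0 : a 0 z ≠ 0)
    (h : SplitsDistinct d (symForm d a z)) : (webPolynomial d a z).roots.Nodup := by
  obtain ⟨ℓ, hℓ, hind⟩ := h
  have hb : ∀ r, ℓ r (0, 1) ≠ 0 := by
    rw [← symForm_zero_one (d := d) (a := a) (z := z), hℓ] at h0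
    exact fun r => Finset.prod_ne_zero_iff.1 h0 r (Finset.mem_univ r)
  have hval : ∀ r (p : ℂ), ℓ r (1, p) = ℓ r (0, 1) * (p - -(ℓ r (1, 0)) / ℓ r (0, 1)) := by
    intro r p
    have : ((1, p) : Plane) = (1, 0) + p • (0, 1) := by ext <;> simp
    rw [this, map_add, map_smul, smul_eq_mul]
    have := hb r
    field_simp
    ring
  have hQ : webPolynomial d a z = C (a 0 z) *
      (Multiset.map (fun x => X - C x)
        (Finset.univ.val.map fun r => -(ℓ r (1, 0)) / ℓ r (0, 1))).prod := by
    rw [Multiset.map_map]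
    change _ = C (a 0 z) * ∏ r, (X - C (-(ℓ r (1, 0)) / ℓ r (0, 1)))
    refine Polynomial.funext fun p => ?_
    rw [webPolynomial_eval_eq_symForm, hℓ, ← symForm_zero_one (d := d) (a := a) (z := z), hℓ, eval_mul, eval_C,
      eval_prod, ← Finset.prod_mul_distrib]
    refine Finset.prod_congr rfl fun r _ => ?_
    rw [hval]
    simp
  rw [hQ, roots_C_mul _ h0, roots_multiset_prod_X_sub_C]
  refine Finset.univ.nodup.map fun r s hrs => ?_
  by_contra hne
  have hli := hind r s hne
  rw [LinearIndependent.pair_iff] at hli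
  have h1 := hb r
  have h2 := hb s
  replace hrs : -(ℓ r (1, 0)) / ℓ r (0, 1) = -(ℓ s (1, 0)) / ℓ s (0, 1) := hrs
  rw [div_eq_div_iff h1 h2] at hrs
  refine h2 (hli (ℓ s (0, 1)) (-(ℓ r (0, 1))) ?_).1
  ext
  · simp
    linear_combination -hrs
  · simp
    ring

/-- Where the roots of `F` are simple, the web is a superposition of `d` foliations. -/
theorem locallySplits_of_nodup (hd : 0 < d) (ha : ∀ k, AnalyticAt ℂ (a k) z) (h0 : a 0 z ≠ 0)
    (hn : (webPolynomial d a z).roots.Nodup) : LocallySplits d (symForm d a) z := by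
  classical
  set Q := webPolynomial d a with hQ
  have hfam : AnalyticFamily Q z := analyticFamily_webPolynomial ha
  have hQ0 : Q z ≠ 0 := webPolynomial_ne_zero h0
  set T := (Q z).roots.toFinset with hT
  have hTcard : T.card = d := by
    rw [hT, Multiset.toFinset_card_of_nodup hn, ← (IsAlgClosed.splits (Q z)).natDegree_eq_card_roots,
      webPolynomial_natDegree h0]
  obtain ⟨ρ, hρ, hsep⟩ := exists_pos_radius T
  have hTroot : ∀ p, p ∈ T ↔ (Q z).eval p = 0 := fun p => by
    rw [hT, Multiset.mem_toFinset, mem_roots hQ0]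
    rfl
  have hs : ∀ p ∈ T, ∀ s ∈ Metric.sphere p ρ, (Q z).eval s ≠ 0 := fun p hp s hs h => by
    have hsT := (hTroot s).2 h
    have hd : dist p s = ρ := by rw [dist_comm]; exact hs
    have hps : p ≠ s := by
      rintro rfl
      rw [dist_self] at hd
      exact hρ.ne hd
    have := hsep p hp s hsT hps
    rw [hd] at this
    linarith
  -- The discs separate the roots, which are simple, so each disc isolates exactly one; it then
  -- depends analytically on the parameters.
  have hone : ∀ p ∈ T, (Q z).roots.filter (· ∈ Metric.ball p ρ) = {p} := fun p hp => by
    refine (Multiset.Nodup.ext (hn.filter _) (Multiset.nodup_singleton p)).2 fun q => ?_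
    rw [Multiset.mem_filter, Multiset.mem_singleton]
    constructor
    · rintro ⟨hq, hqp⟩
      by_contra hne
      have := hsep q (Multiset.mem_toFinset.2 hq) p hp hne
      rw [Metric.mem_ball] at hqp
      linarith
    · rintro rfl
      exact ⟨Multiset.mem_toFinset.1 hp, Metric.mem_ball_self hρ⟩
  have hφ : ∀ p ∈ T, ∃ φ : Plane → ℂ, AnalyticAt ℂ φ z ∧ φ z = p ∧
      ∀ᶠ w in 𝓝 z, φ w ∈ (Q w).roots := fun p hp => by
    obtain ⟨φ, h1, h2⟩ := exists_analyticAt_root hfam hρ (hs p hp) (by rw [hone p hp]; simp)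
    refine ⟨φ, h1, h2.self_of_nhds p fun q hq => ?_, ?_⟩
    · rw [hone p hp] at hq
      exact Multiset.mem_singleton.1 hq
    · filter_upwards [h2, eventually_card_roots_eq hfam hρ (hs p hp)] with w w1 w2
      rw [hone p hp, Multiset.card_singleton, Multiset.card_eq_one] at w2
      obtain ⟨q, hq⟩ := w2
      have hφq : φ w = q := w1 q fun q' hq' => by
        rw [hq] at hq'
        exact Multiset.mem_singleton.1 hq'
      have : q ∈ (Q w).roots.filter (· ∈ Metric.ball p ρ) := by
        rw [hq]
        exact Multiset.mem_singleton_self q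
      rw [hφq]
      exact (Multiset.mem_filter.1 this).1
  choose! φ hφan hφz hφroot using hφ
  let e : Fin d ≃ T := (finCongr hTcard.symm).trans T.equivFin.symm
  have heinj : ∀ r s, r ≠ s → (e r : ℂ) ≠ e s := fun r s hrs h => hrs (e.injective (Subtype.ext h))
  have hfac : ∀ᶠ w in 𝓝 z, Q w = C (a 0 w) * ∏ r, (X - C (φ (e r) w)) := by
    have e1 : ∀ᶠ w in 𝓝 z, ∀ r, φ (e r) w ∈ (Q w).roots :=
      Filter.eventually_all.2 fun r => hφroot _ (e r).2
    have e2 : ∀ᶠ w in 𝓝 z, ∀ r s, r ≠ s → φ (e r) w ≠ φ (e s) w := by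
      refine Filter.eventually_all.2 fun r => Filter.eventually_all.2 fun s => ?_
      by_cases hrs : r = s
      · simp [hrs]
      · have : φ (e r) z ≠ φ (e s) z := by
          rw [hφz _ (e r).2, hφz _ (e s).2]
          exact heinj r s hrs
        filter_upwards [((hφan _ (e r).2).continuousAt.sub
          (hφan _ (e s).2).continuousAt).eventually_ne (sub_ne_zero.2 this)] with w hw _
        exact sub_ne_zero.1 hw
    filter_upwards [e1, e2, (ha 0).continuousAt.eventually_ne h0] with w w1 w2 w3
    have hle : (Finset.univ.val.map fun r => φ (e r) w) ≤ (Q w).roots := by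
      rw [Multiset.le_iff_subset (Finset.univ.nodup.map fun r s hrs =>
        by_contra fun hne => w2 r s hne hrs)]
      intro q hq
      obtain ⟨r, -, rfl⟩ := Multiset.mem_map.1 hq
      exact w1 r
    -- The `d` continued roots are distinct, and the degree leaves no room for further ones or for
    -- multiplicities.
    have heq := Multiset.eq_of_le_of_card_le hle (by
      refine (card_roots' _).trans ?_
      rw [Multiset.card_map, Finset.card_val, Finset.card_univ, Fintype.card_fin]
      exact webPolynomial_natDegree_le)
    conv_lhs => rw [(IsAlgClosed.splits (Q w)).eq_prod_roots]
    rw [hQ, webPolynomial_leadingCoeff w3, ← hQ, ← heq, Multiset.map_map]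
    rfl
  -- The leading coefficient is absorbed by the first factor, which exists since d > 0.
  refine ⟨fun r w => (if r = ⟨0, hd⟩ then a 0 w else 1) • (dy - φ (e r) w • dx), fun r => ?_,
    fun r s hrs => ?_, ?_⟩
  · have h1 : AnalyticAt ℂ (fun w => dy - φ (e r) w • dx) z :=
      analyticAt_const.fun_sub ((hφan _ (e r).2).fun_smul analyticAt_const)
    by_cases hr : r = ⟨0, hd⟩
    · simp only [if_pos hr]
      exact (ha 0).fun_smul h1
    · simpa [hr] using h1
  · rw [wedge_smul_smul, wedge_slope, hφz _ (e r).2, hφz _ (e s).2]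
    refine mul_ne_zero (mul_ne_zero ?_ ?_) (sub_ne_zero.2 (heinj r s hrs).symm)
    all_goals split_ifs <;> simp [h0]
  · filter_upwards [hfac] with w hw v
    rw [symForm_eq_prod hw]
    simp only [FunLike.coe_smul, Pi.smul_apply, smul_eq_mul, Finset.prod_mul_distrib]
    congr 1
    simp

/-- Contour integrals of `k/F` over a fixed circle are analytic in the parameters and, where the
roots are simple, are sums over the roots of `F` in the disc. -/
theorem analyticAt_trace {Q : Plane → ℂ[X]} {z₀ : Plane} (h : AnalyticFamily Q z₀) {c : ℂ} {ρ : ℝ}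
    {k : Plane × ℂ → ℂ} (hρ : 0 < ρ) (hk : ∀ s ∈ Metric.closedBall c ρ, AnalyticAt ℂ k (z₀, s))
    (hs : ∀ s ∈ Metric.sphere c ρ, (Q z₀).eval s ≠ 0) :
    AnalyticAt ℂ (fun z => (2 * Real.pi * Complex.I : ℂ)⁻¹ *
      ∮ s in C(c, ρ), ((Q z).eval s)⁻¹ * k (z, s)) z₀ :=
  analyticAt_const.mul (analyticAt_circleIntegral (g := fun q : Plane × ℂ =>
    ((Q q.1).eval q.2)⁻¹ * k q) hρ.le fun s hss =>
      ((h.eval s).inv (hs s hss)).mul (hk s (Metric.sphere_subset_closedBall hss)))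

theorem eventually_analyticAt_ball {c : ℂ} {ρ : ℝ} {z₀ : Plane} {k : Plane × ℂ → ℂ}
    (hk : ∀ s ∈ Metric.closedBall c ρ, AnalyticAt ℂ k (z₀, s)) :
    ∀ᶠ z in 𝓝 z₀, ∀ s ∈ Metric.closedBall c ρ, AnalyticAt ℂ k (z, s) :=
  (isCompact_closedBall c ρ).eventually_forall_of_forall_eventually fun s hs =>
    (hk s hs).eventually_analyticAt

theorem differentiableOn_slice {k : Plane × ℂ → ℂ} {z : Plane} {K : Set ℂ}
    (hk : ∀ s ∈ K, AnalyticAt ℂ k (z, s)) : DifferentiableOn ℂ (fun s => k (z, s)) K := fun s hs =>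
  (DifferentiableAt.fun_comp' (g := k) (f := fun s => (z, s)) s (hk s hs).differentiableAt
    ((differentiableAt_const z).prodMk differentiableAt_id)).differentiableWithinAt

open Classical in
theorem eventually_trace_eq {Q : Plane → ℂ[X]} {z₀ : Plane} (h : AnalyticFamily Q z₀) {c : ℂ}
    {ρ : ℝ} {k : Plane × ℂ → ℂ} (hρ : 0 < ρ)
    (hk : ∀ s ∈ Metric.closedBall c ρ, AnalyticAt ℂ k (z₀, s))
    (hs : ∀ s ∈ Metric.sphere c ρ, (Q z₀).eval s ≠ 0)
    (hdeg : ∀ᶠ z in 𝓝 z₀, 0 < (Q z).natDegree) :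
    ∀ᶠ z in 𝓝 z₀, (Q z).roots.Nodup →
      ∑ p ∈ (Q z).roots.toFinset with p ∈ Metric.ball c ρ, ((Q z).derivative.eval p)⁻¹ * k (z, p) =
      (2 * Real.pi * Complex.I : ℂ)⁻¹ * ∮ s in C(c, ρ), ((Q z).eval s)⁻¹ * k (z, s) := by
  filter_upwards [h.eventually_eval_ne (isCompact_sphere c ρ) hs, hdeg,
    eventually_analyticAt_ball hk] with z h1 h2 h3 hn
  exact (circleIntegral_inv_eval_mul h2 hn hρ (differentiableOn_slice h3) h1).symm

end WebPolynomial

end PlanarWeb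
end

/-! ### Algebra at a multiple root of F(x, 0, p). -/

noncomputable section

namespace PlanarWeb

section Tangency

open Polynomial

theorem eval_derivative_ne_zero_of_nodup {Q : ℂ[X]} (hQ : Q.roots.Nodup) {p : ℂ} (hp : p ∈ Q.roots) :
    Q.derivative.eval p ≠ 0 := fun h => by
  have hQ0 : Q ≠ 0 := fun h0 => by simp [h0] at hp
  have h1 := (one_lt_rootMultiplicity_iff_isRoot hQ0).2 ⟨(mem_roots hQ0).1 hp, h⟩
  rw [← count_roots] at h1
  exact absurd (Multiset.nodup_iff_count_le_one.1 hQ p) (not_le.2 h1)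

theorem eval_derivative_sub_pow_mul (φ p : ℂ) (P : ℂ[X]) (μ : ℕ) :
    ((X - C φ) ^ (μ + 2) * P).derivative.eval p =
      (p - φ) ^ (μ + 1) * ((μ + 2) * P.eval p + (p - φ) * P.derivative.eval p) := by
  simp [derivative_X_sub_C_pow]
  ring

theorem eval_derivative_derivative_sub_pow_mul (φ p : ℂ) (P : ℂ[X]) (μ : ℕ) :
    ((X - C φ) ^ (μ + 2) * P).derivative.derivative.eval p =
      (p - φ) ^ μ * ((μ + 2) * (μ + 1) * P.eval p + 2 * (μ + 2) * (p - φ) * P.derivative.eval p +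
        (p - φ) ^ 2 * P.derivative.derivative.eval p) := by
  simp [derivative_X_sub_C_pow]
  ring

/-- The factor p - φ avoids the exponent μ - 1, which would be negative for a double root. -/
theorem sub_mul_eval_derivative_derivative_derivative_sub_pow_mul (φ p : ℂ) (P : ℂ[X]) (μ : ℕ) :
    (p - φ) * ((X - C φ) ^ (μ + 2) * P).derivative.derivative.derivative.eval p =
      (p - φ) ^ μ * ((μ + 2) * (μ + 1) * μ * P.eval p +
        3 * (μ + 2) * (μ + 1) * (p - φ) * P.derivative.eval p +
        3 * (μ + 2) * (p - φ) ^ 2 * P.derivative.derivative.eval p +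
        (p - φ) ^ 3 * P.derivative.derivative.derivative.eval p) := by
  rcases μ with _ | μ
  · simp [derivative_X_sub_C_pow]
    ring
  · simp [derivative_X_sub_C_pow]
    ring

theorem fderiv_fst_analyticAt {G : Plane × ℂ → ℂ} {q : Plane × ℂ} (hG : AnalyticAt ℂ G q)
    (v : Plane) : AnalyticAt ℂ (fun q => fderiv ℂ (fun w => G (w, q.2)) q.1 v) q := by
  have h : AnalyticAt ℂ (fun q => fderiv ℂ G q (v, 0)) q := hG.fderiv.clm_apply_const _
  refine h.congr ?_
  filter_upwards [hG.eventually_analyticAt] with w hw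
  have h1 : HasFDerivAt (fun u => G (u, w.2))
      ((fderiv ℂ G w).comp (ContinuousLinearMap.inl ℂ Plane ℂ)) w.1 :=
    HasFDerivAt.comp (g := G) (f := fun u => (u, w.2)) w.1 hw.differentiableAt.hasFDerivAt
      (hasFDerivAt_prodMk_left w.1 w.2)
  rw [h1.fderiv]
  rfl

/-- Partial derivatives of `(p - φ(x))^(μ+2) P(x,p) + y f(x,y,p)`. -/
theorem fderiv_tangency {Q f : Plane → ℂ[X]} {P : ℂ → ℂ[X]} {φ : ℂ → ℂ} {z : Plane} {μ : ℕ} {p : ℂ}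
    (hfac : ∀ᶠ w in 𝓝 z, Q w = (X - C (φ w.1)) ^ (μ + 2) * P w.1 + C w.2 * f w)
    (hφ : DifferentiableAt ℂ φ z.1)
    (hP : AnalyticAt ℂ (fun q : Plane × ℂ => (P q.1.1).eval q.2) (z, p))
    (hf : AnalyticAt ℂ (fun q : Plane × ℂ => (f q.1).eval q.2) (z, p)) :
    fderiv ℂ (fun w => (Q w).eval p) z (1, 0) =
      -((μ + 2) * (p - φ z.1) ^ (μ + 1) * deriv φ z.1 * (P z.1).eval p) +
        (p - φ z.1) ^ (μ + 2) * fderiv ℂ (fun w : Plane => (P w.1).eval p) z (1, 0) +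
        z.2 * fderiv ℂ (fun w => (f w).eval p) z (1, 0) ∧
    fderiv ℂ (fun w => (Q w).eval p) z (0, 1) =
      (f z).eval p + z.2 * fderiv ℂ (fun w => (f w).eval p) z (0, 1) := by
  have hpair : AnalyticAt ℂ (fun w : Plane => (w, p)) z := analyticAt_id.prod analyticAt_const
  have hP' : AnalyticAt ℂ (fun w : Plane => (P w.1).eval p) z :=
    AnalyticAt.fun_comp (g := fun q : Plane × ℂ => (P q.1.1).eval q.2) (f := fun w => (w, p)) hP hpair
  have hf' : AnalyticAt ℂ (fun w : Plane => (f w).eval p) z :=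
    AnalyticAt.fun_comp (g := fun q : Plane × ℂ => (f q.1).eval q.2) (f := fun w => (w, p)) hf hpair
  have hg : DifferentiableAt ℂ (fun x => (P x).eval p) z.1 :=
    DifferentiableAt.fun_comp' (g := fun w : Plane => (P w.1).eval p) (f := fun x => (x, z.2)) z.1
      hP'.differentiableAt (differentiableAt_id.prodMk (differentiableAt_const _))
  have hPd : fderiv ℂ (fun w : Plane => (P w.1).eval p) z (0, 1) = 0 := by
    have := HasFDerivAt.comp (g := fun x => (P x).eval p) (f := Prod.fst) z hg.hasFDerivAt
      hasFDerivAt_fst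
    change HasFDerivAt (fun w : Plane => (P w.1).eval p) _ z at this
    rw [this.fderiv]
    simp
  have hs : HasFDerivAt (fun w : Plane => p - φ w.1) (-(deriv φ z.1 • dx)) z := by
    have := HasDerivAt.comp_hasFDerivAt (h₂ := φ) (f := Prod.fst) z hφ.hasDerivAt
      (hasFDerivAt_fst (𝕜 := ℂ) (p := z))
    exact this.const_sub p
  have key := ((hs.pow (μ + 2)).mul hP'.differentiableAt.hasFDerivAt).add
    ((hasFDerivAt_snd (𝕜 := ℂ) (p := z)).mul hf'.differentiableAt.hasFDerivAt)
  have e : (fun w => (Q w).eval p) =ᶠ[𝓝 z] fun w =>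
      (p - φ w.1) ^ (μ + 2) * (P w.1).eval p + w.2 * (f w).eval p := by
    filter_upwards [hfac] with w hw
    rw [hw]
    simp
  have key' := (HasFDerivAt.congr_of_eventuallyEq key e).fderiv
  rw [key']
  constructor
  · simp
    ring
  · simp [hPd]
    ring

/-- The algebra behind the contribution of a root near a tangency. -/
theorem tangency_term {s P f y p Fx Fy F₁ F₂ F₃ Rx R R₂ R₃ D : ℂ} {μ : ℕ} (hs : s ≠ 0) (hf : f ≠ 0)
    (hF : s ^ (μ + 2) * P + y * f = 0) (hR : R ≠ 0) (h1 : F₁ = s ^ (μ + 1) * R)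
    (h2 : F₂ = s ^ μ * R₂) (h3 : s * F₃ = s ^ μ * R₃) (hx : Fx = s ^ (μ + 1) * Rx) :
    y * ((Fx + p * Fy) * F₃ / (6 * F₁ ^ 2) - D * Fy * F₂ / (2 * F₁ ^ 2)) =
      F₁⁻¹ * (P * s ^ μ *
        (-((s ^ (μ + 1) * Rx + p * Fy) * R₃ / 6 - D * Fy * s * R₂ / 2) / (f * R))) := by
  -- The root equation makes `y` a multiple of s^(μ+2). This cancels the denominators, apart from
  -- the one factor F₁⁻¹ that the trace formula requires.
  have hy : y = -(s ^ (μ + 2) * P) / f := by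
    rw [eq_div_iff hf]
    linear_combination hF
  have h3' : F₃ = s ^ μ * R₃ / s := by
    rw [eq_div_iff hs, ← h3, mul_comm]
  rw [hy, h3', h1, h2, hx, pow_add, pow_add]
  have hσ : s ^ μ ≠ 0 := pow_ne_zero _ hs
  generalize s ^ μ = σ at *
  field_simp

/-- On y = 0 the trace reduces to the residue of a double pole, hence to the derivative of this
kernel at the multiple root. Only the values of `U`, `U₃` and `R₂` at `c` enter, not their
derivatives. -/
theorem hasDerivAt_tangency {P f U U₃ R₂ Rx : ℂ → ℂ} {c d P₁ f₁ : ℂ} {μ : ℕ}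
    (hP : HasDerivAt P P₁ c) (hf : HasDerivAt f f₁ c) (hU : DifferentiableAt ℂ U c)
    (hU₃ : DifferentiableAt ℂ U₃ c) (hR₂ : DifferentiableAt ℂ R₂ c) (hRx : DifferentiableAt ℂ Rx c)
    (hP0 : P c ≠ 0) (hf0 : f c ≠ 0) (hUc : U c = P₁ - P c * f₁ / f c)
    (hU₃c : U₃ c = 3 * (μ + 2) * (μ + 1) * P₁) (hR₂c : R₂ c = (μ + 2) * (μ + 1) * P c) :
    HasDerivAt (fun p => -(((p - c) ^ (μ + 1) * Rx p + p * f p) *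
        ((μ + 2) * (μ + 1) * μ * P p + (p - c) * U₃ p) / 6 - (d - 2) * f p * (p - c) * R₂ p / 2) /
        (f p * ((μ + 2) * P p + (p - c) * U p)))
      (1 / 6 * (μ + 1) * (1 / (μ + 2) * (μ * (d - c * (f₁ / f c)) -
        2 * (μ + 3) * (c * (P₁ / P c) - (d - (μ + 2)))) + μ)) c := by
  have hμ : (μ : ℂ) + 2 ≠ 0 := by exact_mod_cast (by omega : μ + 2 ≠ 0)
  have hid : HasDerivAt (fun p : ℂ => p) 1 c := hasDerivAt_id c
  have hs : HasDerivAt (fun p : ℂ => p - c) 1 c := hid.sub_const c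
  have hR₃ := (hP.const_mul ((μ + 2) * (μ + 1) * μ : ℂ)).fun_add (hs.fun_mul hU₃.hasDerivAt)
  have hR := (hP.const_mul ((μ + 2 : ℂ))).fun_add (hs.fun_mul hU.hasDerivAt)
  have hnum := (((((hs.fun_pow (μ + 1)).fun_mul hRx.hasDerivAt).fun_add (hid.fun_mul hf)).fun_mul
    hR₃).div_const 6).fun_sub ((((hf.const_mul (d - 2)).fun_mul hs).fun_mul
      hR₂.hasDerivAt).div_const 2)
  have hne : f c * ((μ + 2) * P c + (c - c) * U c) ≠ 0 := by
    rw [sub_self, zero_mul, add_zero]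
    exact mul_ne_zero hf0 (mul_ne_zero hμ hP0)
  refine (hnum.fun_neg.fun_div (hf.fun_mul hR) hne).congr_deriv ?_
  -- The derivative of s^(μ+1) at s = 0 is nonzero only for μ = 0, but it is multiplied by the value
  -- of R₃, which carries the factor μ. Hence `Rx`, and with it the derivative of φ, drops out of
  -- the residue.
  have hz : (μ : ℂ) * 0 ^ μ = 0 := by
    rcases μ with _ | μ <;> simp
  simp only [sub_self, zero_mul, mul_zero, add_zero, hUc, hU₃c, hR₂c, mul_one, one_mul,
    Nat.add_sub_cancel, ne_eq, Nat.add_eq_zero_iff, one_ne_zero, and_false, not_false_eq_true,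
    zero_pow, zero_add]
  field_simp
  push_cast
  generalize (0 : ℂ) ^ μ = w at *
  generalize deriv U c = u
  linear_combination -(f c * P c ^ 2 * Rx c * (8 + 24 * μ + 26 * μ ^ 2 + 12 * μ ^ 3 + 2 * μ ^ 4)) * hz

end Tangency

end PlanarWeb
end

/-! ### The contribution of a cluster of roots to the fundamental form. -/

noncomputable section

namespace PlanarWeb

open Polynomial

theorem eventually_closedBall_subset {c : ℂ} {S : Set ℂ} (hS : S ∈ 𝓝 c) :
    ∀ᶠ ρ : ℝ in 𝓝[>] 0, 0 < ρ ∧ Metric.closedBall c ρ ⊆ S := by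
  obtain ⟨ε, hε, hsub⟩ := Metric.nhds_basis_closedBall.mem_iff.1 hS
  filter_upwards [Ioc_mem_nhdsGT hε] with ρ hρ
  exact ⟨hρ.1, (Metric.closedBall_subset_closedBall hρ.2).trans hsub⟩

theorem eventually_eq_of_eval_eq_zero {Q : ℂ[X]} (hQ : Q ≠ 0) (c : ℂ) :
    ∀ᶠ p in 𝓝 c, Q.eval p = 0 → p = c := by
  have h : ((Q.roots.toFinset.erase c : Finset ℂ) : Set ℂ)ᶜ ∈ 𝓝 c :=
    (Finset.finite_toSet _).isClosed.isOpen_compl.mem_nhds (by simp)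
  filter_upwards [h] with p hp h0
  by_contra hne
  exact hp (by simp [hne, hQ, h0])

/-- The sum of `rootTerm` over the roots of `Q z` in a disc. -/
def rootSum (d : ℕ) (Q : Plane → ℂ[X]) (c : ℂ) (ρ : ℝ) (z : Plane) : Plane →L[ℂ] ℂ :=
  open Classical in ∑ p ∈ (Q z).roots.toFinset with p ∈ Metric.ball c ρ,
    rootTerm d (fderiv ℂ (fun w => (Q w).eval p) z (1, 0)) (fderiv ℂ (fun w => (Q w).eval p) z (0, 1))
      p ((Q z).derivative.eval p) ((Q z).derivative.derivative.eval p)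
      ((Q z).derivative.derivative.derivative.eval p)

/-- The sum of `rootTerm` over roots in a disc is the combination of two contour integrals. -/
theorem exists_analyticAt_rootSum {d : ℕ} {Q : Plane → ℂ[X]} {z₀ : Plane} {c : ℂ} {ρ : ℝ}
    {KA KB : Plane × ℂ → ℂ} {S : Set Plane} (hQ : AnalyticFamily Q z₀) (hρ : 0 < ρ)
    (hdeg : ∀ᶠ z in 𝓝 z₀, 0 < (Q z).natDegree)
    (hs : ∀ s ∈ Metric.sphere c ρ, (Q z₀).eval s ≠ 0)
    (hKA : ∀ s ∈ Metric.closedBall c ρ, AnalyticAt ℂ KA (z₀, s))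
    (hKB : ∀ s ∈ Metric.closedBall c ρ, AnalyticAt ℂ KB (z₀, s)) (u : Plane → ℂ)
    (hterm : ∀ᶠ z in 𝓝 z₀, z ∈ S → ∀ p ∈ Metric.ball c ρ, (Q z).eval p = 0 →
      (Q z).derivative.eval p ≠ 0 →
      u z • rootTerm d (fderiv ℂ (fun w => (Q w).eval p) z (1, 0))
        (fderiv ℂ (fun w => (Q w).eval p) z (0, 1)) p ((Q z).derivative.eval p)
        ((Q z).derivative.derivative.eval p) ((Q z).derivative.derivative.derivative.eval p) =
      ((Q z).derivative.eval p)⁻¹ • (KA (z, p) • dy + KB (z, p) • dx)) :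
    ∀ᶠ z in 𝓝 z₀, z ∈ S → (Q z).roots.Nodup → u z • rootSum d Q c ρ z =
      ((2 * Real.pi * Complex.I : ℂ)⁻¹ * ∮ s in C(c, ρ), ((Q z).eval s)⁻¹ * KA (z, s)) • dy +
      ((2 * Real.pi * Complex.I : ℂ)⁻¹ * ∮ s in C(c, ρ), ((Q z).eval s)⁻¹ * KB (z, s)) • dx := by
  classical
  filter_upwards [eventually_trace_eq hQ hρ hKA hs hdeg, eventually_trace_eq hQ hρ hKB hs hdeg,
    hterm] with z h1 h2 h3 hz hn
  rw [← h1 hn, ← h2 hn, rootSum, Finset.smul_sum]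
  rw [clm_sum_smul, clm_sum_smul, ← Finset.sum_add_distrib]
  refine Finset.sum_congr (by ext; simp) fun p hp => ?_
  obtain ⟨hp1, hp2⟩ := Finset.mem_filter.1 hp
  have hpr := Multiset.mem_toFinset.1 hp1
  rw [h3 hz p hp2 (isRoot_of_mem_roots hpr) (eval_derivative_ne_zero_of_nodup hn hpr)]
  module

theorem rootTerm_eq (d : ℕ) (Fx Fy p F₁ F₂ F₃ : ℂ) : rootTerm d Fx Fy p F₁ F₂ F₃ =
    ((Fx + p * Fy) * F₃ / (6 * F₁ ^ 2) - ((d : ℂ) - 2) * Fy * F₂ / (2 * F₁ ^ 2)) • dy +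
    (-p * ((Fx + p * Fy) * F₃ / (6 * F₁ ^ 2) - ((d : ℂ) - 2) * Fy * F₂ / (2 * F₁ ^ 2)) -
      ((d : ℂ) - 1) * ((d : ℂ) - 2) / 2 * Fy / F₁) • dx := by
  rw [rootTerm]
  module

/-- Near a simple root, the contribution to the fundamental form is holomorphic. -/
theorem exists_analyticAt_rootSum_simple (d : ℕ) {Q : Plane → ℂ[X]} {z₀ : Plane} {c : ℂ}
    (hQ : AnalyticFamily Q z₀) (hdeg : ∀ᶠ z in 𝓝 z₀, 0 < (Q z).natDegree)
    (hc' : (Q z₀).derivative.eval c ≠ 0) :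
    ∀ᶠ ρ : ℝ in 𝓝[>] 0, ∃ h : Plane → Plane →L[ℂ] ℂ, AnalyticAt ℂ h z₀ ∧
      ∀ᶠ z in 𝓝 z₀, (Q z).roots.Nodup → rootSum d Q c ρ z = h z := by
  have hne : ∀ᶠ p in 𝓝 c, (Q z₀).derivative.eval p ≠ 0 :=
    (Polynomial.continuous _).continuousAt.eventually_ne hc'
  have hiso := eventually_eq_of_eval_eq_zero (Q := Q z₀) (fun h => hc' (by simp [h])) c
  filter_upwards [eventually_closedBall_subset (hne.and hiso)] with ρ ⟨hρ, hsub⟩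
  set G₁ : Plane × ℂ → ℂ := fun q => (Q q.1).derivative.eval q.2 with hG₁
  set G₂ : Plane × ℂ → ℂ := fun q => (Q q.1).derivative.derivative.eval q.2 with hG₂
  set G₃ : Plane × ℂ → ℂ := fun q => (Q q.1).derivative.derivative.derivative.eval q.2 with hG₃
  set Gx : Plane × ℂ → ℂ := fun q => fderiv ℂ (fun w => (Q w).eval q.2) q.1 (1, 0) with hGx
  set Gy : Plane × ℂ → ℂ := fun q => fderiv ℂ (fun w => (Q w).eval q.2) q.1 (0, 1) with hGy
  have a1 : ∀ p, AnalyticAt ℂ G₁ (z₀, p) := fun p => hQ.derivative.eval p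
  have a2 : ∀ p, AnalyticAt ℂ G₂ (z₀, p) := fun p => hQ.derivative.derivative.eval p
  have a3 : ∀ p, AnalyticAt ℂ G₃ (z₀, p) := fun p => hQ.derivative.derivative.derivative.eval p
  have ax : ∀ p, AnalyticAt ℂ Gx (z₀, p) := fun p => fderiv_fst_analyticAt (hQ.eval p) (1, 0)
  have ay : ∀ p, AnalyticAt ℂ Gy (z₀, p) := fun p => fderiv_fst_analyticAt (hQ.eval p) (0, 1)
  have ap : ∀ p, AnalyticAt ℂ (fun q : Plane × ℂ => q.2) (z₀, p) := fun p => analyticAt_snd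
  -- The dy-coefficient of `rootTerm` with one factor 1/F' removed, as the trace formula wants it;
  -- `KB` is the same for dx. On the chosen disc F' does not vanish, so both are holomorphic.
  set KA : Plane × ℂ → ℂ := fun q => (Gx q + q.2 * Gy q) * G₃ q / (6 * G₁ q) -
    ((d : ℂ) - 2) * Gy q * G₂ q / (2 * G₁ q) with hKA
  set KB : Plane × ℂ → ℂ := fun q => -q.2 * KA q - ((d : ℂ) - 1) * ((d : ℂ) - 2) / 2 * Gy q with hKB
  have aA : ∀ s ∈ Metric.closedBall c ρ, AnalyticAt ℂ KA (z₀, s) := fun s hs => by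
    have h1 : G₁ (z₀, s) ≠ 0 := (hsub hs).1
    exact ((((ax s).fun_add ((ap s).fun_mul (ay s))).fun_mul (a3 s)).fun_div
      (analyticAt_const.fun_mul (a1 s)) (mul_ne_zero (by norm_num) h1)).fun_sub
      (((analyticAt_const.fun_mul (ay s)).fun_mul (a2 s)).fun_div
      (analyticAt_const.fun_mul (a1 s)) (mul_ne_zero (by norm_num) h1))
  have aB : ∀ s ∈ Metric.closedBall c ρ, AnalyticAt ℂ KB (z₀, s) := fun s hs =>
    ((ap s).fun_neg.fun_mul (aA s hs)).fun_sub (analyticAt_const.fun_mul (ay s))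
  have hsph : ∀ s ∈ Metric.sphere c ρ, (Q z₀).eval s ≠ 0 := fun s hs =>
    fun h =>
    Metric.ne_of_mem_sphere hs hρ.ne' ((hsub (Metric.sphere_subset_closedBall hs)).2 h)
  refine ⟨fun z =>
    ((2 * Real.pi * Complex.I : ℂ)⁻¹ * ∮ s in C(c, ρ), ((Q z).eval s)⁻¹ * KA (z, s)) • dy +
    ((2 * Real.pi * Complex.I : ℂ)⁻¹ * ∮ s in C(c, ρ), ((Q z).eval s)⁻¹ * KB (z, s)) • dx,
    ((analyticAt_trace hQ hρ aA hsph).fun_smul analyticAt_const).fun_add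
    ((analyticAt_trace hQ hρ aB hsph).fun_smul analyticAt_const), ?_⟩
  have hterm := exists_analyticAt_rootSum (d := d) (S := Set.univ) hQ hρ hdeg hsph aA aB
    (fun _ => 1) (Eventually.of_forall fun z _ p hp h0 h1 => by
      rw [rootTerm_eq]
      simp only [hKA, hKB, hGx, hGy, hG₁, hG₂, hG₃]
      generalize fderiv ℂ (fun w => (Q w).eval p) z (1, 0) = X1
      generalize fderiv ℂ (fun w => (Q w).eval p) z (0, 1) = X2
      generalize (Q z).derivative.eval p = F1 at *
      refine clm_ext ?_ ?_
      · simp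
        field_simp
      · simp
        field_simp)
  filter_upwards [hterm] with z hz hn
  rw [← hz (Set.mem_univ _) hn]
  exact (one_smul ℂ _).symm

/-- The coefficient `ψ` of the residue at a root of multiplicity `μ + 2`, in terms of the
factorization `F = (p - φ)^(μ+2) P + y f`. -/
def tangencyPsi (d μ : ℕ) (P f : ℂ[X]) (c : ℂ) : ℂ :=
  1 / (μ + 2) * (μ * (d - c * (f.derivative.eval c / f.eval c)) -
    2 * (μ + 3) * (c * (P.derivative.eval c / P.eval c) - (d - (μ + 2))))

/-- Near a multiple root, the contribution to the fundamental form has a simple pole with an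
explicit residue. -/
theorem exists_analyticAt_rootSum_tangency (d μ : ℕ) {Q f : Plane → ℂ[X]} {P : ℂ → ℂ[X]}
    {φ : ℂ → ℂ} {x₀ : ℂ} (hQ : AnalyticFamily Q (x₀, 0))
    (hP : AnalyticFamily (fun z : Plane => P z.1) (x₀, 0)) (hf : AnalyticFamily f (x₀, 0))
    (hφ : AnalyticAt ℂ φ x₀) (hdeg : ∀ᶠ z in 𝓝 ((x₀, 0) : Plane), 0 < (Q z).natDegree)
    (hfac : ∀ᶠ z in 𝓝 ((x₀, 0) : Plane), Q z = (X - C (φ z.1)) ^ (μ + 2) * P z.1 + C z.2 * f z)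
    (hP0 : (P x₀).eval (φ x₀) ≠ 0) (hf0 : (f (x₀, 0)).eval (φ x₀) ≠ 0) :
    ∀ᶠ ρ : ℝ in 𝓝[>] 0, ∃ h : Plane → Plane →L[ℂ] ℂ, AnalyticAt ℂ h (x₀, 0) ∧
      ∀ᶠ z in 𝓝 ((x₀, 0) : Plane), (Q z).roots.Nodup → rootSum d Q (φ x₀) ρ z -
        (1 / (6 * z.2)) • (((μ : ℂ) + 1) • (tangencyPsi d μ (P z.1) (f (z.1, 0)) (φ z.1) •
          (dy - φ z.1 • dx) + (μ : ℂ) • dy)) = h z := by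
  set z₀ : Plane := (x₀, 0) with hz₀
  set s : Plane × ℂ → ℂ := fun q => q.2 - φ q.1.1 with hs
  set E : Plane × ℂ → ℂ := fun q => (P q.1.1).eval q.2 with hE
  set E₁ : Plane × ℂ → ℂ := fun q => (P q.1.1).derivative.eval q.2 with hE₁
  set E₂ : Plane × ℂ → ℂ := fun q => (P q.1.1).derivative.derivative.eval q.2 with hE₂
  set E₃ : Plane × ℂ → ℂ := fun q => (P q.1.1).derivative.derivative.derivative.eval q.2 with hE₃
  set g : Plane × ℂ → ℂ := fun q => (f q.1).eval q.2 with hg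
  set g₁ : Plane × ℂ → ℂ := fun q => (f q.1).derivative.eval q.2 with hg₁
  set g₂ : Plane × ℂ → ℂ := fun q => (f q.1).derivative.derivative.eval q.2 with hg₂
  set g₃ : Plane × ℂ → ℂ := fun q => (f q.1).derivative.derivative.derivative.eval q.2 with hg₃
  set Px : Plane × ℂ → ℂ :=
    fun q => fderiv ℂ (fun w : Plane => (P w.1).eval q.2) q.1 (1, 0) with hPx
  set gx : Plane × ℂ → ℂ := fun q => fderiv ℂ (fun w => (f w).eval q.2) q.1 (1, 0) with hgx
  set Gy : Plane × ℂ → ℂ := fun q => fderiv ℂ (fun w => (Q w).eval q.2) q.1 (0, 1) with hGy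
  set φ' : Plane × ℂ → ℂ := fun q => deriv φ q.1.1 with hφ'
  have aφ : ∀ p, AnalyticAt ℂ (fun q : Plane × ℂ => φ q.1.1) (z₀, p) := fun p =>
    AnalyticAt.fun_comp (g := φ) (f := fun q : Plane × ℂ => q.1.1) hφ (by fun_prop)
  have aφ' : ∀ p, AnalyticAt ℂ φ' (z₀, p) := fun p =>
    AnalyticAt.fun_comp (g := deriv φ) (f := fun q : Plane × ℂ => q.1.1) hφ.deriv (by fun_prop)
  have as : ∀ p, AnalyticAt ℂ s (z₀, p) := fun p => analyticAt_snd.fun_sub (aφ p)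
  have aE : ∀ p, AnalyticAt ℂ E (z₀, p) := fun p => hP.eval p
  have aE₁ : ∀ p, AnalyticAt ℂ E₁ (z₀, p) := fun p => hP.derivative.eval p
  have aE₂ : ∀ p, AnalyticAt ℂ E₂ (z₀, p) := fun p => hP.derivative.derivative.eval p
  have aE₃ : ∀ p, AnalyticAt ℂ E₃ (z₀, p) := fun p => hP.derivative.derivative.derivative.eval p
  have ag : ∀ p, AnalyticAt ℂ g (z₀, p) := fun p => hf.eval p
  have ag₁ : ∀ p, AnalyticAt ℂ g₁ (z₀, p) := fun p => hf.derivative.eval p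
  have ag₂ : ∀ p, AnalyticAt ℂ g₂ (z₀, p) := fun p => hf.derivative.derivative.eval p
  have ag₃ : ∀ p, AnalyticAt ℂ g₃ (z₀, p) := fun p => hf.derivative.derivative.derivative.eval p
  have aPx : ∀ p, AnalyticAt ℂ Px (z₀, p) := fun p =>
    fderiv_fst_analyticAt (G := E) (aE p) (1, 0)
  have agx : ∀ p, AnalyticAt ℂ gx (z₀, p) := fun p => fderiv_fst_analyticAt (ag p) (1, 0)
  have aGy : ∀ p, AnalyticAt ℂ Gy (z₀, p) := fun p => fderiv_fst_analyticAt (hQ.eval p) (0, 1)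
  have ap : ∀ p, AnalyticAt ℂ (fun q : Plane × ℂ => q.2) (z₀, p) := fun p => analyticAt_snd
  -- The next functions arise by substituting y = -s^(μ+2) E / g into the derivatives of F. At a
  -- root with y ≠ 0 this gives F' = s^(μ+1) R, F'' = s^μ R₂, s F''' = s^μ R₃ and F_x = s^(μ+1) Rx,
  -- but the functions themselves are holomorphic on a full neighbourhood.
  set U : Plane × ℂ → ℂ := fun q => E₁ q - E q * g₁ q / g q with hU
  set R : Plane × ℂ → ℂ := fun q => (μ + 2) * E q + s q * U q with hR
  set R₂ : Plane × ℂ → ℂ := fun q => (μ + 2) * (μ + 1) * E q + s q * (2 * (μ + 2) * E₁ q +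
    s q * E₂ q - s q * E q * g₂ q / g q) with hR₂
  set U₃ : Plane × ℂ → ℂ := fun q => 3 * (μ + 2) * (μ + 1) * E₁ q + s q * (3 * (μ + 2) * E₂ q +
    s q * E₃ q - s q * E q * g₃ q / g q) with hU₃
  set R₃ : Plane × ℂ → ℂ := fun q => (μ + 2) * (μ + 1) * μ * E q + s q * U₃ q with hR₃
  set Rx : Plane × ℂ → ℂ := fun q => -((μ + 2) * φ' q * E q) + s q * Px q -
    s q * E q * gx q / g q with hRx
  -- `KA` = E s^μ N is y F' times the dy-coefficient of `rootTerm`, evaluated at a root by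
  -- `tangency_term`.
  set N : Plane × ℂ → ℂ := fun q => -((s q ^ (μ + 1) * Rx q + q.2 * Gy q) * R₃ q / 6 -
    ((d : ℂ) - 2) * Gy q * s q * R₂ q / 2) / (g q * R q) with hN
  set KA : Plane × ℂ → ℂ := fun q => E q * s q ^ μ * N q with hKA
  set KB : Plane × ℂ → ℂ := fun q => -q.2 * KA q -
    q.1.2 * (((d : ℂ) - 1) * ((d : ℂ) - 2) / 2 * Gy q) with hKB
  have hsz : s (z₀, φ x₀) = 0 := sub_self _
  have aU : ∀ p, g (z₀, p) ≠ 0 → AnalyticAt ℂ U (z₀, p) := fun p hp =>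
    (aE₁ p).fun_sub (((aE p).fun_mul (ag₁ p)).fun_div (ag p) hp)
  have aR : ∀ p, g (z₀, p) ≠ 0 → AnalyticAt ℂ R (z₀, p) := fun p hp =>
    (analyticAt_const.fun_mul (aE p)).fun_add ((as p).fun_mul (aU p hp))
  have aR₂ : ∀ p, g (z₀, p) ≠ 0 → AnalyticAt ℂ R₂ (z₀, p) := fun p hp =>
    (analyticAt_const.fun_mul (aE p)).fun_add ((as p).fun_mul
      (((analyticAt_const.fun_mul (aE₁ p)).fun_add ((as p).fun_mul (aE₂ p))).fun_sub
        ((((as p).fun_mul (aE p)).fun_mul (ag₂ p)).fun_div (ag p) hp)))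
  have aU₃ : ∀ p, g (z₀, p) ≠ 0 → AnalyticAt ℂ U₃ (z₀, p) := fun p hp =>
    (analyticAt_const.fun_mul (aE₁ p)).fun_add ((as p).fun_mul
      (((analyticAt_const.fun_mul (aE₂ p)).fun_add ((as p).fun_mul (aE₃ p))).fun_sub
        ((((as p).fun_mul (aE p)).fun_mul (ag₃ p)).fun_div (ag p) hp)))
  have aR₃ : ∀ p, g (z₀, p) ≠ 0 → AnalyticAt ℂ R₃ (z₀, p) := fun p hp =>
    (analyticAt_const.fun_mul (aE p)).fun_add ((as p).fun_mul (aU₃ p hp))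
  have aRx : ∀ p, g (z₀, p) ≠ 0 → AnalyticAt ℂ Rx (z₀, p) := fun p hp =>
    ((((analyticAt_const.fun_mul (aφ' p)).fun_mul (aE p)).fun_neg).fun_add
      ((as p).fun_mul (aPx p))).fun_sub
      ((((as p).fun_mul (aE p)).fun_mul (agx p)).fun_div (ag p) hp)
  have aN : ∀ p, g (z₀, p) ≠ 0 → R (z₀, p) ≠ 0 → AnalyticAt ℂ N (z₀, p) := fun p hp hp' =>
    ((((((((as p).fun_pow (μ + 1)).fun_mul (aRx p hp)).fun_add ((ap p).fun_mul (aGy p))).fun_mul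
      (aR₃ p hp)).fun_div analyticAt_const (by norm_num)).fun_sub
      ((((analyticAt_const.fun_mul (aGy p)).fun_mul (as p)).fun_mul (aR₂ p hp)).fun_div
        analyticAt_const (by norm_num)))).fun_neg.fun_div ((ag p).fun_mul (aR p hp))
        (mul_ne_zero hp hp')
  have hμ2 : (μ : ℂ) + 2 ≠ 0 := by exact_mod_cast (by omega : μ + 2 ≠ 0)
  have hslice : ∀ {k : Plane × ℂ → ℂ}, AnalyticAt ℂ k (z₀, φ x₀) → k (z₀, φ x₀) ≠ 0 →
      ∀ᶠ p in 𝓝 (φ x₀), k (z₀, p) ≠ 0 := fun {k} hk h0 =>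
    (ContinuousAt.comp (g := k) (f := fun p => (z₀, p)) hk.continuousAt
      (by fun_prop)).eventually_ne h0
  have hgz : g (z₀, φ x₀) ≠ 0 := hf0
  have hRz : R (z₀, φ x₀) ≠ 0 := by
    simp only [hR, hsz, zero_mul, add_zero]
    exact mul_ne_zero hμ2 hP0
  -- On a small disc around the multiple root the denominators `g` and `R` do not vanish, and
  -- nonvanishing of `E` leaves the centre as the only zero of `Q z₀`.
  filter_upwards [eventually_closedBall_subset ((hslice (ag _) hgz).and
    ((hslice (aR _ hgz) hRz).and (hslice (aE _) hP0)))] with ρ ⟨hρ, hsub⟩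
  have hg0 : ∀ p ∈ Metric.closedBall (φ x₀) ρ, g (z₀, p) ≠ 0 := fun p hp => (hsub hp).1
  have hR0 : ∀ p ∈ Metric.closedBall (φ x₀) ρ, R (z₀, p) ≠ 0 := fun p hp => (hsub hp).2.1
  have hE0 : ∀ p ∈ Metric.closedBall (φ x₀) ρ, E (z₀, p) ≠ 0 := fun p hp => (hsub hp).2.2
  have aA : ∀ p ∈ Metric.closedBall (φ x₀) ρ, AnalyticAt ℂ KA (z₀, p) := fun p hp =>
    ((aE p).fun_mul ((as p).fun_pow μ)).fun_mul (aN p (hg0 p hp) (hR0 p hp))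
  have aB : ∀ p ∈ Metric.closedBall (φ x₀) ρ, AnalyticAt ℂ KB (z₀, p) := fun p hp =>
    ((ap p).fun_neg.fun_mul (aA p hp)).fun_sub
      (AnalyticAt.fun_mul (by fun_prop) (analyticAt_const.fun_mul (aGy p)))
  have hsph : ∀ p ∈ Metric.sphere (φ x₀) ρ, (Q z₀).eval p ≠ 0 := fun p hp => by
    rw [hfac.self_of_nhds]
    have h1 : p - φ x₀ ≠ 0 := sub_ne_zero.2 (Metric.ne_of_mem_sphere hp hρ.ne')
    have h2 : (P x₀).eval p ≠ 0 := hE0 p (Metric.sphere_subset_closedBall hp)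
    simpa [hz₀, h1] using h2
  set JA : Plane → ℂ := fun z =>
    (2 * Real.pi * Complex.I : ℂ)⁻¹ * ∮ s in C(φ x₀, ρ), ((Q z).eval s)⁻¹ * KA (z, s) with hJA
  set JB : Plane → ℂ := fun z =>
    (2 * Real.pi * Complex.I : ℂ)⁻¹ * ∮ s in C(φ x₀, ρ), ((Q z).eval s)⁻¹ * KB (z, s) with hJB
  -- The traces represent y times the contribution. Subtracting their values on y = 0 and dividing
  -- by `y` gives the holomorphic remainder.
  obtain ⟨hA, hAan, hAeq⟩ := exists_analyticAt_sub_eq_mul (analyticAt_trace hQ hρ aA hsph)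
  obtain ⟨hB, hBan, hBeq⟩ := exists_analyticAt_sub_eq_mul (analyticAt_trace hQ hρ aB hsph)
  have hgood : ∀ᶠ z in 𝓝 z₀, ∀ p ∈ Metric.closedBall (φ x₀) ρ, g (z, p) ≠ 0 ∧ R (z, p) ≠ 0 ∧
      E (z, p) ≠ 0 ∧ AnalyticAt ℂ E (z, p) ∧ AnalyticAt ℂ g (z, p) ∧ AnalyticAt ℂ N (z, p) ∧
      AnalyticAt ℂ U (z, p) ∧ AnalyticAt ℂ U₃ (z, p) ∧ AnalyticAt ℂ R₂ (z, p) ∧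
      AnalyticAt ℂ Rx (z, p) :=
    (isCompact_closedBall _ ρ).eventually_forall_of_forall_eventually fun p hp =>
      ((ag p).continuousAt.eventually_ne (hg0 p hp)).and
        (((aR p (hg0 p hp)).continuousAt.eventually_ne (hR0 p hp)).and
        (((aE p).continuousAt.eventually_ne (hE0 p hp)).and
        ((aE p).eventually_analyticAt.and ((ag p).eventually_analyticAt.and
        ((aN p (hg0 p hp) (hR0 p hp)).eventually_analyticAt.and
        ((aU p (hg0 p hp)).eventually_analyticAt.and ((aU₃ p (hg0 p hp)).eventually_analyticAt.and
        ((aR₂ p (hg0 p hp)).eventually_analyticAt.and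
        (aRx p (hg0 p hp)).eventually_analyticAt))))))))
  have hφd : ∀ᶠ z in 𝓝 z₀, DifferentiableAt ℂ φ z.1 :=
    (continuousAt_fst (p := z₀)).eventually
      (hφ.eventually_analyticAt.mono fun _ h => h.differentiableAt)
  have hterm := exists_analyticAt_rootSum (d := d) (S := {z | z.2 ≠ 0}) hQ hρ hdeg hsph aA aB
    (fun z => z.2) (by
      filter_upwards [hgood, hfac.eventually_nhds, hφd] with z z1 z2 z3 hy p hp h0 h1
      obtain ⟨g0, R0, E0, aE', ag', -⟩ := z1 p (Metric.ball_subset_closedBall hp)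
      obtain ⟨ex, -⟩ := fderiv_tangency z2 z3 aE' ag'
      have hQz := z2.self_of_nhds
      have hsv : s (z, p) = p - φ z.1 := rfl
      have hF : s (z, p) ^ (μ + 2) * E (z, p) + z.2 * g (z, p) = 0 := by
        rw [hQz] at h0
        simpa using h0
      have hs0 : s (z, p) ≠ 0 := fun h => by
        rw [h, zero_pow (by omega), zero_mul, zero_add] at hF
        exact mul_ne_zero hy g0 hF
      have hyv : z.2 = -(s (z, p) ^ (μ + 2) * E (z, p)) / g (z, p) := by
        rw [eq_div_iff g0]
        linear_combination hF
      have d1 : (Q z).derivative.eval p = s (z, p) ^ (μ + 1) * R (z, p) := by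
        have : (Q z).derivative.eval p =
            s (z, p) ^ (μ + 1) * ((μ + 2) * E (z, p) + s (z, p) * E₁ (z, p)) + z.2 * g₁ (z, p) := by
          rw [hQz, derivative_add, eval_add, eval_derivative_sub_pow_mul]
          simp [hsv, hE, hE₁, hg₁]
        rw [this, hyv]
        simp only [hR, hU]
        field_simp
        ring
      have d2 : (Q z).derivative.derivative.eval p = s (z, p) ^ μ * R₂ (z, p) := by
        have : (Q z).derivative.derivative.eval p =
            s (z, p) ^ μ * ((μ + 2) * (μ + 1) * E (z, p) + 2 * (μ + 2) * s (z, p) * E₁ (z, p) +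
              s (z, p) ^ 2 * E₂ (z, p)) + z.2 * g₂ (z, p) := by
          rw [hQz, derivative_add, derivative_add, eval_add, eval_derivative_derivative_sub_pow_mul]
          simp [hsv, hE, hE₁, hE₂, hg₂]
        rw [this, hyv]
        simp only [hR₂]
        field_simp
        ring
      have d3 : s (z, p) * (Q z).derivative.derivative.derivative.eval p =
          s (z, p) ^ μ * R₃ (z, p) := by
        have : s (z, p) * (Q z).derivative.derivative.derivative.eval p =
            s (z, p) ^ μ * ((μ + 2) * (μ + 1) * μ * E (z, p) +
              3 * (μ + 2) * (μ + 1) * s (z, p) * E₁ (z, p) +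
              3 * (μ + 2) * s (z, p) ^ 2 * E₂ (z, p) + s (z, p) ^ 3 * E₃ (z, p)) +
              s (z, p) * (z.2 * g₃ (z, p)) := by
          rw [hQz, derivative_add, derivative_add, derivative_add, eval_add, mul_add, hsv,
            sub_mul_eval_derivative_derivative_derivative_sub_pow_mul]
          simp [hE, hE₁, hE₂, hE₃, hg₃]
        rw [this, hyv]
        simp only [hR₃, hU₃]
        field_simp
        ring
      have dx' : fderiv ℂ (fun w => (Q w).eval p) z (1, 0) = s (z, p) ^ (μ + 1) * Rx (z, p) := by
        have : fderiv ℂ (fun w => (Q w).eval p) z (1, 0) =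
            -((μ + 2) * s (z, p) ^ (μ + 1) * φ' (z, p) * E (z, p)) +
              s (z, p) ^ (μ + 2) * Px (z, p) + z.2 * gx (z, p) := ex
        rw [this, hyv]
        simp only [hRx]
        field_simp
        ring
      have tt := tangency_term (p := p) (Fy := Gy (z, p)) (D := (d : ℂ) - 2) hs0 g0 hF R0 d1 d2 d3
        dx'
      rw [rootTerm_eq]
      change z.2 * ((fderiv ℂ (fun w => (Q w).eval p) z (1, 0) +
        p * fderiv ℂ (fun w => (Q w).eval p) z (0, 1)) * _ / _ - _) = _ * KA (z, p) at tt
      have hKBv : KB (z, p) = -p * KA (z, p) - z.2 * (((d : ℂ) - 1) * ((d : ℂ) - 2) / 2 *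
        fderiv ℂ (fun w => (Q w).eval p) z (0, 1)) := rfl
      rw [hKBv]
      have hGyv : Gy (z, p) = fderiv ℂ (fun w => (Q w).eval p) z (0, 1) := rfl
      rw [hGyv] at tt
      refine clm_ext ?_ ?_
      · simp
        linear_combination (-p) * tt
      · simpa using tt)
  -- The values of the traces on y = 0, that is, the residue of the simple pole.
  have hval : ∀ᶠ x in 𝓝 x₀, JA (x, 0) = 1 / 6 * (μ + 1) *
      (tangencyPsi d μ (P x) (f (x, 0)) (φ x) + μ) ∧
      JB (x, 0) = - (φ x * (1 / 6 * (μ + 1) * tangencyPsi d μ (P x) (f (x, 0)) (φ x))) := by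
    have hc0 : ContinuousAt (fun x : ℂ => ((x, 0) : Plane)) x₀ := by fun_prop
    filter_upwards [hc0.eventually hgood, hc0.eventually hfac.eventually_nhds,
      hc0.eventually hφd, hφ.continuousAt.eventually (Metric.ball_mem_nhds _ hρ)]
      with x x1 x2 x3 x4
    replace x3 : DifferentiableAt ℂ φ x := x3
    have hQx : Q (x, 0) = (X - C (φ x)) ^ (μ + 2) * P x := by simpa using x2.self_of_nhds
    have hGyg : ∀ p ∈ Metric.closedBall (φ x₀) ρ, Gy ((x, 0), p) = g ((x, 0), p) := fun p hp => by
      obtain ⟨-, -, -, aE', ag', -⟩ := x1 p hp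
      have := (fderiv_tangency x2 x3 aE' ag').2
      simpa using this
    obtain ⟨g0, R0, E0, aE', ag', aN', aU', aU₃', aR₂', aRx'⟩ :=
      x1 (φ x) (Metric.ball_subset_closedBall x4)
    have hsl : ∀ {k : Plane × ℂ → ℂ} {p : ℂ}, AnalyticAt ℂ k ((x, 0), p) →
        DifferentiableAt ℂ (fun p => k ((x, 0), p)) p := fun {k p} hk =>
      DifferentiableAt.fun_comp' (g := k) (f := fun p => ((x, 0), p)) p hk.differentiableAt
        ((differentiableAt_const _).prodMk differentiableAt_id)
    have hder : HasDerivAt (fun p => N ((x, 0), p)) (1 / 6 * (μ + 1) *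
        (tangencyPsi d μ (P x) (f (x, 0)) (φ x) + μ)) (φ x) := by
      refine (hasDerivAt_tangency (P := fun p => E ((x, 0), p)) (f := fun p => g ((x, 0), p))
        (U := fun p => U ((x, 0), p)) (U₃ := fun p => U₃ ((x, 0), p))
        (R₂ := fun p => R₂ ((x, 0), p)) (Rx := fun p => Rx ((x, 0), p)) (d := d) (μ := μ)
        ((P x).hasDerivAt _) ((f (x, 0)).hasDerivAt _) (hsl aU') (hsl aU₃') (hsl aR₂') (hsl aRx')
        E0 g0 rfl ?_ ?_).congr_of_eventuallyEq ?_
      · simp [hU₃, hs, hE₁]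
      · simp [hR₂, hs]
      · filter_upwards [Metric.isOpen_ball.mem_nhds x4] with p hp
        simp only [hN, hGyg p (Metric.ball_subset_closedBall hp)]
        rfl
    -- The value of `N` itself enters the dx-component, since the derivative of -p N is -N - p N'.
    -- It cancels the extra μ contained in N', which is why the term (ν - 2) dy of the residue has
    -- no dx counterpart.
    have hNv : N ((x, 0), φ x) = -(φ x * (μ + 1) * μ / 6) := by
      simp only [hN, hGyg _ (Metric.ball_subset_closedBall x4), hR₃, hR, hs, sub_self, zero_mul,
        mul_zero, add_zero, zero_div, sub_zero, zero_add, zero_pow (Nat.succ_ne_zero μ)]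
      field_simp
    have hopen : IsOpen {p | AnalyticAt ℂ N ((x, 0), p)} :=
      (isOpen_analyticAt ℂ N).preimage (by fun_prop)
    have hcl : Metric.closedBall (φ x₀) ρ ⊆ {p | AnalyticAt ℂ N ((x, 0), p)} :=
      fun p hp => (x1 p hp).2.2.2.2.2.1
    -- On y = 0 the polynomial is s^(μ+2) E, so the integrand is k/s² and Cauchy's formula for the
    -- derivative applies.
    have hint : ∀ k : ℂ → ℂ, DifferentiableOn ℂ k {p | AnalyticAt ℂ N ((x, 0), p)} →
        (2 * Real.pi * Complex.I : ℂ)⁻¹ * (∮ t in C(φ x₀, ρ), ((Q (x, 0)).eval t)⁻¹ *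
          (E ((x, 0), t) * s ((x, 0), t) ^ μ * k t)) = deriv k (φ x) := fun k hk => by
      rw [← Complex.two_pi_I_inv_smul_circleIntegral_sub_sq_inv_smul_of_differentiable hopen hcl hk
        x4, smul_eq_mul]
      congr 1
      refine circleIntegral.integral_congr hρ.le fun t ht => ?_
      have ht' := Metric.sphere_subset_closedBall ht
      have h1 : t - φ x ≠ 0 := sub_ne_zero.2 fun h => by
        rw [h] at ht
        exact (Metric.mem_ball.1 x4).ne ht
      have h2 : (P x).eval t ≠ 0 := (x1 t ht').2.2.1
      have h3 : (Q (x, 0)).eval t = (t - φ x) ^ (μ + 2) * (P x).eval t := by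
        rw [hQx]
        simp
      simp only [h3, hE, hs, smul_eq_mul]
      field_simp
      ring
    constructor
    · exact (hint (fun p => N ((x, 0), p)) fun p hp =>
        (hsl hp).differentiableWithinAt).trans hder.deriv
    · have hder' : HasDerivAt (fun p => -p * N ((x, 0), p)) _ (φ x) :=
        (hasDerivAt_id' (φ x)).fun_neg.fun_mul hder
      refine Eq.trans ?_ ((hint (fun p => -p * N ((x, 0), p)) fun p hp =>
        (differentiableAt_id.fun_neg.fun_mul (hsl hp)).differentiableWithinAt).trans
        (hder'.deriv.trans ?_))
      · simp only [hJB, hKB, hKA]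
        congr 2
        funext t
        ring
      · rw [hNv]
        ring
  refine ⟨fun z => hA z • dy + hB z • dx, (hAan.fun_smul analyticAt_const).fun_add
    (hBan.fun_smul analyticAt_const), ?_⟩
  filter_upwards [hterm, (continuousAt_fst (p := z₀)).eventually hval, hAeq, hBeq, hfac, hdeg]
    with z h1 h2 h3 h4 h5 h6 hn
  -- On y = 0 the root φ is multiple, so simple roots force y ≠ 0.
  have hy : z.2 ≠ 0 := fun hy => by
    rw [hy, C_0, zero_mul, add_zero] at h5
    have hroot : φ z.1 ∈ (Q z).roots := by
      rw [mem_roots (fun h => by simp [h] at h6), IsRoot.def, h5]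
      simp
    refine eval_derivative_ne_zero_of_nodup hn hroot ?_
    rw [h5, eval_derivative_sub_pow_mul]
    simp
  have h1' := h1 hy hn
  have e1 : rootSum d Q (φ x₀) ρ z = (z.2)⁻¹ • (JA z • dy + JB z • dx) := by
    rw [← h1', inv_smul_smul₀ hy]
  rw [e1]
  have h3' : JA z = JA (z.1, 0) + z.2 * hA z := sub_eq_iff_eq_add'.1 h3
  have h4' : JB z = JB (z.1, 0) + z.2 * hB z := sub_eq_iff_eq_add'.1 h4
  rw [h3', h4', h2.1, h2.2]
  generalize tangencyPsi d μ (P z.1) (f (z.1, 0)) (φ z.1) = Ψ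
  refine clm_ext ?_ ?_
  · simp
    field_simp
    ring
  · simp
    field_simp
    ring

end PlanarWeb
end

/-! ### Adding the clusters: the local form of the theorem. -/

noncomputable section

namespace PlanarWeb

open Polynomial

theorem clm_smul_zero (c : ℂ) : c • (0 : Plane →L[ℂ] ℂ) = 0 :=
  clm_ext (mul_zero c) (mul_zero c)

theorem sum_countP_eq {ι A : Type*} [Fintype ι] {p : ι → A → Prop} [∀ i, DecidablePred (p i)]
    [DecidablePred fun a => ∃ i, p i a] (hp : ∀ i j a, p i a → p j a → i = j) (s : Multiset A) :
    ∑ i, Multiset.countP (p i) s = Multiset.countP (fun a => ∃ i, p i a) s := by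
  classical
  induction s using Multiset.induction_on with
  | empty => simp
  | cons a s ih =>
    simp only [Multiset.countP_cons, Finset.sum_add_distrib, ih]
    congr 1
    by_cases h : ∃ i, p i a
    · obtain ⟨i, hi⟩ := h
      rw [if_pos ⟨i, hi⟩, Finset.sum_eq_single i (fun j _ hj => if_neg fun hj' => hj (hp j i a hj' hi))
        (fun h => absurd (Finset.mem_univ i) h), if_pos hi]
    · rw [if_neg h]
      exact Finset.sum_eq_zero fun i _ => if_neg fun hi => h ⟨i, hi⟩

open Classical in
/-- If small disjoint discs contain all roots of `Q z₀`, they contain all roots of nearby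
polynomials of the family. -/
theorem eventually_forall_mem_roots {n d : ℕ} {Q : Plane → ℂ[X]} {z₀ : Plane} {c : Fin n → ℂ} {ρ : ℝ}
    (hQ : AnalyticFamily Q z₀) (hρ : 0 < ρ) (hdeg : ∀ᶠ z in 𝓝 z₀, (Q z).natDegree = d)
    (hdisj : ∀ α β p, p ∈ Metric.ball (c α) ρ → p ∈ Metric.ball (c β) ρ → α = β)
    (hs : ∀ α, ∀ s ∈ Metric.sphere (c α) ρ, (Q z₀).eval s ≠ 0)
    (hroots : ∀ p ∈ (Q z₀).roots, ∃ α, p = c α) :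
    ∀ᶠ z in 𝓝 z₀, ∀ p ∈ (Q z).roots, ∃ α, p ∈ Metric.ball (c α) ρ := by
  have hcard : ∀ᶠ z in 𝓝 z₀, ∀ α, ((Q z).roots.filter (· ∈ Metric.ball (c α) ρ)).card =
      ((Q z₀).roots.filter (· ∈ Metric.ball (c α) ρ)).card :=
    Filter.eventually_all.2 fun α => eventually_card_roots_eq hQ hρ (hs α)
  have hd : ∀ z, (Q z).natDegree = d → (Q z).roots.card = d := fun z hz => by
    rw [← (IsAlgClosed.splits (Q z)).natDegree_eq_card_roots, hz]
  filter_upwards [hcard, hdeg] with z h1 h2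
  simp only [← Multiset.countP_eq_card_filter] at h1
  -- The numbers of roots in the disjoint discs are locally constant and add up to the degree at z₀;
  -- the degree is also locally constant, so no root can lie outside the discs.
  have h3 := sum_countP_eq (p := fun α p => p ∈ Metric.ball (c α) ρ) hdisj (Q z).roots
  have h4 := sum_countP_eq (p := fun α p => p ∈ Metric.ball (c α) ρ) hdisj (Q z₀).roots
  rw [Finset.sum_congr rfl fun α _ => h1 α, h4, Multiset.countP_eq_card.2 fun p hp => by
    obtain ⟨α, rfl⟩ := hroots p hp
    exact ⟨α, Metric.mem_ball_self hρ⟩, hd _ hdeg.self_of_nhds, ← hd z h2] at h3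
  exact fun p hp => Multiset.countP_eq_card.1 h3.symm p hp

theorem derivative_prod_sub_pow {ι : Type*} (U : Finset ι) (A : ℂ) (φ : ι → ℂ) (ν : ι → ℕ)
    {c : ℂ} (hc : ∀ β ∈ U, c ≠ φ β) :
    (C A * ∏ β ∈ U, (X - C (φ β)) ^ ν β).derivative.eval c =
      (C A * ∏ β ∈ U, (X - C (φ β)) ^ ν β).eval c * ∑ β ∈ U, (ν β : ℂ) / (c - φ β) := by
  classical
  induction U using Finset.induction_on with
  | empty => simp
  | insert β U hβ ih =>
    have ih' := ih fun γ hγ => hc γ (Finset.mem_insert_of_mem hγ)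
    have h0 : c - φ β ≠ 0 := sub_ne_zero.2 (hc β (Finset.mem_insert_self _ _))
    rw [Finset.prod_insert hβ, mul_left_comm]
    generalize C A * ∏ β ∈ U, (X - C (φ β)) ^ ν β = G at *
    rw [derivative_mul, eval_add, eval_mul, eval_mul, ih',
      Finset.sum_insert hβ, derivative_X_sub_C_pow]
    rcases hν : ν β with _ | m
    · simp
    · simp only [eval_mul, eval_pow, eval_sub, eval_X, eval_C, Nat.add_sub_cancel]
      push_cast
      field_simp
      ring

/-- Writing φ_β = c - (c - φ_β) converts the sum appearing in ψ_α into the logarithmic derivative of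
the cofactor `P`, the form in which the residue computation produces it. -/
theorem sum_slopes_eq {ι : Type*} (U : Finset ι) (φ : ι → ℂ) (ν : ι → ℕ) {c : ℂ}
    (hc : ∀ β ∈ U, c ≠ φ β) :
    ∑ β ∈ U, (ν β : ℂ) * φ β / (c - φ β) =
      c * ∑ β ∈ U, (ν β : ℂ) / (c - φ β) - ∑ β ∈ U, (ν β : ℂ) := by
  rw [Finset.mul_sum, ← Finset.sum_sub_distrib]
  refine Finset.sum_congr rfl fun β hβ => ?_
  have h0 : c - φ β ≠ 0 := sub_ne_zero.2 (hc β hβ)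
  field_simp
  ring

variable {d : ℕ} {a a₁ : ℕ → Plane → ℂ}

theorem webPolynomial_eq_add {z : Plane}
    (h : ∀ k ∈ Finset.range (d + 1), a k z = a k (z.1, 0) + z.2 * a₁ k z) :
    webPolynomial d a z = webPolynomial d a (z.1, 0) + C z.2 * webPolynomial d a₁ z := by
  simp only [webPolynomial, Finset.mul_sum, ← Finset.sum_add_distrib]
  refine Finset.sum_congr rfl fun k hk => ?_
  rw [h k hk, C_add, C_mul]
  ring

/-- The polynomial quotient of `F(x,y,p) - F(x,0,p)` by `y` is `∂F/∂y` at `y = 0`. -/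
theorem deriv_webPoly {x : ℂ} (ha₁ : ∀ k ∈ Finset.range (d + 1),
    DifferentiableAt ℂ (a₁ k) (x, 0))
    (h : ∀ᶠ z in 𝓝 ((x, 0) : Plane), ∀ k ∈ Finset.range (d + 1),
      a k z = a k (z.1, 0) + z.2 * a₁ k z) (p : ℂ) :
    deriv (fun y => webPoly d a x y p) 0 = (webPolynomial d a₁ (x, 0)).eval p := by
  have hc : ContinuousAt (fun y : ℂ => ((x, y) : Plane)) 0 := by fun_prop
  have hg : DifferentiableAt ℂ (fun y => (webPolynomial d a₁ (x, y)).eval p) 0 := by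
    refine DifferentiableAt.fun_comp' (g := fun z => (webPolynomial d a₁ z).eval p)
      (f := fun y => (x, y)) (0 : ℂ) ?_ (by fun_prop)
    simp only [webPolynomial_eval_eq_sum]
    exact DifferentiableAt.fun_sum fun k hk => (ha₁ k hk).mul_const _
  have h1 := ((hasDerivAt_id' (0 : ℂ)).fun_mul hg.hasDerivAt).const_add
    ((webPolynomial d a (x, 0)).eval p)
  rw [zero_mul, one_mul, add_zero] at h1
  rw [← h1.deriv]
  refine Filter.EventuallyEq.deriv_eq ?_
  filter_upwards [hc.eventually h] with y hy
  rw [← webPolynomial_eval (z := (x, y)), webPolynomial_eq_add hy]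
  simp

/-- The local form of the theorem: at a point `(x₀, 0)` where the roots of `F(x, 0, p)` have
constant multiplicities and the characteristic surface is smooth, the polar part of the fundamental
form is given by the residue. -/
theorem exists_analyticAt_sub_residue (hd : 0 < d) {x₀ : ℂ} {n : ℕ} {φ : Fin n → ℂ → ℂ}
    {ν : Fin n → ℕ} (ha : ∀ᶠ z in 𝓝 ((x₀, 0) : Plane), ∀ k, AnalyticAt ℂ (a k) z)
    (h0 : a 0 (x₀, 0) ≠ 0) (hφ : ∀ α, AnalyticAt ℂ (φ α) x₀) (hν : ∀ α, 1 ≤ ν α)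
    (hne : ∀ α β, α ≠ β → φ α x₀ ≠ φ β x₀)
    (hfac : ∀ᶠ x in 𝓝 x₀, webPolynomial d a (x, 0) =
      C (a 0 (x, 0)) * ∏ α, (X - C (φ α x)) ^ ν α)
    (hFy : ∀ α, 2 ≤ ν α → deriv (fun y => webPoly d a x₀ y (φ α x₀)) 0 ≠ 0) :
    (∀ α, 2 ≤ ν α → AnalyticAt ℂ (psi d a φ ν α) x₀) ∧
    ∃ h : Plane → Plane →L[ℂ] ℂ, AnalyticAt ℂ h (x₀, 0) ∧ ∀ᶠ z in 𝓝 ((x₀, 0) : Plane),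
      (webPolynomial d a z).roots.Nodup → fundamentalForm d (symForm d a) z -
        (1 / (6 * z.2)) • residue d a φ ν z.1 = h z := by
  classical
  set z₀ : Plane := (x₀, 0) with hz₀
  set Q := webPolynomial d a with hQdef
  have ha0 := ha.self_of_nhds
  have hQ : AnalyticFamily Q z₀ := analyticFamily_webPolynomial ha0
  have hlead : ∀ᶠ z in 𝓝 z₀, a 0 z ≠ 0 := (ha0 0).continuousAt.eventually_ne h0
  have hdeg : ∀ᶠ z in 𝓝 z₀, (Q z).natDegree = d := hlead.mono fun z hz => webPolynomial_natDegree hz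
  have hdeg' : ∀ᶠ z in 𝓝 z₀, 0 < (Q z).natDegree := hdeg.mono fun z hz => hz.symm ▸ hd
  -- Dividing each coefficient by `y` yields F(x, y, p) = F(x, 0, p) + y f(x, y, p).
  have hquot := fun k => exists_analyticAt_sub_eq_mul (ha0 k)
  choose a₁ ha₁ hq using hquot
  have hq' : ∀ᶠ z in 𝓝 z₀, ∀ k ∈ Finset.range (d + 1), a k z = a k (z.1, 0) + z.2 * a₁ k z :=
    (Filter.eventually_all_finset _).2 fun k _ =>
      (hq k).mono fun z hz => sub_eq_iff_eq_add'.1 hz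
  set f := webPolynomial d a₁ with hfdef
  have hf : AnalyticFamily f z₀ := analyticFamily_webPolynomial ha₁
  set P : Fin n → ℂ → ℂ[X] := fun α x =>
    C (a 0 (x, 0)) * ∏ β ∈ Finset.univ.erase α, (X - C (φ β x)) ^ ν β with hPdef
  have hsplit : ∀ α x, C (a 0 (x, 0)) * ∏ β, (X - C (φ β x)) ^ ν β =
      (X - C (φ α x)) ^ ν α * P α x := fun α x => by
    rw [hPdef, ← Finset.mul_prod_erase _ _ (Finset.mem_univ α)]
    ring
  have hφ' : ∀ α, AnalyticAt ℂ (fun z : Plane => φ α z.1) z₀ := fun α =>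
    AnalyticAt.fun_comp (g := φ α) (f := Prod.fst) (hφ α) analyticAt_fst
  have hP : ∀ α, AnalyticFamily (fun z : Plane => P α z.1) z₀ := fun α =>
    (AnalyticFamily.C (g := fun z : Plane => a 0 (z.1, 0)) (AnalyticAt.fun_comp (g := a 0)
      (f := fun z : Plane => (z.1, (0 : ℂ))) (ha0 0) (by fun_prop))).mul
      (AnalyticFamily.prod _ fun β _ => (AnalyticFamily.sub_C (hφ' β)).pow _)
  have hfac' : ∀ α, ∀ᶠ z in 𝓝 z₀, Q z = (X - C (φ α z.1)) ^ ν α * P α z.1 + C z.2 * f z := fun α => by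
    filter_upwards [hq', (continuousAt_fst (p := z₀)).eventually hfac] with z h1 h2
    rw [hQdef, webPolynomial_eq_add h1, ← hQdef, h2, hsplit α]
  have hQz₀ : Q z₀ = C (a 0 z₀) * ∏ α, (X - C (φ α x₀)) ^ ν α := hfac.self_of_nhds
  have hPeval : ∀ α x, (∀ β ∈ Finset.univ.erase α, φ α x ≠ φ β x) → a 0 (x, 0) ≠ 0 →
      (P α x).eval (φ α x) ≠ 0 := fun α x h h' => by
    simp only [hPdef, eval_mul, eval_C, eval_prod, eval_pow, eval_sub, eval_X]
    exact mul_ne_zero h' (Finset.prod_ne_zero_iff.2 fun β hβ => pow_ne_zero _ (sub_ne_zero.2 (h β hβ)))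
  have hneα : ∀ α, ∀ β ∈ Finset.univ.erase α, φ α x₀ ≠ φ β x₀ := fun α β hβ =>
    hne α β (Finset.ne_of_mem_erase hβ).symm
  have hP0 : ∀ α, (P α x₀).eval (φ α x₀) ≠ 0 := fun α => hPeval α x₀ (hneα α) h0
  have hsum : ∑ α, ν α = d := by
    rw [← hdeg.self_of_nhds, hQz₀, natDegree_C_mul h0, natDegree_prod _ _ fun α _ =>
      pow_ne_zero _ (X_sub_C_ne_zero _)]
    simp
  -- On y = 0 the polynomial `f` is ∂F/∂y, and the multiplicities of the other roots add up to d -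
  -- ν_α.
  have hpsi : ∀ α μ, ν α = μ + 2 → ∀ᶠ x in 𝓝 x₀, psi d a φ ν α x =
      tangencyPsi d μ (P α x) (f (x, 0)) (φ α x) := fun α μ hμ => by
    have hc : ContinuousAt (fun x : ℂ => ((x, 0) : Plane)) x₀ := by fun_prop
    have e1 : ∀ᶠ x in 𝓝 x₀, ∀ β ∈ Finset.univ.erase α, φ α x ≠ φ β x :=
      (Filter.eventually_all_finset _).2 fun β hβ =>
        (((hφ α).continuousAt.sub (hφ β).continuousAt).eventually_ne
          (sub_ne_zero.2 (hneα α β hβ))).mono fun x hx => sub_ne_zero.1 hx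
    have e2 : ∀ᶠ z in 𝓝 z₀, ∀ k ∈ Finset.range (d + 1), DifferentiableAt ℂ (a₁ k) z :=
      (Filter.eventually_all_finset _).2 fun k _ =>
        (ha₁ k).eventually_analyticAt.mono fun _ h => h.differentiableAt
    filter_upwards [e1, hc.eventually e2, hc.eventually hq'.eventually_nhds, hc.eventually hlead]
      with x x1 x2 x3 x4
    have hd1 : (fun p => deriv (fun y => webPoly d a x y p) 0) = fun p => (f (x, 0)).eval p :=
      funext fun p => deriv_webPoly x2 x3 p
    have hd2 : (P α x).derivative.eval (φ α x) / (P α x).eval (φ α x) =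
        ∑ β ∈ Finset.univ.erase α, (ν β : ℂ) / (φ α x - φ β x) := by
      rw [div_eq_iff (hPeval α x x1 x4), mul_comm]
      exact derivative_prod_sub_pow _ _ _ _ x1
    have hd3 : ∑ β ∈ Finset.univ.erase α, (ν β : ℂ) = d - (μ + 2) := by
      rw [← hsum, ← Finset.add_sum_erase _ _ (Finset.mem_univ α), hμ]
      push_cast
      ring
    rw [psi, tangencyPsi, hd1, deriv_webPoly x2 x3, Polynomial.deriv, sum_slopes_eq _ _ _ x1, hd2,
      hd3, hμ]
    push_cast
    ring
  have hf0 : ∀ α, 2 ≤ ν α → (f z₀).eval (φ α x₀) ≠ 0 := fun α hα => by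
    rw [← deriv_webPoly (fun k _ => (ha₁ k).differentiableAt) hq']
    exact hFy α hα
  have hpsi_an : ∀ α, 2 ≤ ν α → AnalyticAt ℂ (psi d a φ ν α) x₀ := fun α hα => by
    obtain ⟨μ, hμ⟩ := Nat.exists_eq_add_of_le' hα
    have hx : AnalyticAt ℂ (fun x : ℂ => ((x, 0) : Plane)) x₀ := by fun_prop
    have hev : ∀ {G : Plane → ℂ[X]}, AnalyticFamily G z₀ →
        AnalyticAt ℂ (fun x => (G (x, 0)).eval (φ α x)) x₀ := fun {G} hG =>
      AnalyticAt.fun_comp (g := fun z => (G z).eval (φ α z.1)) (f := fun x : ℂ => ((x, 0) : Plane))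
        (hG.eval_comp (hφ' α)) hx
    have h1 : AnalyticAt ℂ (fun x => tangencyPsi d μ (P α x) (f (x, 0)) (φ α x)) x₀ :=
      analyticAt_const.fun_mul ((analyticAt_const.fun_mul (analyticAt_const.fun_sub
        ((hφ α).fun_mul ((hev hf.derivative).fun_div (hev hf) (hf0 α hα))))).fun_sub
        (analyticAt_const.fun_mul (((hφ α).fun_mul ((hev (hP α).derivative).fun_div
          (hev (hP α)) (hP0 α))).fun_sub analyticAt_const)))
    exact h1.congr ((hpsi α μ hμ).mono fun x hx => hx.symm)
  refine ⟨hpsi_an, ?_⟩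
  have hlocal : ∀ α, ∀ᶠ ρ : ℝ in 𝓝[>] 0, ∃ h : Plane → Plane →L[ℂ] ℂ, AnalyticAt ℂ h z₀ ∧
      ∀ᶠ z in 𝓝 z₀, (Q z).roots.Nodup → rootSum d Q (φ α x₀) ρ z -
        (1 / (6 * z.2)) • (((ν α : ℂ) - 1) • (psi d a φ ν α z.1 • (dy - φ α z.1 • dx) +
          ((ν α : ℂ) - 2) • dy)) = h z := fun α => by
    -- A simple root has no pole, in agreement with the coefficient ν - 1 = 0, whatever value `psi`
    -- takes.
    rcases (hν α).eq_or_lt with h1 | h1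
    · have hsimple : (Q z₀).derivative.eval (φ α x₀) ≠ 0 := by
        rw [hQz₀, hsplit α x₀, ← h1, pow_one, derivative_mul]
        simpa using hP0 α
      filter_upwards [exists_analyticAt_rootSum_simple d hQ hdeg' hsimple] with ρ ⟨h, hh, he⟩
      refine ⟨h, hh, ?_⟩
      filter_upwards [he] with z hz hn
      rw [← h1, Nat.cast_one, sub_self, clm_zero_smul, clm_smul_zero, sub_zero, hz hn]
    · obtain ⟨μ, hμ⟩ := Nat.exists_eq_add_of_le' (show 2 ≤ ν α from h1)
      filter_upwards [exists_analyticAt_rootSum_tangency d μ hQ (hP α) hf (hφ α) hdeg'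
        (by simpa only [hμ] using hfac' α) (hP0 α) (hf0 α h1)] with ρ ⟨h, hh, he⟩
      refine ⟨h, hh, ?_⟩
      filter_upwards [he, (continuousAt_fst (p := z₀)).eventually (hpsi α μ hμ)] with z hz hz' hn
      rw [← hz hn, hz', hμ]
      push_cast
      rw [show (μ : ℂ) + 2 - 1 = μ + 1 by ring, show (μ : ℂ) + 2 - 2 = μ by ring]
  have hroots : ∀ p, (Q z₀).eval p = 0 → ∃ α, p = φ α x₀ := fun p hp => by
    rw [hQz₀, eval_mul, eval_C, eval_prod] at hp
    obtain ⟨α, -, hα⟩ := Finset.prod_eq_zero_iff.1 ((mul_eq_zero.1 hp).resolve_left h0)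
    refine ⟨α, ?_⟩
    simpa [sub_eq_zero] using eq_zero_of_pow_eq_zero (by simpa using hα : (p - φ α x₀) ^ ν α = 0)
  have hsep : ∀ᶠ ρ : ℝ in 𝓝[>] 0, ∀ α β, α ≠ β → 2 * ρ < dist (φ α x₀) (φ β x₀) := by
    refine Filter.eventually_all.2 fun α => Filter.eventually_all.2 fun β => ?_
    by_cases hαβ : α = β
    · exact Eventually.of_forall fun ρ h => absurd hαβ h
    · filter_upwards [Ioo_mem_nhdsGT (half_pos (dist_pos.2 (hne α β hαβ)))] with ρ hρ _
      linarith [hρ.2]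
  obtain ⟨ρ, ⟨hsepρ, hloc⟩, hρ⟩ := ((hsep.and (Filter.eventually_all.2 hlocal)).and
    self_mem_nhdsWithin).exists
  replace hρ : 0 < ρ := hρ
  choose h hh he using hloc
  have hdisj : ∀ α β p, p ∈ Metric.ball (φ α x₀) ρ → p ∈ Metric.ball (φ β x₀) ρ → α = β := by
    intro α β p h1 h2
    by_contra hαβ
    have := hsepρ α β hαβ
    have h3 := dist_triangle_left (φ α x₀) (φ β x₀) p
    rw [Metric.mem_ball] at h1 h2
    linarith
  have hsph : ∀ α, ∀ s ∈ Metric.sphere (φ α x₀) ρ, (Q z₀).eval s ≠ 0 := fun α s hs h => by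
    obtain ⟨β, rfl⟩ := hroots s h
    rcases eq_or_ne β α with rfl | hβα
    · exact Metric.ne_of_mem_sphere hs hρ.ne' rfl
    · have := hsepρ β α hβα
      rw [Metric.mem_sphere] at hs
      linarith
  have hall := eventually_forall_mem_roots hQ hρ hdeg hdisj hsph fun p hp =>
    hroots p (isRoot_of_mem_roots hp)
  refine ⟨fun z => (((d : ℂ) - 1) * ((d : ℂ) - 2) / 2) • ((a 0 z)⁻¹ • fderiv ℂ (a 0) z) +
    ∑ α, h α z, AnalyticAt.fun_add (analyticAt_const.fun_smul (((ha0 0).fun_inv h0).fun_smul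
      (ha0 0).fderiv)) (Finset.analyticAt_fun_sum _ fun α _ => hh α), ?_⟩
  filter_upwards [ha, hlead, hall, Filter.eventually_all.2 he] with z z1 z2 z3 z4 hn
  have hff := (locallySplits_of_nodup hd z1 z2 hn).isFundamentalFormAt.eq_sum_roots
    (by rwa [symForm_zero_one]) (G := Q z) fun p => webPolynomial_eval_eq_symForm p
  simp only [symForm_zero_one, ← webPolynomial_eval_eq_symForm] at hff
  -- Every nearby root lies in exactly one disc, so the sum over roots splits into clusters.
  have hsumroots : ∀ T : ℂ → Plane →L[ℂ] ℂ, ∑ p ∈ (Q z).roots.toFinset, T p =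
      ∑ α, ∑ p ∈ (Q z).roots.toFinset with p ∈ Metric.ball (φ α x₀) ρ, T p := fun T => by
    simp only [Finset.sum_filter]
    rw [Finset.sum_comm]
    refine Finset.sum_congr rfl fun p hp => ?_
    obtain ⟨α, hα⟩ := z3 p (Multiset.mem_toFinset.1 hp)
    rw [Finset.sum_eq_single α (fun β _ hβ => if_neg fun h => hβ (hdisj β α p h hα))
      (fun h => absurd (Finset.mem_univ _) h), if_pos hα]
  rw [hff, hsumroots, residue, Finset.smul_sum, add_sub_assoc, ← Finset.sum_sub_distrib]
  congr 1
  refine Finset.sum_congr rfl fun α _ => ?_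
  rw [← z4 α hn, rootSum]

end PlanarWeb
end

/-! ### Changes of charts. -/

noncomputable section

namespace PlanarWeb

section Charts

variable {M : Type*} [TopologicalSpace M] {e e' : OpenPartialHomeomorph M Plane}

theorem eventually_chart_mem {z : Plane} (hz : z ∈ e.target) {S : Set M} (hS : IsOpen S)
    (hzS : e.symm z ∈ S) : ∀ᶠ w in 𝓝 z, w ∈ e.target ∧ e.symm w ∈ S :=
  (e.open_target.eventually_mem hz).and
    ((e.continuousAt_symm hz).eventually (hS.eventually_mem hzS))

theorem chart_change_symm {z : Plane} (hz : z ∈ e.target) (hz' : e.symm z ∈ e'.source) :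
    e' (e.symm z) ∈ e'.target ∧ e'.symm (e' (e.symm z)) = e.symm z ∧
      e (e'.symm (e' (e.symm z))) = z := by
  refine ⟨e'.map_source hz', e'.left_inv hz', ?_⟩
  rw [e'.left_inv hz', e.right_inv hz]

theorem jac_comp (S T : Plane →L[ℂ] Plane) : jac (S.comp T) = jac S * jac T := by
  have h : ∀ v, S v = v.1 • S (1, 0) + v.2 • S (0, 1) := fun v => by
    have : v = v.1 • ((1, 0) : Plane) + v.2 • ((0, 1) : Plane) := by ext <;> simp
    conv_lhs => rw [this, map_add, map_smul, map_smul]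
  simp only [jac, ContinuousLinearMap.comp_apply]
  rw [h (T (1, 0)), h (T (0, 1))]
  simp
  ring

variable [ChartedSpace Plane M]

theorem chart_change_analyticAt (he : e ∈ IsManifold.maximalAtlas 𝓘(ℂ, Plane) ω M)
    (he' : e' ∈ IsManifold.maximalAtlas 𝓘(ℂ, Plane) ω M) {z : Plane} (hz : z ∈ e.target)
    (hz' : e.symm z ∈ e'.source) : AnalyticAt ℂ (fun w => e' (e.symm w)) z := by
  have h1 := contMDiffAt_symm_of_mem_maximalAtlas he hz
  have h2 := contMDiffAt_of_mem_maximalAtlas he' hz'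
  have h3 : ContMDiffAt 𝓘(ℂ, Plane) 𝓘(ℂ, Plane) ω (fun w => e' (e.symm w)) z := h2.comp z h1
  exact (contMDiffAt_iff_contDiffAt.1 h3).analyticAt

theorem jac_chart_change_ne_zero (he : e ∈ IsManifold.maximalAtlas 𝓘(ℂ, Plane) ω M)
    (he' : e' ∈ IsManifold.maximalAtlas 𝓘(ℂ, Plane) ω M) {z : Plane} (hz : z ∈ e.target)
    (hz' : e.symm z ∈ e'.source) : jac (fderiv ℂ (fun w => e' (e.symm w)) z) ≠ 0 := by
  have h1 := (chart_change_analyticAt he he' hz hz').differentiableAt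
  have h3 := chart_change_symm hz hz'
  have h2 := (chart_change_analyticAt he' he h3.1 (by
    rw [h3.2.1]
    exact e.map_target hz)).differentiableAt
  have h4 : (fun w => e (e'.symm (e' (e.symm w)))) =ᶠ[𝓝 z] id := by
    filter_upwards [eventually_chart_mem hz e'.open_source hz'] with w hw
    exact (chart_change_symm hw.1 hw.2).2.2
  have h5 := h4.fderiv_eq (𝕜 := ℂ)
  rw [fderiv_id, fderiv_fun_comp (g := fun w => e (e'.symm w))
    (f := fun w => e' (e.symm w)) z h2 h1] at h5
  have h6 := congrArg jac h5
  rw [jac_comp] at h6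
  intro h0
  rw [h0, mul_zero] at h6
  simp [jac] at h6

theorem form_congr (σ : (m : M) → TangentSpace 𝓘(ℂ, Plane) m → ℂ) {m m' : M} (h : m = m')
    (v : Plane) : σ m v = σ m' v := by
  subst h
  rfl

/-- The chain rule for the inverse chart factored through the transition map. It presents two local
expressions of a form as pull-backs of each other, as the transformation rules require. -/
theorem localExpr_chart_change (σ : (m : M) → TangentSpace 𝓘(ℂ, Plane) m → ℂ)
    (he : e ∈ IsManifold.maximalAtlas 𝓘(ℂ, Plane) ω M)
    (he' : e' ∈ IsManifold.maximalAtlas 𝓘(ℂ, Plane) ω M) {z : Plane} (hz : z ∈ e.target)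
    (hz' : e.symm z ∈ e'.source) (v : Plane) :
    localExpr σ e z v =
      localExpr σ e' (e' (e.symm z)) (fderiv ℂ (fun w => e' (e.symm w)) z v) := by
  have h3 := chart_change_symm hz hz'
  have h1 : MDifferentiableAt 𝓘(ℂ, Plane) 𝓘(ℂ, Plane) (fun w => e' (e.symm w)) z :=
    (chart_change_analyticAt he he' hz hz').differentiableAt.mdifferentiableAt
  have h2 : MDifferentiableAt 𝓘(ℂ, Plane) 𝓘(ℂ, Plane) e'.symm (e' (e.symm z)) :=
    (contMDiffAt_symm_of_mem_maximalAtlas he' h3.1).mdifferentiableAt (by simp)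
  have h4 : e.symm =ᶠ[𝓝 z] e'.symm ∘ fun w => e' (e.symm w) := by
    filter_upwards [eventually_chart_mem hz e'.open_source hz'] with w hw
    exact (chart_change_symm hw.1 hw.2).2.1.symm
  have h5 := h4.mfderiv_eq (I := 𝓘(ℂ, Plane)) (I' := 𝓘(ℂ, Plane))
  have h6 := mfderiv_comp z h2 h1
  rw [localExpr, localExpr]
  have h7 : mfderiv 𝓘(ℂ, Plane) 𝓘(ℂ, Plane) e.symm z v =
      mfderiv 𝓘(ℂ, Plane) 𝓘(ℂ, Plane) e'.symm (e' (e.symm z))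
        (fderiv ℂ (fun w => e' (e.symm w)) z v) := by
    rw [← mfderiv_eq_fderiv]
    exact (congrArg (fun A : Plane →L[ℂ] Plane => A v) h5).trans
      (congrArg (fun A : Plane →L[ℂ] Plane => A v) h6)
  refine (congrArg (σ (e.symm z)) h7).trans ?_
  exact form_congr σ h3.2.1.symm _

theorem transHomeomorph_mem_maximalAtlas [IsManifold 𝓘(ℂ, Plane) ω M]
    (he : e ∈ IsManifold.maximalAtlas 𝓘(ℂ, Plane) ω M)
    (T : Plane ≃L[ℂ] Plane) :
    e.transHomeomorph T.toHomeomorph ∈ IsManifold.maximalAtlas 𝓘(ℂ, Plane) ω M := by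
  rw [IsManifold.mem_maximalAtlas_iff_contMDiffOn] at he ⊢
  exact ⟨(T.contDiff.contMDiff).comp_contMDiffOn he.1,
    he.2.comp T.symm.contDiff.contMDiff.contMDiffOn fun z hz => hz⟩

end Charts

end PlanarWeb
end

/-! ### Splitting of symmetric forms and the discriminant. -/

noncomputable section

namespace PlanarWeb

section Splitting

variable {d : ℕ} {T T' : Type*} [AddCommGroup T] [Module ℂ T] [AddCommGroup T'] [Module ℂ T']

theorem SplitsDistinct.comp {q : T → ℂ} (h : SplitsDistinct d q) (A : T' →ₗ[ℂ] T)
    (hA : Function.Surjective A) : SplitsDistinct d (fun v => q (A v)) := by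
  obtain ⟨ℓ, h1, h2⟩ := h
  refine ⟨fun r => (ℓ r).comp A, fun v => h1 (A v), fun r s hrs => ?_⟩
  have h3 := LinearIndependent.pair_iff.1 (h2 r s hrs)
  refine LinearIndependent.pair_iff.2 fun x y hxy => h3 x y ?_
  ext v
  obtain ⟨w, rfl⟩ := hA v
  exact congrArg (fun f : Module.Dual ℂ T' => f w) hxy

theorem splitsDistinct_comp_iff {q : T → ℂ} (A : T' →ₗ[ℂ] T) (hA : Function.Bijective A) :
    SplitsDistinct d (fun v => q (A v)) ↔ SplitsDistinct d q := by
  refine ⟨fun h => ?_, fun h => h.comp A hA.2⟩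
  have := h.comp (LinearEquiv.ofBijective A hA).symm.toLinearMap
    (LinearEquiv.ofBijective A hA).symm.surjective
  have e : (fun v => q (A ((LinearEquiv.ofBijective A hA).symm.toLinearMap v))) = q := by
    funext v
    exact congrArg q ((LinearEquiv.ofBijective A hA).apply_symm_apply v)
  rwa [e] at this

theorem SplitsDistinct.mul (hd : 0 < d) {q : T → ℂ} (h : SplitsDistinct d q) {c : ℂ} (hc : c ≠ 0) :
    SplitsDistinct d (fun v => c * q v) := by
  obtain ⟨ℓ, h1, h2⟩ := h
  have hu : ∀ r : Fin d, (if r = ⟨0, hd⟩ then c else 1) ≠ 0 := fun r => by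
    split_ifs <;> simp [hc]
  refine ⟨fun r => (if r = ⟨0, hd⟩ then c else 1) • ℓ r, fun v => ?_, fun r s hrs => ?_⟩
  · simp only [LinearMap.smul_apply, smul_eq_mul, Finset.prod_mul_distrib, h1]
    simp
  · refine LinearIndependent.pair_iff.2 fun x y hxy => ?_
    rw [smul_smul, smul_smul] at hxy
    obtain ⟨hx, hy⟩ := LinearIndependent.pair_iff.1 (h2 r s hrs) _ _ hxy
    exact ⟨(mul_eq_zero.1 hx).resolve_right (hu r), (mul_eq_zero.1 hy).resolve_right (hu s)⟩

theorem splitsDistinct_of_wedge {q : Plane → ℂ} {L : Fin d → Plane →L[ℂ] ℂ}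
    (hq : ∀ v, q v = ∏ r, L r v) (hL : ∀ r s, r ≠ s → wedge (L r) (L s) ≠ 0) :
    SplitsDistinct d q := by
  refine ⟨fun r => (L r).toLinearMap, hq, fun r s hrs => LinearIndependent.pair_iff.2 fun x y hxy => ?_⟩
  have h1 : x * L r (1, 0) + y * L s (1, 0) = 0 :=
    congrArg (fun f : Module.Dual ℂ Plane => f (1, 0)) hxy
  have h2 : x * L r (0, 1) + y * L s (0, 1) = 0 :=
    congrArg (fun f : Module.Dual ℂ Plane => f (0, 1)) hxy
  have h3 := hL r s hrs
  unfold wedge at h3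
  constructor
  · refine (mul_eq_zero.1 ?_).resolve_right h3
    linear_combination L s (0, 1) * h1 - L s (1, 0) * h2
  · refine (mul_eq_zero.1 ?_).resolve_right h3
    linear_combination L r (1, 0) * h2 - L r (0, 1) * h1

theorem LocallySplits.eventually_splitsDistinct {σ : Plane → Plane → ℂ} {z : Plane}
    (h : LocallySplits d σ z) : ∀ᶠ w in 𝓝 z, SplitsDistinct d (σ w) := by
  filter_upwards [h.eventually] with w hw
  obtain ⟨L, -, h2, h3⟩ := hw
  exact splitsDistinct_of_wedge h3.self_of_nhds h2

end Splitting

/-- The shear as an automorphism of the plane. -/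
def shearEquiv (t : ℂ) : Plane ≃L[ℂ] Plane :=
  ContinuousLinearEquiv.equivOfInverse (shear t) ((dy - t • dx).prod dx)
    (fun v => by ext <;> simp [shear]) fun v => by ext <;> simp [shear]

section

variable {M : Type*} [TopologicalSpace M] [ChartedSpace Plane M]
  {e e' : OpenPartialHomeomorph M Plane}

theorem localExpr_transHomeomorph [IsManifold 𝓘(ℂ, Plane) ω M]
    (σ : (m : M) → TangentSpace 𝓘(ℂ, Plane) m → ℂ)
    (he : e ∈ IsManifold.maximalAtlas 𝓘(ℂ, Plane) ω M) (T : Plane ≃L[ℂ] Plane) {w : Plane}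
    (hw : T.symm w ∈ e.target) (v : Plane) :
    localExpr σ (e.transHomeomorph T.toHomeomorph) w v = localExpr σ e (T.symm w) (T.symm v) := by
  have h1 := localExpr_chart_change σ (transHomeomorph_mem_maximalAtlas he T) he
    (z := w) hw (e.map_target hw) v
  rw [h1]
  have h2 : (fun u => e ((e.transHomeomorph T.toHomeomorph).symm u)) =ᶠ[𝓝 w] T.symm := by
    filter_upwards [T.symm.continuous.continuousAt.eventually (e.open_target.eventually_mem hw)]
      with u hu
    exact e.right_inv hu
  have h3 : fderiv ℂ (T.symm : Plane → Plane) w = T.symm := T.symm.toContinuousLinearMap.fderiv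
  have h4 : e ((e.transHomeomorph T.toHomeomorph).symm w) = T.symm w := h2.self_of_nhds
  rw [h2.fderiv_eq, h4, h3]
  rfl

theorem splitsDistinct_localExpr_iff {d : ℕ} (σ : (m : M) → TangentSpace 𝓘(ℂ, Plane) m → ℂ)
    (he : e ∈ IsManifold.maximalAtlas 𝓘(ℂ, Plane) ω M) {z : Plane} (hz : z ∈ e.target) :
    SplitsDistinct d (localExpr σ e z) ↔ SplitsDistinct d (σ (e.symm z)) := by
  have h1 : e.MDifferentiable 𝓘(ℂ, Plane) 𝓘(ℂ, Plane) :=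
    ⟨(contMDiffOn_of_mem_maximalAtlas he).mdifferentiableOn (by simp),
      (contMDiffOn_symm_of_mem_maximalAtlas he).mdifferentiableOn (by simp)⟩
  exact splitsDistinct_comp_iff (q := σ (e.symm z))
    (mfderiv 𝓘(ℂ, Plane) 𝓘(ℂ, Plane) e.symm z).toLinearMap (h1.symm.mfderiv_bijective hz)

namespace Web

variable {d : ℕ} {ι : Type*} (W : Web d ι M)

/-- In degree 0 or 1 a defining form splits everywhere, so the discriminant is empty. -/
theorem two_le_of_mem_discriminant [IsManifold 𝓘(ℂ, Plane) ω M] {m : M} (hm : m ∈ W.discriminant) :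
    2 ≤ d := by
  obtain ⟨i, hi, hns⟩ := hm
  by_contra! hd
  set e := chartAt Plane m with hedef
  have he : e ∈ IsManifold.maximalAtlas 𝓘(ℂ, Plane) ω M := IsManifold.chart_mem_maximalAtlas m
  have hms : m ∈ e.source := mem_chart_source Plane m
  obtain ⟨a, ha, hform⟩ := W.holomorphic i e he
  have hmem : ∀ m' ∈ e.source ∩ W.dom i, e m' ∈ e.target ∩ e.symm ⁻¹' W.dom i := fun m' hm' =>
    ⟨e.map_source hm'.1, by rw [Set.mem_preimage, e.left_inv hm'.1]; exact hm'.2⟩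
  have hiff := splitsDistinct_localExpr_iff (d := d) (W.form i) he (e.map_source hms)
  rw [e.left_inv hms, funext (hform _ (hmem m ⟨hms, hi⟩))] at hiff
  refine hns (hiff.1 ?_)
  interval_cases d
  -- A form of degree 0 is a function, which splits exactly where it equals 1. Splitting points are
  -- dense, so by continuity it equals 1 everywhere.
  · refine ⟨Fin.elim0, fun v => ?_, fun r => r.elim0⟩
    have hval : ∀ v, symForm 0 a (e m) v = a 0 (e m) := fun v => by simp [symForm]
    rw [hval, Finset.univ_eq_empty, Finset.prod_empty]
    by_contra h1
    have hcont : ContinuousAt (fun m' => a 0 (e m')) m :=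
      ContinuousAt.comp (g := a 0) ((ha 0 _ (hmem m ⟨hms, hi⟩)).continuousAt) (e.continuousAt hms)
    obtain ⟨m', ⟨hm1, hm2⟩, hm3, hm4⟩ := ((mem_closure_iff_frequently.1
      (W.generic_splits i hi)).and_eventually ((hcont.eventually_ne h1).and
        (e.open_source.eventually_mem hms))).exists
    have h2 := (splitsDistinct_localExpr_iff (d := 0) (W.form i) he (e.map_source hm4)).2
      (by rwa [e.left_inv hm4])
    obtain ⟨ℓ, h5, -⟩ := h2
    have h6 := h5 0
    rw [hform _ (hmem m' ⟨hm4, hm1⟩), Finset.univ_eq_empty, Finset.prod_empty] at h6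
    exact hm3 (by simpa [symForm] using h6)
  -- A linear form is its own splitting; there are no pairs to compare.
  · refine ⟨fun _ => (a 1 (e m) • dx + a 0 (e m) • dy).toLinearMap, fun v => ?_, fun r s hrs =>
      absurd (Subsingleton.elim r s) hrs⟩
    simp [symForm, Finset.sum_range_succ]
    ring

theorem splitsDistinct_of_notMem {m : M} (hm : m ∉ W.discriminant) {i : ι} (hi : m ∈ W.dom i) :
    SplitsDistinct d (W.form i m) := by
  by_contra h
  exact hm ⟨i, hi, h⟩

/-- Off the discriminant, the web is a superposition of `d` foliations. -/
theorem locallySplits [IsManifold 𝓘(ℂ, Plane) ω M] (hd : 2 ≤ d)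
    (he : e ∈ IsManifold.maximalAtlas 𝓘(ℂ, Plane) ω M) {z : Plane} (hz : z ∈ e.target)
    (hΔ : e.symm z ∉ W.discriminant) {i : ι} (hi : e.symm z ∈ W.dom i) :
    LocallySplits d (localExpr (W.form i) e) z := by
  have hform := W.splitsDistinct_of_notMem hΔ hi
  obtain ⟨ℓ, h1, h2⟩ := (splitsDistinct_localExpr_iff (W.form i) he hz).2 hform
  have hℓ : ∀ r, LinearMap.toContinuousLinearMap (ℓ r) ≠ 0 := fun r h0 => by
    have : Nontrivial (Fin d) := Fin.nontrivial_iff_two_le.2 hd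
    obtain ⟨s, hs⟩ := exists_ne r
    have h3 := (h2 r s hs.symm).ne_zero 0
    refine h3 (LinearMap.ext fun v => ?_)
    exact congrArg (fun f : Plane →L[ℂ] ℂ => f v) h0
  -- In sheared coordinates no factor is vertical, so the leading coefficient is nonzero, the roots
  -- of F are simple, and `locallySplits_of_nodup` applies. The splitting is then pulled back.
  obtain ⟨t, ht⟩ := exists_shear hℓ
  set e' := e.transHomeomorph (shearEquiv t).symm.toHomeomorph with he'def
  have he' : e' ∈ IsManifold.maximalAtlas 𝓘(ℂ, Plane) ω M := transHomeomorph_mem_maximalAtlas he _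
  have hw : (shearEquiv t).symm.symm ((shearEquiv t).symm z) = z := by simp
  set w := (shearEquiv t).symm z with hwdef
  have hwt : w ∈ e'.target := by
    change (shearEquiv t).symm.symm w ∈ e.target
    rwa [hw]
  have hws : e'.symm w = e.symm z := by
    change e.symm ((shearEquiv t).symm.symm w) = _
    rw [hw]
  obtain ⟨a, ha, hae⟩ := W.holomorphic i e' he'
  have hopen : IsOpen (e'.target ∩ e'.symm ⁻¹' W.dom i) :=
    e'.isOpen_inter_preimage_symm (W.isOpen_dom i)
  have hwm : w ∈ e'.target ∩ e'.symm ⁻¹' W.dom i := ⟨hwt, by rw [Set.mem_preimage, hws]; exact hi⟩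
  have ha0 : a 0 w ≠ 0 := by
    rw [← symForm_zero_one (d := d) (a := a) (z := w), ← hae w hwm, he'def,
      localExpr_transHomeomorph _ he _ (by rwa [hw]), hw, h1]
    exact Finset.prod_ne_zero_iff.2 fun r _ => ht r
  have hsplit : SplitsDistinct d (symForm d a w) := by
    rw [← funext (hae w hwm), splitsDistinct_localExpr_iff _ he' hwt, hws]
    exact hform
  have h4 : LocallySplits d (localExpr (W.form i) e') w :=
    (locallySplits_of_nodup (by omega) (fun k => ha k w hwm) ha0
      (webPolynomial_nodup_of_splitsDistinct ha0 hsplit)).congr (by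
        filter_upwards [hopen.mem_nhds hwm] with u hu v using (hae u hu v).symm)
  have hzs : e.symm z ∈ e'.source := e.map_target hz
  have hτ : e' (e.symm z) = w := by
    change (shearEquiv t).symm (e (e.symm z)) = w
    rw [e.right_inv hz]
  refine LocallySplits.pullback (τ := fun u => e' (e.symm u)) (σ := localExpr (W.form i) e')
    (by rwa [hτ]) (chart_change_analyticAt he he' hz hzs) (jac_chart_change_ne_zero he he' hz hzs) ?_
  filter_upwards [eventually_chart_mem hz e'.open_source hzs] with u hu v
  exact localExpr_chart_change _ he he' hu.1 hu.2 v

/-- Splitting at a point extends to a holomorphic splitting nearby, so it is an open condition;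
units between the defining forms make it independent of the index. -/
theorem isClosed_discriminant [IsManifold 𝓘(ℂ, Plane) ω M] (hd : 2 ≤ d) :
    IsClosed W.discriminant := by
  rw [← isOpen_compl_iff, isOpen_iff_mem_nhds]
  intro m hm
  obtain ⟨i, hi⟩ := W.covers m
  set e := chartAt Plane m with hedef
  have he : e ∈ IsManifold.maximalAtlas 𝓘(ℂ, Plane) ω M := IsManifold.chart_mem_maximalAtlas m
  have hms : m ∈ e.source := mem_chart_source Plane m
  have h1 := (W.locallySplits hd he (e.map_source hms) (by rwa [e.left_inv hms])
    (i := i) (by rwa [e.left_inv hms])).eventually_splitsDistinct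
  filter_upwards [(e.continuousAt hms).eventually h1, e.open_source.mem_nhds hms,
    (W.isOpen_dom i).mem_nhds hi] with m' h2 h3 h4
  rintro ⟨j, hj, hns⟩
  rw [splitsDistinct_localExpr_iff _ he (e.map_source h3), e.left_inv h3] at h2
  obtain ⟨g, -, hg⟩ := W.compatible j i
  obtain ⟨hg0, hgf⟩ := hg m' ⟨hj, h4⟩
  refine hns ?_
  rw [funext hgf]
  exact h2.mul (by omega) hg0

theorem dense_compl_discriminant [IsManifold 𝓘(ℂ, Plane) ω M] (hd : 2 ≤ d) :
    Dense W.discriminantᶜ := by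
  intro m
  obtain ⟨i, hi⟩ := W.covers m
  refine closure_mono ?_ (W.generic_splits i hi)
  rintro m' ⟨hm1, hm2⟩ ⟨j, hj, hns⟩
  obtain ⟨g, -, hg⟩ := W.compatible j i
  obtain ⟨hg0, hgf⟩ := hg m' ⟨hj, hm1⟩
  refine hns ?_
  rw [funext hgf]
  exact hm2.mul (by omega) hg0

theorem exists_localExpr_eq_mul {i j : ι} (he : e ∈ IsManifold.maximalAtlas 𝓘(ℂ, Plane) ω M)
    {z : Plane} (hz : z ∈ e.target) (hi : e.symm z ∈ W.dom i) (hj : e.symm z ∈ W.dom j) :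
    ∃ g : Plane → ℂ, AnalyticAt ℂ g z ∧ g z ≠ 0 ∧
      ∀ᶠ w in 𝓝 z, ∀ v, localExpr (W.form i) e w v = g w * localExpr (W.form j) e w v := by
  obtain ⟨g, hg, hgf⟩ := W.compatible i j
  have hopen := (W.isOpen_dom i).inter (W.isOpen_dom j)
  refine ⟨fun w => g (e.symm w), ?_, (hgf _ ⟨hi, hj⟩).1, ?_⟩
  · have h1 : ContMDiffAt 𝓘(ℂ, Plane) 𝓘(ℂ, ℂ) ω (fun w => g (e.symm w)) z :=
      (hg.contMDiffAt (hopen.mem_nhds ⟨hi, hj⟩)).comp z (contMDiffAt_symm_of_mem_maximalAtlas he hz)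
    exact (contMDiffAt_iff_contDiffAt.1 h1).analyticAt
  · filter_upwards [eventually_chart_mem hz hopen ⟨hi, hj⟩] with w hw v
    exact (hgf _ hw.2).2 _

end Web

end

end PlanarWeb
end

/-! ### The regular locus of the discriminant and propagation of the curvature along it. -/

noncomputable section

namespace PlanarWeb

section

variable {d : ℕ} {ι M : Type*} [TopologicalSpace M] [ChartedSpace Plane M]
  [IsManifold 𝓘(ℂ, Plane) ω M] {e : OpenPartialHomeomorph M Plane}

/-- Around a regular point of a curve there are polydisc coordinates in which the curve is
`{y = 0}`. -/
theorem exists_adapted_chart {Δ N : Set M} {m : M} (hm : m ∈ regularLocus Δ) (hN : IsOpen N)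
    (hmN : m ∈ N) : ∃ e ∈ IsManifold.maximalAtlas 𝓘(ℂ, Plane) ω M, m ∈ e.source ∧ e.source ⊆ N ∧
      (∀ m' ∈ e.source, m' ∈ Δ ↔ (e m').2 = 0) ∧ ∃ r > 0, e.target = Metric.ball (e m) r := by
  obtain ⟨-, e, he, hme, hiff⟩ := hm
  have h1 : e.target ∩ e.symm ⁻¹' N ∈ 𝓝 (e m) :=
    (e.isOpen_inter_preimage_symm hN).mem_nhds
      ⟨e.map_source hme, by rwa [Set.mem_preimage, e.left_inv hme]⟩
  obtain ⟨r, hr, hsub⟩ := Metric.nhds_basis_ball.mem_iff.1 h1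
  have hsrc : ∀ m', m' ∈ (e.symm.restr (Metric.ball (e m) r)).target →
      m' ∈ e.source ∧ e m' ∈ Metric.ball (e m) r := fun m' hm' => by
    simpa [Metric.isOpen_ball.interior_eq] using hm'
  -- Restricting the inverse chart, rather than the chart, makes the new target exactly the ball.
  refine ⟨(e.symm.restr (Metric.ball (e m) r)).symm, ?_, ?_, ?_, ?_, r, hr, ?_⟩
  · rw [IsManifold.mem_maximalAtlas_iff_contMDiffOn] at he ⊢
    refine ⟨he.1.mono fun m' hm' => (hsrc m' hm').1, he.2.mono fun z hz => ?_⟩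
    have : z ∈ e.target ∧ z ∈ Metric.ball (e m) r := by
        simpa [Metric.isOpen_ball.interior_eq] using hz
    exact this.1
  · simpa [hme, Metric.isOpen_ball.interior_eq] using hr
  · intro m' hm'
    have := (hsub (hsrc m' hm').2).2
    rwa [Set.mem_preimage, e.left_inv (hsrc m' hm').1] at this
  · exact fun m' hm' => hiff m' (hsrc m' hm').1
  · ext z
    constructor
    · intro hz
      have : z ∈ e.target ∧ z ∈ Metric.ball (e m) r := by
        simpa [Metric.isOpen_ball.interior_eq] using hz
      exact this.2
    · intro hz
      simpa [Metric.isOpen_ball.interior_eq] using And.intro (hsub hz).1 hz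

omit [IsManifold 𝓘(ℂ, Plane) ω M] in
theorem mem_regularLocus_of_chart {Δ : Set M} (he : e ∈ IsManifold.maximalAtlas 𝓘(ℂ, Plane) ω M)
    (hiff : ∀ m' ∈ e.source, m' ∈ Δ ↔ (e m').2 = 0) {m : M} (hm : m ∈ e.source)
    (hm0 : (e m).2 = 0) : m ∈ regularLocus Δ :=
  ⟨(hiff m hm).2 hm0, e, he, hm, hiff⟩

omit [IsManifold 𝓘(ℂ, Plane) ω M] in
/-- In polydisc coordinates in which `Δ = {y = 0}`, all points of `Δ` belong to the same component
of the regular locus. -/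
theorem mem_component_of_chart {Δ : Set M} (he : e ∈ IsManifold.maximalAtlas 𝓘(ℂ, Plane) ω M)
    (hiff : ∀ m' ∈ e.source, m' ∈ Δ ↔ (e m').2 = 0) {m m' m₀ : M} {r : ℝ}
    (htar : e.target = Metric.ball (e m) r) (hm : m ∈ e.source)
    (hmC : m ∈ connectedComponentIn (regularLocus Δ) m₀) (hm' : m' ∈ e.source)
    (hm0 : (e m').2 = 0) : m' ∈ connectedComponentIn (regularLocus Δ) m₀ := by
  have hmΔ : (e m).2 = 0 := (hiff m hm).1 (connectedComponentIn_subset _ _ hmC).1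
  rw [connectedComponentIn_eq hmC]
  have hsub : Metric.ball (e m).1 r ×ˢ {(0 : ℂ)} ⊆ e.target := by
    rintro ⟨x, y⟩ ⟨hx, hy⟩
    rw [Set.mem_singleton_iff] at hy
    rw [htar, Metric.mem_ball, Prod.dist_eq, max_lt_iff]
    refine ⟨hx, ?_⟩
    rw [hy, hmΔ, dist_self]
    exact dist_nonneg.trans_lt hx
  have hpre : IsPreconnected (e.symm '' (Metric.ball (e m).1 r ×ˢ {(0 : ℂ)})) :=
    (((convex_ball _ r).isPreconnected).prod isPreconnected_singleton).image _
      (e.continuousOn_symm.mono hsub)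
  have hmem : ∀ m₁ ∈ e.source, (e m₁).2 = 0 →
      m₁ ∈ e.symm '' (Metric.ball (e m).1 r ×ˢ {(0 : ℂ)}) := fun m₁ h1 h2 => by
    refine ⟨e m₁, ⟨?_, h2⟩, e.left_inv h1⟩
    have := e.map_source h1
    rw [htar, Metric.mem_ball, Prod.dist_eq, max_lt_iff] at this
    exact this.1
  refine hpre.subset_connectedComponentIn (hmem m hm hmΔ) ?_ (hmem m' hm' hm0)
  rintro _ ⟨z, hz, rfl⟩
  refine mem_regularLocus_of_chart he hiff (e.map_target (hsub hz)) ?_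
  rw [e.right_inv (hsub hz)]
  exact hz.2

namespace Web

variable (W : Web d ι M)

/-- The curvature extends holomorphically near `m`. -/
def CurvatureExtendsAt (m : M) : Prop :=
  ∀ e ∈ IsManifold.maximalAtlas 𝓘(ℂ, Plane) ω M, m ∈ e.source → ∀ i, m ∈ W.dom i →
    ExtendsAt (W.discrIn e) (curvature d (localExpr (W.form i) e)) (e m)

variable {W}

theorem analyticAt_curvature (hd : 2 ≤ d)
    (he : e ∈ IsManifold.maximalAtlas 𝓘(ℂ, Plane) ω M) {z : Plane} (hz : z ∈ e.target)
    (hΔ : e.symm z ∉ W.discriminant) {i : ι} (hi : e.symm z ∈ W.dom i) :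
    AnalyticAt ℂ (curvature d (localExpr (W.form i) e)) z :=
  extd_analyticAt (W.locallySplits hd he hz hΔ hi).analyticAt_fundamentalForm

/-- Holomorphic extension of the curvature does not depend on coordinates and on defining forms. -/
theorem curvatureExtendsAt_of_extendsAt (hd : 2 ≤ d)
    (he : e ∈ IsManifold.maximalAtlas 𝓘(ℂ, Plane) ω M) {z : Plane} (hz : z ∈ e.target) {i : ι}
    (hi : e.symm z ∈ W.dom i)
    (h : ExtendsAt (W.discrIn e) (curvature d (localExpr (W.form i) e)) z) :
    W.CurvatureExtendsAt (e.symm z) := by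
  intro e' he' hm j hj
  obtain ⟨k, hk, hkeq⟩ := h
  set w₀ := e' (e.symm z) with hw₀
  have hw₀t : w₀ ∈ e'.target := e'.map_source hm
  have hw₀s : e'.symm w₀ = e.symm z := e'.left_inv hm
  have hes : e'.symm w₀ ∈ e.source := by
    rw [hw₀s]
    exact e.map_target hz
  have hτ : e (e'.symm w₀) = z := by rw [hw₀s, e.right_inv hz]
  have hτan := chart_change_analyticAt he' he hw₀t hes
  refine ⟨fun w => jac (fderiv ℂ (fun u => e (e'.symm u)) w) * k (e (e'.symm w)),
    (jac_analyticAt hτan).fun_mul (AnalyticAt.fun_comp (g := k) (f := fun u => e (e'.symm u))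
      (by rwa [hτ]) hτan), ?_⟩
  have hτc : Tendsto (fun w => e (e'.symm w)) (𝓝 w₀) (𝓝 z) := by
    rw [← hτ]
    exact hτan.continuousAt
  have hopen := (W.isOpen_dom i).inter (W.isOpen_dom j)
  filter_upwards [(eventually_chart_mem hw₀t e.open_source hes).eventually_nhds,
    eventually_chart_mem hw₀t hopen (by rw [hw₀s]; exact ⟨hi, hj⟩),
    hτc.eventually hkeq] with w w1 w2 w3 hw
  obtain ⟨w4, w5⟩ := w1.self_of_nhds
  obtain ⟨u1, u2, -⟩ := chart_change_symm w4 w5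
  have hwΔ : e'.symm w ∉ W.discriminant := hw
  obtain ⟨g, hg, hg0, hgeq⟩ := W.exists_localExpr_eq_mul (i := j) (j := i) he' w4 w2.2.2 w2.2.1
  rw [(W.locallySplits hd he' w4 hwΔ w2.2.1).curvature_mul (by omega) hg hg0 hgeq,
    LocallySplits.curvature_pullback (τ := fun u => e (e'.symm u)) (σ := localExpr (W.form i) e)
      (W.locallySplits hd he u1 (by rwa [u2]) (by rw [u2]; exact w2.2.1))
      (chart_change_analyticAt he' he w4 w5) (jac_chart_change_ne_zero he' he w4 w5)
      (w1.mono fun u hu v => localExpr_chart_change _ he' he hu.1 hu.2 v)]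
  congr 1
  refine w3 fun hΔ => hwΔ ?_
  rw [← u2]
  exact hΔ

/-- In a polydisc chart the curvature is holomorphic off y = 0, so `extends_of_extends` carries an
extension from one point of the line to any other. -/
theorem curvatureExtendsAt_iff_of_chart (hd : 2 ≤ d)
    (he : e ∈ IsManifold.maximalAtlas 𝓘(ℂ, Plane) ω M)
    (hiff : ∀ m' ∈ e.source, m' ∈ W.discriminant ↔ (e m').2 = 0) {i : ι} (hi : e.source ⊆ W.dom i)
    {z₀ : Plane} (hz₀ : z₀.2 = 0) {r : ℝ} (hr : 0 < r) (htar : e.target = Metric.ball z₀ r)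
    {m m' : M} (hm : m ∈ e.source) (hm' : m' ∈ e.source) (hm0 : (e m).2 = 0) (hm0' : (e m').2 = 0)
    (h : W.CurvatureExtendsAt m) : W.CurvatureExtendsAt m' := by
  have hdisc : ∀ z ∈ e.target, z ∉ W.discrIn e ↔ z.2 ≠ 0 := fun z hz => by
    have := hiff (e.symm z) (e.map_target hz)
    rw [e.right_inv hz] at this
    exact not_congr this
  have hball : ∀ x ∈ Metric.ball z₀.1 r, ∀ y, ‖y‖ < r → (x, y) ∈ e.target := fun x hx y hy => by
    rw [htar, Metric.mem_ball, Prod.dist_eq, max_lt_iff]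
    exact ⟨hx, by simpa [hz₀] using hy⟩
  have hx : ∀ m₁ ∈ e.source, (e m₁).1 ∈ Metric.ball z₀.1 r := fun m₁ h1 => by
    have := e.map_source h1
    rw [htar, Metric.mem_ball, Prod.dist_eq, max_lt_iff] at this
    exact this.1
  have hpt : ∀ m₁, (e m₁).2 = 0 → ((e m₁).1, (0 : ℂ)) = e m₁ := fun m₁ h1 => by
    rw [← h1]
  have hev : ∀ m₁ ∈ e.source, ∀ᶠ z in 𝓝 (e m₁), z ∈ e.target := fun m₁ h1 =>
    e.open_target.eventually_mem (e.map_source h1)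
  obtain ⟨k, hk, hkeq⟩ := h e he hm i (hi hm)
  have key := extends_of_extends (f := curvature d (localExpr (W.form i) e)) Metric.isOpen_ball
    (convex_ball z₀.1 r).isPreconnected hr (fun x hx y hy hyr =>
      analyticAt_curvature hd he (hball x hx y hyr) ((hdisc _ (hball x hx y hyr)).2 hy)
        (hi (e.map_target (hball x hx y hyr)))) (hx m hm)
    ⟨k, by rwa [hpt m hm0], by
      rw [hpt m hm0]
      filter_upwards [hkeq, hev m hm] with z h1 h2 h3 using h1 ((hdisc z h2).2 h3)⟩ (hx m' hm')
  rw [hpt m' hm0'] at key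
  obtain ⟨k', hk', hkeq'⟩ := key
  have := curvatureExtendsAt_of_extendsAt hd he (e.map_source hm') (i := i)
    (by rw [e.left_inv hm']; exact hi hm') ⟨k', hk', by
      filter_upwards [hkeq', hev m' hm'] with z h1 h2 h3 using h1 ((hdisc z h2).1 h3)⟩
  rwa [e.left_inv hm'] at this

/-- If the curvature extends near one point of a component of the regular locus of the
discriminant, it extends near all its points. -/
theorem curvatureExtendsAt_of_mem_component (hd : 2 ≤ d) {m₀ m m' : M}
    (hm : m ∈ connectedComponentIn (regularLocus W.discriminant) m₀)
    (hm' : m' ∈ connectedComponentIn (regularLocus W.discriminant) m₀)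
    (h : W.CurvatureExtendsAt m) : W.CurvatureExtendsAt m' := by
  -- Being equivalent as to extendability is a locally trivial equivalence relation, hence trivial
  -- on a preconnected set.
  refine (isPreconnected_connectedComponentIn.induction₂
    (fun m₁ m₂ => W.CurvatureExtendsAt m₁ ↔ W.CurvatureExtendsAt m₂) (fun m₁ hm₁ => ?_)
    (fun _ _ _ _ _ _ h1 h2 => h1.trans h2) (fun _ _ _ _ h1 => h1.symm) hm hm').1 h
  have hreg := connectedComponentIn_subset _ _ hm₁
  obtain ⟨i, hi⟩ := W.covers m₁
  obtain ⟨e, he, hms, hsub, hiff, r, hr, htar⟩ := exists_adapted_chart hreg (W.isOpen_dom i) hi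
  have h0 := (hiff m₁ hms).1 hreg.1
  filter_upwards [mem_nhdsWithin_of_mem_nhds (e.open_source.mem_nhds hms), self_mem_nhdsWithin]
    with m₂ h2 h3
  have h0' := (hiff m₂ h2).1 (connectedComponentIn_subset _ _ h3).1
  exact ⟨curvatureExtendsAt_iff_of_chart hd he hiff hsub h0 hr htar hms h2 h0 h0',
    curvatureExtendsAt_iff_of_chart hd he hiff hsub h0 hr htar h2 hms h0' h0⟩

end Web

end

end PlanarWeb
end

/-! ### Smoothness of the characteristic surface and transversality to y = 0. -/

noncomputable section

namespace PlanarWeb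

section

open Polynomial

variable {d : ℕ} {a : ℕ → Plane → ℂ}

theorem analyticAt_symForm {z : Plane} (ha : ∀ k, AnalyticAt ℂ (a k) z) (v : Plane) :
    AnalyticAt ℂ (fun u : Plane × Plane => symForm d a u.1 u.2) (z, v) := by
  unfold symForm
  refine Finset.analyticAt_fun_sum _ fun k _ => ?_
  have h1 : AnalyticAt ℂ (fun u : Plane × Plane => a k u.1) (z, v) :=
    AnalyticAt.fun_comp (g := a k) (f := Prod.fst) (ha k) analyticAt_fst
  fun_prop

/-- Where the characteristic surface is smooth, `∂F/∂y` does not vanish at a multiple root of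
`F(x, 0, p)`. -/
theorem deriv_webPoly_ne_zero_of_smooth {x₀ : ℂ} {φ : ℂ → ℂ}
    (ha : ∀ k, AnalyticAt ℂ (a k) (x₀, 0)) (hφ : DifferentiableAt ℂ φ x₀)
    (hroot : ∀ᶠ x in 𝓝 x₀, (webPolynomial d a (x, 0)).eval (φ x) = 0)
    (hdouble : (webPolynomial d a (x₀, 0)).derivative.eval (φ x₀) = 0)
    (hs : fderiv ℂ (fun u : Plane × Plane => symForm d a u.1 u.2) ((x₀, 0), (1, φ x₀)) ≠ 0) :
    deriv (fun y => webPoly d a x₀ y (φ x₀)) 0 ≠ 0 := by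
  set H : Plane × Plane → ℂ := fun u => symForm d a u.1 u.2 with hH
  set q : Plane × Plane := ((x₀, 0), (1, φ x₀)) with hq
  have hd : HasFDerivAt H (fderiv ℂ H q) q := (analyticAt_symForm ha _).differentiableAt.hasFDerivAt
  set Λ := fderiv ℂ H q with hΛ
  have hcurve : ∀ {γ : ℂ → Plane × Plane} {γ' : Plane × Plane} {t : ℂ}, HasDerivAt γ γ' t →
      γ t = q → HasDerivAt (fun s => H (γ s)) (Λ γ') t := fun {γ γ' t} hγ ht =>
    HasFDerivAt.comp_hasDerivAt (l := H) (f := γ) t (by rw [ht]; exact hd) hγ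
  have hval : ∀ z p, H (z, (1, p)) = (webPolynomial d a z).eval p := fun z p =>
    (webPolynomial_eval_eq_symForm p).symm
  have h0 := hroot.self_of_nhds
  have hc : ∀ {E : Type} [NormedAddCommGroup E] [NormedSpace ℂ E] (c : E) (t : ℂ),
      HasDerivAt (fun _ : ℂ => c) 0 t := fun c t => hasDerivAt_const t c
  -- homogeneity
  have e1 : Λ (0, (1, φ x₀)) = 0 := by
    have h1 := hcurve (γ := fun t : ℂ => (((x₀, 0) : Plane), ((t, t * φ x₀) : Plane)))
      ((hc ((x₀, 0) : Plane) 1).prodMk ((hasDerivAt_id' (1 : ℂ)).prodMk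
        ((hasDerivAt_id' (1 : ℂ)).mul_const (φ x₀)))) (by simp [hq])
    have h2 : (fun t : ℂ => H (((x₀, 0) : Plane), ((t, t * φ x₀) : Plane))) = fun _ => 0 := by
      funext t
      have : ((t, t * φ x₀) : Plane) = t • ((1, φ x₀) : Plane) := by ext <;> simp
      simp only [hH]
      rw [this, symForm_smul, ← webPolynomial_eval_eq_symForm, h0, mul_zero]
    rw [h2] at h1
    simpa using h1.unique (hasDerivAt_const _ _)
  -- The root is multiple.
  have e2 : Λ (0, (0, 1)) = 0 := by
    have h1 := hcurve (γ := fun p : ℂ => (((x₀, 0) : Plane), ((1, p) : Plane)))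
      ((hc ((x₀, 0) : Plane) (φ x₀)).prodMk ((hc (1 : ℂ) _).prodMk (hasDerivAt_id' (φ x₀)))) rfl
    simp only [hval] at h1
    exact (h1.unique ((webPolynomial d a (x₀, 0)).hasDerivAt _)).trans hdouble
  -- F vanishes along the curve x ↦ (x, 0, φ(x)).
  have e3 : Λ ((1, 0), (0, deriv φ x₀)) = 0 := by
    have h1 := hcurve (γ := fun x : ℂ => (((x, 0) : Plane), ((1, φ x) : Plane)))
      (((hasDerivAt_id' x₀).prodMk (hc (0 : ℂ) x₀)).prodMk
        ((hc (1 : ℂ) x₀).prodMk hφ.hasDerivAt)) rfl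
    simp only [hval] at h1
    exact h1.unique ((hasDerivAt_const x₀ (0 : ℂ)).congr_of_eventuallyEq hroot)
  have e4 : HasDerivAt (fun y => webPoly d a x₀ y (φ x₀)) (Λ ((0, 1), 0)) 0 := by
    have h1 := hcurve (γ := fun y : ℂ => (((x₀, y) : Plane), ((1, φ x₀) : Plane)))
      (((hc x₀ (0 : ℂ)).prodMk (hasDerivAt_id' (0 : ℂ))).prodMk (hc ((1, φ x₀) : Plane) (0 : ℂ))) rfl
    simpa only [hval, webPolynomial_eval] using h1
  rw [e4.deriv]
  intro e5
  refine hs (ContinuousLinearMap.ext fun u => ?_)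
  -- These four directions span the tangent space. Three are already killed, so vanishing of ∂F/∂y
  -- would make the whole differential zero.
  have hu : u = u.1.1 • (((1, 0), (0, deriv φ x₀)) : Plane × Plane) +
      u.1.2 • (((0, 1), 0) : Plane × Plane) + u.2.1 • ((0, (1, φ x₀)) : Plane × Plane) +
      (u.2.2 - u.1.1 * deriv φ x₀ - u.2.1 * φ x₀) • ((0, (0, 1)) : Plane × Plane) := by
    ext <;> simp
  change Λ u = 0
  rw [hu, map_add, map_add, map_add, map_smul, map_smul, map_smul, map_smul, e1, e2, e3, e5]
  simp

end

/-! ### Exterior derivative of a simple pole. -/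

section Pole

theorem eq_zero_of_mem_closure {X : Type*} [TopologicalSpace X] {Φ : X → ℂ} {T : Set X} {z : X}
    (hΦ : ContinuousAt Φ z) (hz : z ∈ closure T) (h : ∀ᶠ w in 𝓝 z, w ∈ T → Φ w = 0) : Φ z = 0 := by
  by_contra h0
  obtain ⟨w, h1, h2, h3⟩ := ((mem_closure_iff_frequently.1 hz).and_eventually
    (h.and (hΦ.eventually_ne h0))).exists
  exact h3 (h2 h1)

variable {η h : Plane → Plane →L[ℂ] ℂ} {A B : ℂ → ℂ} {x₀ : ℂ} {S : Set Plane}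

/-- The two coefficients appear at different pole orders in `y`, so they can be recovered separately
from the derivative. -/
theorem extd_pole {z : Plane} (hz : z.2 ≠ 0) (hA : DifferentiableAt ℂ A z.1)
    (hB : DifferentiableAt ℂ B z.1) (hh : DifferentiableAt ℂ h z)
    (hη : ∀ᶠ w in 𝓝 z, η w = h w + (1 / (6 * w.2)) • (A w.1 • dx + B w.1 • dy)) :
    extd η z = extd h z + 1 / 6 * (deriv B z.1 / z.2 + A z.1 / z.2 ^ 2) := by
  have hB' : HasFDerivAt (fun w : Plane => B w.1) (deriv B z.1 • dx) z :=
    HasDerivAt.comp_hasFDerivAt (h₂ := B) (f := Prod.fst) z hB.hasDerivAt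
      (hasFDerivAt_fst (𝕜 := ℂ) (p := z))
  have hA'' : HasFDerivAt (fun w : Plane => A w.1) (deriv A z.1 • dx) z :=
    HasDerivAt.comp_hasFDerivAt (h₂ := A) (f := Prod.fst) z hA.hasDerivAt
      (hasFDerivAt_fst (𝕜 := ℂ) (p := z))
  have hα : HasFDerivAt (fun w : Plane => A w.1 • dx + B w.1 • dy)
      ((deriv A z.1 • dx).smulRight dx + (deriv B z.1 • dx).smulRight dy) z :=
    (hA''.smul_const dx).fun_add (hB'.smul_const dy)
  have hu : HasFDerivAt (fun w : Plane => 1 / (6 * w.2)) ((-(1 / (6 * z.2 ^ 2))) • dy) z := by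
    have h1 : HasDerivAt (fun y : ℂ => 1 / (6 * y)) (-(1 / (6 * z.2 ^ 2))) z.2 := by
      have := ((hasDerivAt_id' z.2).const_mul (6 : ℂ)).fun_inv (mul_ne_zero (by norm_num) hz)
      simp only [one_div]
      refine this.congr_deriv ?_
      field_simp
    exact HasDerivAt.comp_hasFDerivAt (h₂ := fun y : ℂ => 1 / (6 * y)) (f := Prod.snd) z h1
      (hasFDerivAt_snd (𝕜 := ℂ) (p := z))
  rw [extd_congr hη, extd_add hh (hu.differentiableAt.fun_smul hα.differentiableAt),
    extd_smul hu.differentiableAt hα.differentiableAt, hu.fderiv]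
  simp only [extd, hα.fderiv, wedge]
  simp
  field_simp
  ring

/-- Clearing denominators gives 6y²(k - dh) - y B' - A = 0 off `S`, hence everywhere by density.
Setting y = 0 gives A = 0; dividing by `y` and setting y = 0 again gives B' = 0. -/
theorem residue_eq_zero_of_extendsAt (hA : AnalyticAt ℂ A x₀) (hB : AnalyticAt ℂ B x₀)
    (hh : AnalyticAt ℂ h (x₀, 0))
    (hη : ∀ᶠ z in 𝓝 ((x₀, 0) : Plane), z ∉ S → z.2 ≠ 0 ∧
      ∀ᶠ w in 𝓝 z, η w = h w + (1 / (6 * w.2)) • (A w.1 • dx + B w.1 • dy))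
    (hS : ∀ᶠ z in 𝓝 ((x₀, 0) : Plane), z ∈ closure Sᶜ)
    (hext : ExtendsAt S (extd η) (x₀, 0)) :
    (∀ᶠ x in 𝓝 x₀, A x = 0) ∧ ∀ᶠ x in 𝓝 x₀, deriv B x = 0 := by
  obtain ⟨k, hk, hkeq⟩ := hext
  have hc : ContinuousAt (fun x : ℂ => ((x, 0) : Plane)) x₀ := by fun_prop
  have hfst : ContinuousAt (Prod.fst : Plane → ℂ) (x₀, 0) := continuousAt_fst
  have hcA : ∀ᶠ z in 𝓝 ((x₀, 0) : Plane), ContinuousAt (fun z : Plane => A z.1) z :=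
    (hfst.eventually hA.eventually_analyticAt).mono fun z hz =>
      ContinuousAt.comp (g := A) hz.continuousAt continuousAt_fst
  have hcB : ∀ᶠ z in 𝓝 ((x₀, 0) : Plane), ContinuousAt (fun z : Plane => deriv B z.1) z :=
    (hfst.eventually hB.deriv.eventually_analyticAt).mono fun z hz =>
      ContinuousAt.comp (g := deriv B) hz.continuousAt continuousAt_fst
  have hdh := extd_analyticAt hh
  have hck : ∀ᶠ z in 𝓝 ((x₀, 0) : Plane), ContinuousAt (fun z => k z - extd h z) z :=
    (hk.fun_sub hdh).eventually_analyticAt.mono fun z hz => hz.continuousAt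
  have hzero : ∀ᶠ z in 𝓝 ((x₀, 0) : Plane), z ∉ S →
      6 * z.2 ^ 2 * (k z - extd h z) - z.2 * deriv B z.1 - A z.1 = 0 := by
    filter_upwards [hkeq, hη, hfst.eventually hA.eventually_analyticAt,
      hfst.eventually hB.eventually_analyticAt, hh.eventually_analyticAt] with z h1 h2 h3 h4 h5 hz
    obtain ⟨hy, h6⟩ := h2 hz
    rw [← h1 hz, extd_pole hy h3.differentiableAt h4.differentiableAt h5.differentiableAt h6]
    field_simp
    ring
  have hall : ∀ᶠ z in 𝓝 ((x₀, 0) : Plane),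
      6 * z.2 ^ 2 * (k z - extd h z) - z.2 * deriv B z.1 - A z.1 = 0 := by
    filter_upwards [hzero.eventually_nhds, hS, hcA, hcB, hck] with z h1 h2 h3 h4 h5
    exact eq_zero_of_mem_closure (Φ := fun z : Plane =>
      6 * z.2 ^ 2 * (k z - extd h z) - z.2 * deriv B z.1 - A z.1)
      (((ContinuousAt.fun_mul (by fun_prop) h5).fun_sub
        (ContinuousAt.fun_mul (by fun_prop) h4)).fun_sub h3) h2 h1
  have hA0 : ∀ᶠ x in 𝓝 x₀, A x = 0 := by
    filter_upwards [hc.eventually hall] with x hx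
    simpa using hx
  refine ⟨hA0, ?_⟩
  have hB0 : ∀ᶠ z in 𝓝 ((x₀, 0) : Plane), z ∈ {z : Plane | z.2 ≠ 0} →
      6 * z.2 * (k z - extd h z) - deriv B z.1 = 0 := by
    filter_upwards [hall, hfst.eventually hA0] with z h1 h2 hz
    rw [h2, sub_zero] at h1
    refine (mul_eq_zero.1 (?_ : z.2 * _ = 0)).resolve_left hz
    linear_combination h1
  filter_upwards [hc.eventually hB0.eventually_nhds, hc.eventually hcB, hc.eventually hck]
    with x h1 h2 h3
  have hcl : ((x, 0) : Plane) ∈ closure {z : Plane | z.2 ≠ 0} := by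
    rw [mem_closure_iff_frequently]
    have : Tendsto (fun y : ℂ => ((x, y) : Plane)) (𝓝[≠] 0) (𝓝 (x, 0)) :=
      ((by fun_prop : ContinuousAt (fun y : ℂ => ((x, y) : Plane)) 0).tendsto).mono_left
        nhdsWithin_le_nhds
    have h0 : ∀ᶠ y in 𝓝[≠] (0 : ℂ), y ≠ 0 := eventually_mem_nhdsWithin
    exact this.frequently h0.frequently
  have := eq_zero_of_mem_closure (Φ := fun z : Plane =>
      6 * z.2 * (k z - extd h z) - deriv B z.1)
    ((ContinuousAt.fun_mul (by fun_prop) h3).fun_sub h2) hcl h1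
  simpa using this

theorem extendsAt_of_residue_eq_zero (hA : AnalyticAt ℂ A x₀) (hB : AnalyticAt ℂ B x₀)
    (hh : AnalyticAt ℂ h (x₀, 0))
    (hη : ∀ᶠ z in 𝓝 ((x₀, 0) : Plane), z ∉ S → z.2 ≠ 0 ∧
      ∀ᶠ w in 𝓝 z, η w = h w + (1 / (6 * w.2)) • (A w.1 • dx + B w.1 • dy))
    (hA0 : ∀ᶠ x in 𝓝 x₀, A x = 0) (hB0 : ∀ᶠ x in 𝓝 x₀, deriv B x = 0) :
    ExtendsAt S (extd η) (x₀, 0) := by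
  have hfst : ContinuousAt (Prod.fst : Plane → ℂ) (x₀, 0) := continuousAt_fst
  refine ⟨extd h, extd_analyticAt hh, ?_⟩
  filter_upwards [hη, hfst.eventually hA.eventually_analyticAt, hfst.eventually hA0,
    hfst.eventually hB.eventually_analyticAt, hfst.eventually hB0, hh.eventually_analyticAt]
    with z h2 h3 h3' h4 h4' h5 hz
  obtain ⟨hy, h6⟩ := h2 hz
  rw [extd_pole hy h3.differentiableAt h4.differentiableAt h5.differentiableAt h6, h3', h4']
  simp

end Pole

end PlanarWeb
end

/-! ### Equimultiple points and the components of the residue. -/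

noncomputable section

namespace PlanarWeb

section

open Polynomial

variable {d : ℕ} {a : ℕ → Plane → ℂ} {n : ℕ} {φ : Fin n → ℂ → ℂ} {ν : Fin n → ℕ} {x x₀ : ℂ}

/-- The polynomial `∂F/∂y`. -/
def webPolynomialY (d : ℕ) (a : ℕ → Plane → ℂ) : Plane → ℂ[X] :=
  webPolynomial d fun k w => fderiv ℂ (a k) w (0, 1)

theorem deriv_webPoly_eq_eval (ha : ∀ k, DifferentiableAt ℂ (a k) (x, 0)) (p : ℂ) :
    deriv (fun y => webPoly d a x y p) 0 = (webPolynomialY d a (x, 0)).eval p := by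
  have h1 : ∀ k, HasDerivAt (fun y => a k (x, y)) (fderiv ℂ (a k) (x, 0) (0, 1)) 0 := fun k =>
    HasFDerivAt.comp_hasDerivAt (l := a k) (f := fun y : ℂ => (x, y)) 0 (ha k).hasFDerivAt
      ((hasDerivAt_const (0 : ℂ) x).prodMk (hasDerivAt_id' 0))
  rw [webPolynomialY, webPolynomial_eval_eq_sum]
  exact (HasDerivAt.fun_sum fun k _ => (h1 k).mul_const _).deriv

theorem deriv_deriv_webPoly_eq_eval (ha : ∀ k, DifferentiableAt ℂ (a k) (x, 0)) (p : ℂ) :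
    deriv (fun p => deriv (fun y => webPoly d a x y p) 0) p =
      (webPolynomialY d a (x, 0)).derivative.eval p := by
  simp only [deriv_webPoly_eq_eval ha]
  exact Polynomial.deriv _

theorem analyticFamily_webPolynomialY {z : Plane} (ha : ∀ k, AnalyticAt ℂ (a k) z) :
    AnalyticFamily (webPolynomialY d a) z :=
  analyticFamily_webPolynomial fun k => (ha k).fderiv.clm_apply_const _

theorem AnalyticFamily.analyticAt_eval_slice {Q : Plane → ℂ[X]} {f : ℂ → ℂ}
    (hQ : AnalyticFamily Q (x, 0)) (hf : AnalyticAt ℂ f x) :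
    AnalyticAt ℂ (fun x => (Q (x, 0)).eval (f x)) x :=
  AnalyticAt.fun_comp (g := fun q : Plane × ℂ => (Q q.1).eval q.2)
    (f := fun x => (((x, 0) : Plane), f x)) (hQ.eval _)
    ((analyticAt_id.prod analyticAt_const).prod hf)

theorem analyticAt_slice {f : Plane → ℂ} (hf : AnalyticAt ℂ f (x, 0)) :
    AnalyticAt ℂ (fun x => f (x, 0)) x :=
  AnalyticAt.fun_comp (g := f) (f := fun x => ((x, 0) : Plane)) hf
    (analyticAt_id.prod analyticAt_const)

/-- Conditions on the equation of a web under which the roots of `F(x, 0, p)` keep their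
multiplicities near `x₀` and the multiple ones are simple zeros of `F` in the direction of `y`. -/
structure EquimultipleAt (d : ℕ) (a : ℕ → Plane → ℂ) {n : ℕ} (φ : Fin n → ℂ → ℂ)
    (ν : Fin n → ℕ) (x₀ : ℂ) : Prop where
  analyticAt_coeff : ∀ᶠ z in 𝓝 ((x₀, 0) : Plane), ∀ k, AnalyticAt ℂ (a k) z
  leading_ne_zero : a 0 (x₀, 0) ≠ 0
  analyticAt_root : ∀ α, AnalyticAt ℂ (φ α) x₀
  root_ne : ∀ α β, α ≠ β → φ α x₀ ≠ φ β x₀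
  factorization : ∀ᶠ x in 𝓝 x₀, webPolynomial d a (x, 0) =
    C (a 0 (x, 0)) * ∏ α, (X - C (φ α x)) ^ ν α
  transverse : ∀ α, 2 ≤ ν α → deriv (fun y => webPoly d a x₀ y (φ α x₀)) 0 ≠ 0

theorem analyticAt_deriv_webPoly {f : ℂ → ℂ}
    (ha : ∀ᶠ z in 𝓝 ((x₀, 0) : Plane), ∀ k, AnalyticAt ℂ (a k) z) (hf : AnalyticAt ℂ f x₀) :
    AnalyticAt ℂ (fun x => deriv (fun y => webPoly d a x y (f x)) 0) x₀ := by
  have hc : ContinuousAt (fun x : ℂ => ((x, 0) : Plane)) x₀ := by fun_prop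
  refine ((analyticFamily_webPolynomialY (d := d) ha.self_of_nhds).analyticAt_eval_slice hf).congr ?_
  filter_upwards [hc.eventually ha] with x hx
  exact (deriv_webPoly_eq_eval (fun k => (hx k).differentiableAt) _).symm

theorem analyticAt_deriv_deriv_webPoly {f : ℂ → ℂ}
    (ha : ∀ᶠ z in 𝓝 ((x₀, 0) : Plane), ∀ k, AnalyticAt ℂ (a k) z) (hf : AnalyticAt ℂ f x₀) :
    AnalyticAt ℂ (fun x => deriv (fun p => deriv (fun y => webPoly d a x y p) 0) (f x)) x₀ := by
  have hc : ContinuousAt (fun x : ℂ => ((x, 0) : Plane)) x₀ := by fun_prop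
  refine ((analyticFamily_webPolynomialY (d := d)
    ha.self_of_nhds).derivative.analyticAt_eval_slice hf).congr ?_
  filter_upwards [hc.eventually ha] with x hx
  exact (deriv_deriv_webPoly_eq_eval (fun k => (hx k).differentiableAt) _).symm

/-- Neither distinctness of the roots nor transversality at `x₀` is required, so this holds on all
of V and makes the identity theorem applicable there. -/
theorem meromorphicAt_psi (ha : ∀ᶠ z in 𝓝 ((x₀, 0) : Plane), ∀ k, AnalyticAt ℂ (a k) z)
    (hφ : ∀ α, AnalyticAt ℂ (φ α) x₀) (α : Fin n) : MeromorphicAt (psi d a φ ν α) x₀ := by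
  have h1 := (analyticAt_deriv_webPoly (d := d) ha (hφ α)).meromorphicAt
  have h2 := (analyticAt_deriv_deriv_webPoly (d := d) ha (hφ α)).meromorphicAt
  have h3 := fun β => (hφ β).meromorphicAt
  have h4 : MeromorphicAt (fun x => ∑ β ∈ Finset.univ.erase α,
      (ν β : ℂ) * φ β x / (φ α x - φ β x)) x₀ :=
    MeromorphicAt.fun_sum fun β _ =>
      ((MeromorphicAt.const (ν β : ℂ) x₀).fun_mul (h3 β)).fun_div ((h3 α).fun_sub (h3 β))
  unfold psi
  exact (MeromorphicAt.const _ x₀).fun_mul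
    (((MeromorphicAt.const _ x₀).fun_mul ((MeromorphicAt.const _ x₀).fun_sub
      ((h3 α).fun_mul (h2.fun_div h1)))).fun_sub ((MeromorphicAt.const _ x₀).fun_mul h4))

/-- The `dx`-component of the residue. -/
def residueX (d : ℕ) (a : ℕ → Plane → ℂ) {n : ℕ} (φ : Fin n → ℂ → ℂ) (ν : Fin n → ℕ) (x : ℂ) : ℂ :=
  -∑ α, ((ν α : ℂ) - 1) * φ α x * psi d a φ ν α x

/-- The `dy`-component of the residue. -/
def residueY (d : ℕ) (a : ℕ → Plane → ℂ) {n : ℕ} (φ : Fin n → ℂ → ℂ) (ν : Fin n → ℕ) (x : ℂ) : ℂ :=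
  ∑ α, ((ν α : ℂ) - 1) * (psi d a φ ν α x + ((ν α : ℂ) - 2))

theorem residue_eq : residue d a φ ν x = residueX d a φ ν x • dx + residueY d a φ ν x • dy := by
  apply clm_ext
  · simp only [residue, residueX]
    simp
    exact Finset.sum_congr rfl fun α _ => by ring
  · simp [residue, residueY]
    simp only [mul_add]

/-- For a simple root the coefficient ν - 1 vanishes, so `psi` need not be analytic there. -/
theorem coeff_mul_analyticAt (hν : ∀ α, 1 ≤ ν α) (α : Fin n) {f g : ℂ → ℂ}
    (hf : AnalyticAt ℂ f x₀) (h : 2 ≤ ν α → AnalyticAt ℂ g x₀) :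
    AnalyticAt ℂ (fun x => ((ν α : ℂ) - 1) * f x * g x) x₀ := by
  by_cases hα : 2 ≤ ν α
  · exact (analyticAt_const.fun_mul hf).fun_mul (h hα)
  · have : ν α = 1 := le_antisymm (by omega) (hν α)
    simp only [this, Nat.cast_one, sub_self, zero_mul]
    exact analyticAt_const

namespace EquimultipleAt

variable (h : EquimultipleAt d a φ ν x₀) (hd : 0 < d) (hν : ∀ α, 1 ≤ ν α)
include h hd hν

theorem analyticAt_psi (α : Fin n) (hα : 2 ≤ ν α) : AnalyticAt ℂ (psi d a φ ν α) x₀ :=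
  (exists_analyticAt_sub_residue hd h.analyticAt_coeff h.leading_ne_zero h.analyticAt_root hν
    h.root_ne h.factorization h.transverse).1 α hα

theorem analyticAt_residueX : AnalyticAt ℂ (residueX d a φ ν) x₀ :=
  (Finset.analyticAt_fun_sum _ fun α _ =>
    coeff_mul_analyticAt hν α (h.analyticAt_root α) (h.analyticAt_psi hd hν α)).fun_neg

theorem analyticAt_residueY : AnalyticAt ℂ (residueY d a φ ν) x₀ := by
  refine Finset.analyticAt_fun_sum _ fun α _ => ?_
  simpa using coeff_mul_analyticAt hν α (f := fun _ => 1) (g := fun x => psi d a φ ν α x + _)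
    analyticAt_const fun hα => (h.analyticAt_psi hd hν α hα).fun_add analyticAt_const

theorem deriv_residueY :
    deriv (residueY d a φ ν) x₀ = ∑ α, ((ν α : ℂ) - 1) * deriv (psi d a φ ν α) x₀ := by
  refine (HasDerivAt.fun_sum fun α _ => ?_).deriv
  by_cases hα : 2 ≤ ν α
  · exact ((h.analyticAt_psi hd hν α hα).differentiableAt.hasDerivAt.add_const _).const_mul _
  · have : ν α = 1 := le_antisymm (by omega) (hν α)
    simp only [this, Nat.cast_one, sub_self, zero_mul]
    exact hasDerivAt_const _ _

end EquimultipleAt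

end

/-! ### Local equations of the web. -/

namespace Web

variable {d : ℕ} {ι M : Type*} [TopologicalSpace M] [ChartedSpace Plane M]
  {e : OpenPartialHomeomorph M Plane} (W : Web d ι M)

/-- Near `z`, the symmetric form `∑ k, a k (dx)^k (dy)^(d-k)` is a holomorphic unit times the
`i`-th form defining `W`. -/
structure IsEquationAt (e : OpenPartialHomeomorph M Plane) (a : ℕ → Plane → ℂ) (i : ι)
    (z : Plane) : Prop where
  mem_target : z ∈ e.target
  mem_dom : e.symm z ∈ W.dom i
  analyticAt_coeff : ∀ᶠ w in 𝓝 z, ∀ k, AnalyticAt ℂ (a k) w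
  exists_unit : ∃ g : Plane → ℂ, AnalyticAt ℂ g z ∧ g z ≠ 0 ∧
    ∀ᶠ w in 𝓝 z, ∀ v, symForm d a w v = g w * localExpr (W.form i) e w v

variable {W} {a : ℕ → Plane → ℂ} {i : ι} {z : Plane}

theorem IsEquation.isEquationAt (h : W.IsEquation e a) (hz : z ∈ e.target)
    (hi : e.symm z ∈ W.dom i) : W.IsEquationAt e a i z := by
  obtain ⟨g, h1, h2⟩ := h.2 i
  refine ⟨hz, hi, ?_, g, h1 z ⟨hz, hi⟩, (h2 z ⟨hz, hi⟩).1, ?_⟩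
  · filter_upwards [e.open_target.eventually_mem hz] with w hw k using h.1 k w hw
  · filter_upwards [eventually_chart_mem hz (W.isOpen_dom i) hi] with w hw
    exact (h2 w hw).2

theorem isEquationAt_of_holomorphic
    (h1 : ∀ k, AnalyticOnNhd ℂ (a k) (e.target ∩ e.symm ⁻¹' W.dom i))
    (h2 : ∀ z ∈ e.target ∩ e.symm ⁻¹' W.dom i, ∀ v, localExpr (W.form i) e z v = symForm d a z v)
    (hz : z ∈ e.target) (hi : e.symm z ∈ W.dom i) : W.IsEquationAt e a i z := by
  refine ⟨hz, hi, ?_, fun _ => 1, analyticAt_const, one_ne_zero, ?_⟩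
  · filter_upwards [eventually_chart_mem hz (W.isOpen_dom i) hi] with w hw k using h1 k w hw
  · filter_upwards [eventually_chart_mem hz (W.isOpen_dom i) hi] with w hw v
    rw [one_mul, h2 w hw]

namespace IsEquationAt

variable (h : W.IsEquationAt e a i z)
include h

theorem eventually : ∀ᶠ w in 𝓝 z, W.IsEquationAt e a i w := by
  obtain ⟨g, hg, hg0, hgeq⟩ := h.exists_unit
  filter_upwards [eventually_chart_mem h.mem_target (W.isOpen_dom i) h.mem_dom,
    h.analyticAt_coeff.eventually_nhds, hg.eventually_analyticAt, hg.continuousAt.eventually_ne hg0,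
    hgeq.eventually_nhds] with w e1 e2 e3 e4 e5
  exact ⟨e1.1, e1.2, e2, g, e3, e4, e5⟩

theorem splitsDistinct (hd : 0 < d) (he : e ∈ IsManifold.maximalAtlas 𝓘(ℂ, Plane) ω M)
    (hz : z ∉ W.discrIn e) : SplitsDistinct d (symForm d a z) := by
  obtain ⟨g, hg, hg0, hgeq⟩ := h.exists_unit
  rw [funext hgeq.self_of_nhds]
  exact ((splitsDistinct_localExpr_iff (W.form i) he h.mem_target).2
    (W.splitsDistinct_of_notMem hz h.mem_dom)).mul hd hg0

theorem eventually_notMem [IsManifold 𝓘(ℂ, Plane) ω M] (hd : 2 ≤ d) (hz : z ∉ W.discrIn e) :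
    ∀ᶠ w in 𝓝 z, w ∉ W.discrIn e :=
  (eventually_chart_mem h.mem_target (W.isClosed_discriminant hd).isOpen_compl hz).mono
    fun _ hw => hw.2

theorem mem_closure_compl_discrIn [IsManifold 𝓘(ℂ, Plane) ω M] (hd : 2 ≤ d) :
    z ∈ closure (W.discrIn e)ᶜ := by
  have h1 := mem_closure_iff_frequently.1 (W.dense_compl_discriminant hd (e.symm z))
  have h2 : Tendsto e (𝓝 (e.symm z)) (𝓝 z) := by
    simpa [h.mem_target] using (e.continuousAt (e.map_target h.mem_target)).tendsto
  have h3 : ∃ᶠ m in 𝓝 (e.symm z), e m ∈ (W.discrIn e)ᶜ := by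
    refine (h1.and_eventually (e.open_source.eventually_mem (e.map_target h.mem_target))).mono ?_
    rintro m ⟨hm1, hm2⟩ hm3
    rw [discrIn, Set.mem_preimage, e.left_inv hm2] at hm3
    exact hm1 hm3
  exact mem_closure_iff_frequently.2 (h2.frequently h3)

theorem curvature_eq [IsManifold 𝓘(ℂ, Plane) ω M] (hd : 2 ≤ d)
    (he : e ∈ IsManifold.maximalAtlas 𝓘(ℂ, Plane) ω M) (hz : z ∉ W.discrIn e) :
    curvature d (symForm d a) z = curvature d (localExpr (W.form i) e) z := by
  obtain ⟨g, hg, hg0, hgeq⟩ := h.exists_unit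
  exact (W.locallySplits hd he h.mem_target hz h.mem_dom).curvature_mul (by omega) hg hg0 hgeq

theorem extendsAt_curvature_iff [IsManifold 𝓘(ℂ, Plane) ω M] (hd : 2 ≤ d)
    (he : e ∈ IsManifold.maximalAtlas 𝓘(ℂ, Plane) ω M) :
    ExtendsAt (W.discrIn e) (curvature d (symForm d a)) z ↔
      ExtendsAt (W.discrIn e) (curvature d (localExpr (W.form i) e)) z := by
  refine exists_congr fun k => and_congr_right fun _ => ?_
  refine eventually_congr (h.eventually.mono fun w hw => imp_congr_right fun hwd => ?_)
  rw [hw.curvature_eq hd he hwd]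

/-- Smoothness is a hypothesis on the defining forms, and at a zero a unit only rescales the
differential. -/
theorem fderiv_symForm_ne_zero (he : e ∈ IsManifold.maximalAtlas 𝓘(ℂ, Plane) ω M)
    (hs : W.SmoothOver (e.symm z)) {v : Plane} (hv : v ≠ 0) (h0 : symForm d a z v = 0) :
    fderiv ℂ (fun u : Plane × Plane => symForm d a u.1 u.2) (z, v) ≠ 0 := by
  obtain ⟨g, hg, hg0, hgeq⟩ := h.exists_unit
  have hes : e (e.symm z) = z := e.right_inv h.mem_target
  have h1 : localExpr (W.form i) e z v = 0 := by
    rw [hgeq.self_of_nhds] at h0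
    exact (mul_eq_zero.1 h0).resolve_left hg0
  have h2 := hs e he (e.map_target h.mem_target) i h.mem_dom v hv (by rwa [hes])
  rw [hes] at h2
  intro h3
  refine h2 ?_
  have hfst : ContinuousAt (Prod.fst : Plane × Plane → Plane) (z, v) := continuousAt_fst
  have hsym := (analyticAt_symForm (d := d) h.analyticAt_coeff.self_of_nhds v).differentiableAt
  have hginv : DifferentiableAt ℂ (fun u : Plane × Plane => (g u.1)⁻¹) (z, v) :=
    DifferentiableAt.fun_comp' (g := fun w => (g w)⁻¹) (f := Prod.fst) ((z, v) : Plane × Plane)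
      (hg.fun_inv hg0).differentiableAt differentiableAt_fst
  have h4 : (fun u : Plane × Plane => localExpr (W.form i) e u.1 u.2) =ᶠ[𝓝 (z, v)]
      fun u => (g u.1)⁻¹ * symForm d a u.1 u.2 := by
    filter_upwards [hfst.eventually hgeq, hfst.eventually (hg.continuousAt.eventually_ne hg0)]
      with u u1 u2
    rw [u1, inv_mul_cancel_left₀ u2]
  have h5 := (hginv.hasFDerivAt.mul hsym.hasFDerivAt).congr_of_eventuallyEq h4
  rw [h5.fderiv, h3, h0]
  refine ContinuousLinearMap.ext fun u => ?_
  change (g z)⁻¹ * (0 : ℂ) + 0 * _ = (0 : ℂ)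
  ring

end IsEquationAt

end Web

end PlanarWeb
end

/-! ### Polar part and curvature at equimultiple points. -/

noncomputable section

namespace PlanarWeb

namespace Web

open Polynomial

variable {d : ℕ} {ι M : Type*} [TopologicalSpace M] [ChartedSpace Plane M]
  {e : OpenPartialHomeomorph M Plane} {W : Web d ι M} {a : ℕ → Plane → ℂ} {i j : ι} {x₀ : ℂ}
  {n : ℕ} {φ : Fin n → ℂ → ℂ} {ν : Fin n → ℕ}

theorem IsEquationAt.congr_index {z : Plane} (h : W.IsEquationAt e a i z)
    (he : e ∈ IsManifold.maximalAtlas 𝓘(ℂ, Plane) ω M) (hj : e.symm z ∈ W.dom j) :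
    W.IsEquationAt e a j z := by
  obtain ⟨g, hg, hg0, hgeq⟩ := h.exists_unit
  obtain ⟨g', hg', hg0', hgeq'⟩ := W.exists_localExpr_eq_mul he h.mem_target h.mem_dom hj
  refine ⟨h.mem_target, hj, h.analyticAt_coeff, fun w => g w * g' w, hg.fun_mul hg',
    mul_ne_zero hg0 hg0', ?_⟩
  filter_upwards [hgeq, hgeq'] with w h1 h2 v
  rw [h1, h2, mul_assoc]

/-- At a point over which the characteristic surface is smooth, the multiple roots are simple zeros
of `F` in the direction of `y`. -/
theorem IsEquationAt.equimultipleAt (h : W.IsEquationAt e a i (x₀, 0))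
    (he : e ∈ IsManifold.maximalAtlas 𝓘(ℂ, Plane) ω M) (hs : W.SmoothOver (e.symm (x₀, 0)))
    (h0 : a 0 (x₀, 0) ≠ 0) (hφ : ∀ α, AnalyticAt ℂ (φ α) x₀)
    (hne : ∀ α β, α ≠ β → φ α x₀ ≠ φ β x₀)
    (hfac : ∀ᶠ x in 𝓝 x₀, webPolynomial d a (x, 0) =
      C (a 0 (x, 0)) * ∏ α, (X - C (φ α x)) ^ ν α) : EquimultipleAt d a φ ν x₀ := by
  refine ⟨h.analyticAt_coeff, h0, hφ, hne, hfac, fun α hα => ?_⟩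
  -- Divisibility by the square gives both the vanishing of F along φ_α and that of its derivative
  -- in p.
  have hdvd : ∀ x, (X - C (φ α x)) ^ 2 ∣ C (a 0 (x, 0)) * ∏ α, (X - C (φ α x)) ^ ν α := fun x =>
    ((pow_dvd_pow _ hα).trans (Finset.dvd_prod_of_mem (fun α => (X - C (φ α x)) ^ ν α)
      (Finset.mem_univ α))).trans (dvd_mul_left _ _)
  have hroot : ∀ᶠ x in 𝓝 x₀, (webPolynomial d a (x, 0)).eval (φ α x) = 0 := by
    filter_upwards [hfac] with x hx
    rw [hx]
    exact eval_eq_zero_of_dvd_of_eval_eq_zero (hdvd x) (by simp)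
  have hdouble : (webPolynomial d a (x₀, 0)).derivative.eval (φ α x₀) = 0 := by
    rw [hfac.self_of_nhds]
    obtain ⟨q, hq⟩ := hdvd x₀
    rw [hq]
    simp [derivative_mul, derivative_pow]
  refine deriv_webPoly_ne_zero_of_smooth h.analyticAt_coeff.self_of_nhds (hφ α).differentiableAt
    hroot hdouble (h.fderiv_symForm_ne_zero he hs (by simp) ?_)
  rw [← webPolynomial_eval_eq_symForm, hroot.self_of_nhds]

variable (hd : 2 ≤ d) (he : e ∈ IsManifold.maximalAtlas 𝓘(ℂ, Plane) ω M)
  (hν : ∀ α, 1 ≤ ν α) (h : W.IsEquationAt e a i (x₀, 0)) (hF : EquimultipleAt d a φ ν x₀)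
include hd he hν h hF

/-- Off the discriminant the form splits into independent factors, so the roots of F are simple and
the local theorem applies. -/
theorem exists_fundamentalForm_sub_residue :
    ∃ k : Plane → Plane →L[ℂ] ℂ, AnalyticAt ℂ k (x₀, 0) ∧ ∀ᶠ z in 𝓝 ((x₀, 0) : Plane),
      z ∉ W.discrIn e → fundamentalForm d (symForm d a) z -
        (1 / (6 * z.2)) • residue d a φ ν z.1 = k z := by
  obtain ⟨-, k, hk, hkeq⟩ := exists_analyticAt_sub_residue (by omega) hF.analyticAt_coeff
    hF.leading_ne_zero hF.analyticAt_root hν hF.root_ne hF.factorization hF.transverse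
  refine ⟨k, hk, ?_⟩
  filter_upwards [hkeq, h.eventually, (h.analyticAt_coeff.self_of_nhds 0).continuousAt.eventually_ne
    hF.leading_ne_zero] with z h1 h2 h3 h4
  exact h1 (webPolynomial_nodup_of_splitsDistinct h3 (h2.splitsDistinct (by omega) he h4))

variable [IsManifold 𝓘(ℂ, Plane) ω M]
  (hΔ : ∀ᶠ z in 𝓝 ((x₀, 0) : Plane), z.2 = 0 → z ∈ W.discrIn e)
include hΔ

/-- Near an equimultiple point, the fundamental form has at most a simple pole. -/
theorem extendsAt_smul_fundamentalForm (hj : e.symm (x₀, 0) ∈ W.dom j) :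
    ExtendsAt (W.discrIn e) (fun z => z.2 • fundamentalForm d (localExpr (W.form j) e) z)
      (x₀, 0) := by
  have hE := h.congr_index he hj
  obtain ⟨k, hk, hkeq⟩ := exists_fundamentalForm_sub_residue hd he hν h hF
  obtain ⟨g, hg, hg0, hgeq⟩ := hE.exists_unit
  have hres : AnalyticAt ℂ (fun z : Plane => residue d a φ ν z.1) (x₀, 0) := by
    simp only [residue_eq]
    have h1 : AnalyticAt ℂ (fun z : Plane => residueX d a φ ν z.1) (x₀, 0) :=
      AnalyticAt.fun_comp (g := residueX d a φ ν) (f := Prod.fst)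
        (hF.analyticAt_residueX (by omega) hν) analyticAt_fst
    have h2 : AnalyticAt ℂ (fun z : Plane => residueY d a φ ν z.1) (x₀, 0) :=
      AnalyticAt.fun_comp (g := residueY d a φ ν) (f := Prod.fst)
        (hF.analyticAt_residueY (by omega) hν) analyticAt_fst
    exact (h1.fun_smul analyticAt_const).fun_add (h2.fun_smul analyticAt_const)
  -- Passing from the equation to the `j`-th defining form costs a multiple of dg/g, which is
  -- holomorphic and does not affect the pole.
  have hdl : AnalyticAt ℂ (fun z => unitWeight (⟨0, by omega⟩ : Fin d) •
      ((g z)⁻¹ • fderiv ℂ g z)) (x₀, 0) :=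
    analyticAt_const.fun_smul ((hg.fun_inv hg0).fun_smul hg.fderiv)
  refine ⟨fun z => z.2 • (k z - unitWeight (⟨0, by omega⟩ : Fin d) • ((g z)⁻¹ • fderiv ℂ g z)) +
    (1 / 6 : ℂ) • residue d a φ ν z.1, ((analyticAt_snd.fun_smul (hk.fun_sub hdl)).fun_add
      (analyticAt_const.fun_smul hres)), ?_⟩
  filter_upwards [hkeq, hE.eventually, hg.eventually_analyticAt, hg.continuousAt.eventually_ne hg0,
    hgeq.eventually_nhds, hΔ] with z h1 h2 h3 h4 h5 h6 h7
  have h8 : z.2 ≠ 0 := fun h8 => h7 (h6 h8)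
  have h9 := ((W.locallySplits hd he h2.mem_target h7 h2.mem_dom).isFundamentalFormAt.mul
    ⟨0, by omega⟩ h3 h4 h5).fundamentalForm_eq
  rw [← h1 h7, h9]
  have h10 : (1 / 6 : ℂ) • residue d a φ ν z.1 =
      z.2 • ((1 / (6 * z.2)) • residue d a φ ν z.1) := by
    rw [smul_smul]
    congr 1
    field_simp
  rw [h10]
  module

/-- Near an equimultiple point, the curvature is holomorphic if and only if the exterior
derivative of the polar part of the fundamental form vanishes. -/
theorem extendsAt_curvature_iff_residue :
    ExtendsAt (W.discrIn e) (curvature d (symForm d a)) (x₀, 0) ↔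
      (∀ᶠ x in 𝓝 x₀, residueX d a φ ν x = 0) ∧ ∀ᶠ x in 𝓝 x₀, deriv (residueY d a φ ν) x = 0 := by
  obtain ⟨k, hk, hkeq⟩ := exists_fundamentalForm_sub_residue hd he hν h hF
  have hX := hF.analyticAt_residueX (by omega) hν
  have hY := hF.analyticAt_residueY (by omega) hν
  have hη : ∀ᶠ z in 𝓝 ((x₀, 0) : Plane), z ∉ W.discrIn e → z.2 ≠ 0 ∧
      ∀ᶠ w in 𝓝 z, fundamentalForm d (symForm d a) w = k w +
        (1 / (6 * w.2)) • (residueX d a φ ν w.1 • dx + residueY d a φ ν w.1 • dy) := by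
    filter_upwards [hkeq.eventually_nhds, h.eventually, hΔ] with z h1 h2 h3 h4
    refine ⟨fun h5 => h4 (h3 h5), ?_⟩
    filter_upwards [h1, h2.eventually_notMem hd h4] with w h5 h6
    rw [← h5 h6, ← residue_eq]
    exact (sub_add_cancel _ _).symm
  refine ⟨fun hext => residue_eq_zero_of_extendsAt hX hY hk hη
    (h.eventually.mono fun z hz => hz.mem_closure_compl_discrIn hd) hext, fun ⟨h1, h2⟩ =>
    extendsAt_of_residue_eq_zero hX hY hk hη h1 h2⟩

end Web

end PlanarWeb
end

/-! ### Simple poles along a component of the discriminant. -/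

noncomputable section

namespace PlanarWeb

/-- Directions with both coordinates nonzero are dense, and homogeneity normalizes the first one to
1. The condition t ≠ 0 allows the horizontal shear with parameter 1/t. -/
theorem exists_symForm_ne_zero {d : ℕ} {a : ℕ → Plane → ℂ} {z v : Plane}
    (h : symForm d a z v ≠ 0) : ∃ t ≠ 0, symForm d a z (1, t) ≠ 0 := by
  have hc : ContinuousAt (symForm d a z) v := by
    unfold symForm
    fun_prop
  have hdense : Dense (({0}ᶜ : Set ℂ) ×ˢ ({0}ᶜ : Set ℂ)) :=
    (dense_compl_singleton 0).prod (dense_compl_singleton 0)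
  obtain ⟨w, ⟨hw1, hw2⟩, hw⟩ := ((mem_closure_iff_frequently.1 (hdense v)).and_eventually
    (hc.eventually_ne h)).exists
  refine ⟨w.2 / w.1, div_ne_zero hw2 hw1, fun h0 => hw ?_⟩
  have : w = w.1 • ((1, w.2 / w.1) : Plane) := by
    have hw1' : w.1 ≠ 0 := hw1
    ext
    · simp
    · simp [mul_div_cancel₀ _ hw1']
  rw [this, symForm_smul, h0, mul_zero]

/-- The shear `(x, y) ↦ (x - t y, y)`. -/
def horizontalShear (t : ℂ) : Plane ≃L[ℂ] Plane :=
  ContinuousLinearEquiv.equivOfInverse ((dx - t • dy).prod dy) ((dx + t • dy).prod dy)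
    (fun v => by ext <;> simp) fun v => by ext <;> simp

theorem horizontalShear_symm_apply (t : ℂ) (v : Plane) :
    (horizontalShear t).symm v = (v.1 + t * v.2, v.2) := rfl

section

variable {d : ℕ} {ι M : Type*} [TopologicalSpace M] [ChartedSpace Plane M]
  {e : OpenPartialHomeomorph M Plane} {x₀ : ℂ}

theorem exists_localExpr_ne_zero [IsManifold 𝓘(ℂ, Plane) ω M]
    (σ : (m : M) → TangentSpace 𝓘(ℂ, Plane) m → ℂ)
    (he : e ∈ IsManifold.maximalAtlas 𝓘(ℂ, Plane) ω M) {z : Plane} (hz : z ∈ e.target)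
    (h : ∃ v, σ (e.symm z) v ≠ 0) : ∃ v, localExpr σ e z v ≠ 0 := by
  have h1 : e.MDifferentiable 𝓘(ℂ, Plane) 𝓘(ℂ, Plane) :=
    ⟨(contMDiffOn_of_mem_maximalAtlas he).mdifferentiableOn (by simp),
      (contMDiffOn_symm_of_mem_maximalAtlas he).mdifferentiableOn (by simp)⟩
  obtain ⟨v, hv⟩ := h
  obtain ⟨w, rfl⟩ := (h1.symm.mfderiv_bijective hz).2 v
  exact ⟨w, hv⟩

omit [ChartedSpace Plane M] in
theorem tendsto_symm_slice (hx : (x₀, 0) ∈ e.target) :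
    Tendsto (fun x : ℂ => e.symm (x, 0)) (𝓝[≠] x₀) (𝓝[≠] (e.symm (x₀, 0))) := by
  have hc : ContinuousAt (fun x : ℂ => ((x, 0) : Plane)) x₀ := by fun_prop
  refine tendsto_nhdsWithin_iff.2 ⟨?_, ?_⟩
  · exact ((e.continuousAt_symm hx).tendsto.comp hc.tendsto).mono_left nhdsWithin_le_nhds
  · filter_upwards [nhdsWithin_le_nhds (hc.eventually (e.open_target.eventually_mem hx)),
      self_mem_nhdsWithin] with x h1 h2 h3
    exact h2 (congrArg Prod.fst (e.symm.injOn h1 hx h3))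

omit [ChartedSpace Plane M] in
/-- A property that holds densely on a curve `{y = 0}` holds for points `(x, 0)` near any point. -/
theorem frequently_symm_slice {D : Set M} {p : M → Prop} (hx : (x₀, 0) ∈ e.target)
    (hiff : ∀ m ∈ e.source, m ∈ D ↔ (e m).2 = 0) (h : D ⊆ closure {m | m ∈ D ∧ p m}) :
    ∃ᶠ x in 𝓝 x₀, p (e.symm (x, 0)) := by
  have hsrc := e.map_target hx
  have ht : Tendsto (fun m => (e m).1) (𝓝 (e.symm (x₀, 0))) (𝓝 x₀) := by
    have h1 := continuous_fst.continuousAt.tendsto.comp (e.continuousAt hsrc).tendsto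
    rw [e.right_inv hx] at h1
    exact h1
  have h1 : ∃ᶠ m in 𝓝 (e.symm (x₀, 0)), p (e.symm ((e m).1, 0)) := by
    refine ((mem_closure_iff_frequently.1 (h ((hiff _ hsrc).2
      (by rw [e.right_inv hx])))).and_eventually (e.open_source.eventually_mem hsrc)).mono ?_
    rintro m ⟨⟨hm1, hm2⟩, hm3⟩
    have : ((e m).1, (0 : ℂ)) = e m := by rw [← (hiff m hm3).1 hm1]
    rwa [this, e.left_inv hm3]
  exact ht.frequently h1

/-- This is where isolated zeros matter: a defining form cannot vanish identically along the curve.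
-/
theorem Web.eventually_exists_localExpr_ne_zero [IsManifold 𝓘(ℂ, Plane) ω M] (W : Web d ι M)
    (he : e ∈ IsManifold.maximalAtlas 𝓘(ℂ, Plane) ω M) {i : ι} (hx : (x₀, 0) ∈ e.target)
    (hi : e.symm (x₀, 0) ∈ W.dom i) :
    ∀ᶠ x in 𝓝[≠] x₀, ∃ v, localExpr (W.form i) e (x, 0) v ≠ 0 := by
  have hc : ContinuousAt (fun x : ℂ => ((x, 0) : Plane)) x₀ := by fun_prop
  filter_upwards [(tendsto_symm_slice hx).eventually (W.isolated_zeros i _ hi),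
    nhdsWithin_le_nhds (hc.eventually (e.open_target.eventually_mem hx))] with x h1 h2
  exact exists_localExpr_ne_zero _ he h2 h1

namespace Web

open Polynomial

variable {W : Web d ι M} {D : Set M} {a : ℕ → Plane → ℂ} {i : ι}
  {n : ℕ} {φ : Fin n → ℂ → ℂ} {ν : Fin n → ℕ}

/-- Along a curve along which the web is smooth, roots of constant multiplicity give
equimultiple points. -/
theorem frequently_equimultipleAt (hs : W.SmoothAlong D)
    (he : e ∈ IsManifold.maximalAtlas 𝓘(ℂ, Plane) ω M)
    (hiff : ∀ m ∈ e.source, m ∈ D ↔ (e m).2 = 0) (h : W.IsEquationAt e a i (x₀, 0))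
    (h0 : a 0 (x₀, 0) ≠ 0) (hφ : ∀ α, AnalyticAt ℂ (φ α) x₀)
    (hne : ∀ α β, α ≠ β → φ α x₀ ≠ φ β x₀)
    (hfac : ∀ᶠ x in 𝓝 x₀, webPolynomial d a (x, 0) =
      C (a 0 (x, 0)) * ∏ α, (X - C (φ α x)) ^ ν α) :
    ∃ᶠ x in 𝓝 x₀, EquimultipleAt d a φ ν x := by
  have hc : ContinuousAt (fun x : ℂ => ((x, 0) : Plane)) x₀ := by fun_prop
  have h2 := frequently_symm_slice h.mem_target hiff hs
  have h3 : ∀ᶠ x in 𝓝 x₀, ∀ α, AnalyticAt ℂ (φ α) x :=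
    Filter.eventually_all.2 fun α => (hφ α).eventually_analyticAt
  have h4 : ∀ᶠ x in 𝓝 x₀, ∀ α β, α ≠ β → φ α x ≠ φ β x := by
    refine Filter.eventually_all.2 fun α => Filter.eventually_all.2 fun β => ?_
    by_cases hαβ : α = β
    · simp [hαβ]
    · filter_upwards [((hφ α).fun_sub (hφ β)).continuousAt.eventually_ne
        (sub_ne_zero.2 (hne α β hαβ))] with x hx _ using sub_ne_zero.1 hx
  refine (h2.and_eventually ((hc.eventually h.eventually).and
    (((analyticAt_slice (h.analyticAt_coeff.self_of_nhds 0)).continuousAt.eventually_ne h0).and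
      (h3.and (h4.and hfac.eventually_nhds))))).mono ?_
  rintro x ⟨e1, e2, e3, e4, e5, e6⟩
  exact e2.equimultipleAt he e1 e3 e4 e5 e6

/-- If a web is smooth along an irreducible component of its discriminant, its fundamental form has
at most simple poles there. -/
theorem fundamentalFormSimplePolesAlong [IsManifold 𝓘(ℂ, Plane) ω M]
    (hD : IsIrreducibleComponent W.discriminant D) (hs : W.SmoothAlong D) :
    W.FundamentalFormSimplePolesAlong D := by
  obtain ⟨m₀, hm₀, hDeq⟩ := hD
  have hd := W.two_le_of_mem_discriminant hm₀.1
  set K := connectedComponentIn (regularLocus W.discriminant) m₀ with hK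
  have hKD : K ⊆ D := hDeq ▸ subset_closure
  have hKΔ : K ⊆ W.discriminant := fun m hm => (connectedComponentIn_subset _ _ hm).1
  have hDΔ : D ⊆ W.discriminant := hDeq ▸ closure_minimal hKΔ (W.isClosed_discriminant hd)
  -- D is the closure of `K`, so it is enough to find good points of D arbitrarily close to each
  -- point of `K`.
  suffices key : ∀ m ∈ K, ∀ N : Set M, IsOpen N → m ∈ N → (N ∩ {m | m ∈ D ∧
      ∃ e ∈ IsManifold.maximalAtlas 𝓘(ℂ, Plane) ω M, m ∈ e.source ∧
      (∀ m' ∈ e.source, m' ∈ D ↔ (e m').2 = 0) ∧ ∀ i, m ∈ W.dom i →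
      ExtendsAt (W.discrIn e) (fun z => z.2 • fundamentalForm d (localExpr (W.form i) e) z)
        (e m)}).Nonempty by
    rw [FundamentalFormSimplePolesAlong]
    conv_lhs => rw [hDeq]
    exact closure_minimal (fun m hm => mem_closure_iff.2 (key m hm)) isClosed_closure
  intro m hm N hN hmN
  obtain ⟨i, hi⟩ := W.covers m
  obtain ⟨e₁, he₁, hms, hsub, hiffΔ, r, hr, htar⟩ := exists_adapted_chart
    (connectedComponentIn_subset _ _ hm) (hN.inter (W.isOpen_dom i)) ⟨hmN, hi⟩
  have hiff₁ : ∀ m' ∈ e₁.source, m' ∈ D ↔ (e₁ m').2 = 0 := fun m' hm' =>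
    ⟨fun h => (hiffΔ m' hm').1 (hDΔ h), fun h =>
      hKD (mem_component_of_chart he₁ hiffΔ htar hms hm hm' h)⟩
  have hm0 := (hiffΔ m hms).1 (hKΔ hm)
  have hz₁ : ((e₁ m).1, (0 : ℂ)) ∈ e₁.target := by
    have : ((e₁ m).1, (0 : ℂ)) = e₁ m := by rw [← hm0]
    rw [this]
    exact e₁.map_source hms
  have hcz : ∀ x : ℂ, ContinuousAt (fun x : ℂ => ((x, 0) : Plane)) x := fun x => by fun_prop
  obtain ⟨x₁, ⟨v, hv⟩, hx₁⟩ := ((W.eventually_exists_localExpr_ne_zero he₁ hz₁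
    (hsub (e₁.map_target hz₁)).2).and (nhdsWithin_le_nhds ((hcz _).eventually
      (e₁.open_target.eventually_mem hz₁)))).exists
  obtain ⟨a₁, -, ha₁⟩ := W.holomorphic i e₁ he₁
  have hmem₁ : ∀ z ∈ e₁.target, z ∈ e₁.target ∩ e₁.symm ⁻¹' W.dom i := fun z hz =>
    ⟨hz, (hsub (e₁.map_target hz)).2⟩
  rw [ha₁ _ (hmem₁ _ hx₁)] at hv
  obtain ⟨s, hs0, hs1⟩ := exists_symForm_ne_zero hv
  -- The line y = 0 is fixed pointwise, while the vertical direction of the new chart is the old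
  -- direction (1, s), up to scale, at which the form does not vanish. This makes the leading
  -- coefficient nonzero.
  set T := horizontalShear s⁻¹ with hT
  set e₂ := e₁.transHomeomorph T.toHomeomorph with he₂def
  have he₂ : e₂ ∈ IsManifold.maximalAtlas 𝓘(ℂ, Plane) ω M := transHomeomorph_mem_maximalAtlas he₁ _
  have hTx : ∀ x : ℂ, T.symm (x, 0) = (x, 0) := fun x => by simp [hT, horizontalShear_symm_apply]
  have htar₂ : ∀ x : ℂ, (x, 0) ∈ e₁.target → (x, 0) ∈ e₂.target := fun x hx => by
    change T.symm (x, 0) ∈ e₁.target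
    rwa [hTx]
  have hiff₂ : ∀ m' ∈ e₂.source, m' ∈ D ↔ (e₂ m').2 = 0 := hiff₁
  obtain ⟨a, ha, hae⟩ := W.holomorphic i e₂ he₂
  have hmem₂ : ∀ z ∈ e₂.target, z ∈ e₂.target ∩ e₂.symm ⁻¹' W.dom i := fun z hz =>
    ⟨hz, (hsub (e₂.map_target hz)).2⟩
  have ha0 : a 0 (x₁, 0) ≠ 0 := by
    rw [← symForm_zero_one (d := d) (a := a) (z := (x₁, 0)), ← hae _ (hmem₂ _ (htar₂ _ hx₁)), he₂def,
      localExpr_transHomeomorph _ he₁ _ (by rwa [hTx]), hTx, ha₁ _ (hmem₁ _ hx₁)]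
    have : T.symm (0, 1) = s⁻¹ • ((1, s) : Plane) := by
      rw [hT, horizontalShear_symm_apply]
      ext <;> simp [hs0]
    rw [this, symForm_smul]
    exact mul_ne_zero (pow_ne_zero _ (inv_ne_zero hs0)) hs1
  have hU : ∀ᶠ x in 𝓝 x₁, (x, 0) ∈ e₂.target ∧ a 0 (x, 0) ≠ 0 :=
    ((hcz _).eventually (e₂.open_target.eventually_mem (htar₂ _ hx₁))).and
      ((analyticAt_slice (ha 0 _ (hmem₂ _ (htar₂ _ hx₁)))).continuousAt.eventually_ne ha0)
  obtain ⟨U, hU1, hU2, hU3⟩ := eventually_nhds_iff.1 hU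
  obtain ⟨x₀, hx₀, n, φ, ν, hφ, hν, hne, hfac⟩ := exists_generic_factorization
    (Q := webPolynomial d a) ⟨x₁, hU3⟩ hU2 d
    (fun x hx => analyticFamily_webPolynomial fun k => ha k _ (hmem₂ _ (hU1 x hx).1))
    (fun x hx => webPolynomial_natDegree (hU1 x hx).2)
    (fun x hx => webPolynomial_ne_zero (hU1 x hx).2)
  have hE : ∀ x ∈ U, W.IsEquationAt e₂ a i (x, 0) := fun x hx =>
    isEquationAt_of_holomorphic ha hae (hU1 x hx).1 (hmem₂ _ (hU1 x hx).1).2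
  -- Smooth points are dense in D and the remaining conditions are open, so an equimultiple point
  -- can be found near `x₀`.
  obtain ⟨x, hx, hxU⟩ := ((frequently_equimultipleAt (φ := φ) (ν := ν) hs he₂ hiff₂ (hE x₀ hx₀)
    (hU1 x₀ hx₀).2 hφ hne (by
      filter_upwards [hfac, hU2.eventually_mem hx₀] with x h1 h2
      rwa [webPolynomial_leadingCoeff (hU1 x h2).2] at h1)).and_eventually
    (hU2.eventually_mem hx₀)).exists
  have hxt := (hU1 x hxU).1
  have hxs := e₂.map_target hxt
  refine ⟨e₂.symm (x, 0), (hsub hxs).1, (hiff₂ _ hxs).2 (by rw [e₂.right_inv hxt]), e₂, he₂, hxs,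
    hiff₂, fun j hj => ?_⟩
  rw [e₂.right_inv hxt]
  refine extendsAt_smul_fundamentalForm hd he₂ hν (hE x hxU) hx ?_ hj
  filter_upwards [e₂.open_target.eventually_mem hxt] with z h1 h2
  exact hDΔ ((hiff₂ _ (e₂.map_target h1)).2 (by rw [e₂.right_inv h1, h2]))

end Web

end

end PlanarWeb
end

/-! ### Statements up to a discrete subset of V, and the curvature criterion. -/

noncomputable section

namespace PlanarWeb

section Codiscrete

variable {V : Set ℂ} {p : ℂ → Prop}

theorem eventually_eventually_nhds_of_codiscreteWithin (hV : IsOpen V)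
    (h : ∀ᶠ x in codiscreteWithin V, p x) {x : ℂ} (hx : x ∈ V) :
    ∀ᶠ y in 𝓝[≠] x, ∀ᶠ z in 𝓝 y, p z := by
  have h1 : {x | p x} ∪ Vᶜ ∈ 𝓝[≠] x := mem_codiscreteWithin_iff_forall_mem_nhdsNE.1 h x hx
  have h2 : ∀ᶠ y in 𝓝[≠] x, p y := by
    filter_upwards [h1, nhdsWithin_le_nhds (hV.mem_nhds hx)] with y h3 h4
    exact h3.resolve_right (not_not.2 h4)
  filter_upwards [eventually_eventually_nhdsWithin.2 h2, self_mem_nhdsWithin] with y h3 h4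
  rwa [isOpen_compl_singleton.nhdsWithin_eq h4] at h3

theorem exists_eventually_nhds_of_codiscreteWithin (hV : IsOpen V) (hne : V.Nonempty)
    (h : ∀ᶠ x in codiscreteWithin V, p x) : ∃ x ∈ V, ∀ᶠ z in 𝓝 x, p z := by
  obtain ⟨x, hx⟩ := hne
  obtain ⟨y, h1, h2⟩ := ((eventually_eventually_nhds_of_codiscreteWithin hV h hx).and
    (nhdsWithin_le_nhds (hV.mem_nhds hx))).exists
  exact ⟨y, h2, h1⟩

/-- The identity theorem for meromorphic functions. -/
theorem eventually_codiscreteWithin_eq_zero {f : ℂ → ℂ} {x : ℂ} (hV : IsPreconnected V)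
    (hf : MeromorphicOn f V) (hx : x ∈ V) (h : ∀ᶠ z in 𝓝 x, f z = 0) :
    ∀ᶠ x in codiscreteWithin V, f x = 0 := by
  refine mem_codiscreteWithin_iff_forall_mem_nhdsNE.2 fun y hy => ?_
  have h1 : meromorphicOrderAt f y = ⊤ := by
    by_contra h0
    exact hf.meromorphicOrderAt_ne_top_of_isPreconnected hV hy hx h0
      (meromorphicOrderAt_eq_top_iff.2 (nhdsWithin_le_nhds h))
  filter_upwards [meromorphicOrderAt_eq_top_iff.1 h1] with z hz using Or.inl hz

end Codiscrete

namespace Web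

open Polynomial

variable {d : ℕ} {ι M : Type*} [TopologicalSpace M] [ChartedSpace Plane M]
  [IsManifold 𝓘(ℂ, Plane) ω M] {e : OpenPartialHomeomorph M Plane} {W : Web d ι M} {D : Set M}
  {a : ℕ → Plane → ℂ} {V : Set ℂ} {n : ℕ} {φ : Fin n → ℂ → ℂ} {ν : Fin n → ℕ}

omit [IsManifold 𝓘(ℂ, Plane) ω M] in
theorem IsEquation.exists_isEquationAt (hE : W.IsEquation e a) {z : Plane} (hz : z ∈ e.target) :
    ∃ i, W.IsEquationAt e a i z := by
  obtain ⟨i, hi⟩ := W.covers (e.symm z)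
  exact ⟨i, hE.isEquationAt hz hi⟩

/-- Each condition says that a holomorphic function on the connected set V does not vanish, so it
fails on a discrete set at most, provided that the function is nonzero at one point. -/
theorem eventually_equimultipleAt (hs : W.SmoothAlong D)
    (he : e ∈ IsManifold.maximalAtlas 𝓘(ℂ, Plane) ω M)
    (hiff : ∀ m ∈ e.source, m ∈ D ↔ (e m).2 = 0) (hE : W.IsEquation e a) (hV : IsOpen V)
    (hVc : IsConnected V) (htar : ∀ x ∈ V, (x, (0 : ℂ)) ∈ e.target)
    (hφ : ∀ α, AnalyticOnNhd ℂ (φ α) V) (hne : ∀ α β, α ≠ β → ∃ x ∈ V, φ α x ≠ φ β x)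
    (hfac : ∀ x ∈ V, ∀ p : ℂ, webPoly d a x 0 p = a 0 (x, 0) * ∏ α, (p - φ α x) ^ ν α) :
    ∀ᶠ x in codiscreteWithin V, EquimultipleAt d a φ ν x := by
  have hcz : ∀ x : ℂ, ContinuousAt (fun x : ℂ => ((x, 0) : Plane)) x := fun x => by fun_prop
  have hpoly : ∀ x ∈ V, webPolynomial d a (x, 0) = C (a 0 (x, 0)) * ∏ α, (X - C (φ α x)) ^ ν α :=
    fun x hx => Polynomial.funext fun p => by
      rw [webPolynomial_eval, hfac x hx]
      simp [eval_prod]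
  have hfac' : ∀ x ∈ V, ∀ᶠ x in 𝓝 x, webPolynomial d a (x, 0) =
      C (a 0 (x, 0)) * ∏ α, (X - C (φ α x)) ^ ν α := fun x hx =>
    (hV.eventually_mem hx).mono hpoly
  have han : ∀ x ∈ V, ∀ᶠ z in 𝓝 ((x, 0) : Plane), ∀ k, AnalyticAt ℂ (a k) z := fun x hx =>
    (hE.exists_isEquationAt (htar x hx)).elim fun _ h => h.analyticAt_coeff
  -- F(x, 0, p) is nonzero for some `x` and `p`, as the form has isolated zeros; in the
  -- factorization its leading coefficient is then nonzero.
  have h0 : ∃ x ∈ V, a 0 (x, 0) ≠ 0 := by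
    obtain ⟨x₁, hx₁⟩ := hVc.nonempty
    obtain ⟨i, hi⟩ := hE.exists_isEquationAt (htar x₁ hx₁)
    obtain ⟨x, ⟨v, hv⟩, hi', hx⟩ := ((W.eventually_exists_localExpr_ne_zero he (htar x₁ hx₁)
      hi.mem_dom).and (nhdsWithin_le_nhds (((hcz x₁).eventually hi.eventually).and
        (hV.eventually_mem hx₁)))).exists
    obtain ⟨g, -, hg0, hgeq⟩ := hi'.exists_unit
    have h1 : symForm d a (x, 0) v ≠ 0 := by
      rw [hgeq.self_of_nhds]
      exact mul_ne_zero hg0 hv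
    obtain ⟨t, -, ht⟩ := exists_symForm_ne_zero h1
    rw [← webPolynomial_eval_eq_symForm, webPolynomial_eval, hfac x hx] at ht
    exact ⟨x, hx, left_ne_zero_of_mul ht⟩
  have hlead : ∀ᶠ x in codiscreteWithin V, a 0 (x, 0) ≠ 0 := by
    obtain ⟨x, hx, h1⟩ := h0
    exact AnalyticOnNhd.preimage_zero_mem_codiscreteWithin (f := fun x => a 0 (x, 0))
      (fun x hx => analyticAt_slice ((han x hx).self_of_nhds 0)) h1 hx hVc
  have hroots : ∀ᶠ x in codiscreteWithin V, ∀ α β, α ≠ β → φ α x ≠ φ β x := by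
    refine Filter.eventually_all.2 fun α => Filter.eventually_all.2 fun β => ?_
    by_cases hαβ : α = β
    · simp [hαβ]
    · obtain ⟨x, hx, h1⟩ := hne α β hαβ
      have h2 : ∀ᶠ x in codiscreteWithin V, φ α x - φ β x ≠ 0 :=
        AnalyticOnNhd.preimage_zero_mem_codiscreteWithin (f := fun x => φ α x - φ β x)
          (fun x hx => (hφ α x hx).fun_sub (hφ β x hx)) (sub_ne_zero.2 h1) hx hVc
      exact h2.mono fun x h3 _ => sub_ne_zero.1 h3
  -- Smoothness along D gives a single equimultiple point, a witness that ∂F/∂y does not vanish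
  -- identically along any multiple root.
  obtain ⟨x₃, hx₃V, hx₃⟩ : ∃ x ∈ V, EquimultipleAt d a φ ν x := by
    obtain ⟨x, hx, h1⟩ := exists_eventually_nhds_of_codiscreteWithin hV hVc.nonempty
      (hlead.and hroots)
    obtain ⟨i, hi⟩ := hE.exists_isEquationAt (htar x hx)
    obtain ⟨h2, h3⟩ := h1.self_of_nhds
    obtain ⟨y, h4, h5⟩ := ((frequently_equimultipleAt hs he hiff hi h2 (fun α => hφ α x hx) h3
      (hfac' x hx)).and_eventually (hV.eventually_mem hx)).exists
    exact ⟨y, h5, h4⟩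
  have htrans : ∀ᶠ x in codiscreteWithin V,
      ∀ α, 2 ≤ ν α → deriv (fun y => webPoly d a x y (φ α x)) 0 ≠ 0 := by
    refine Filter.eventually_all.2 fun α => ?_
    by_cases hα : 2 ≤ ν α
    · have h2 : ∀ᶠ x in codiscreteWithin V, deriv (fun y => webPoly d a x y (φ α x)) 0 ≠ 0 :=
        AnalyticOnNhd.preimage_zero_mem_codiscreteWithin
          (f := fun x => deriv (fun y => webPoly d a x y (φ α x)) 0)
          (fun x hx => analyticAt_deriv_webPoly (han x hx) (hφ α x hx)) (hx₃.transverse α hα)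
          hx₃V hVc
      exact h2.mono fun x h3 _ => h3
    · simp [hα]
  filter_upwards [hlead, hroots, htrans, self_mem_codiscreteWithin V] with x h1 h2 h3 hx
  exact ⟨han x hx, h1, fun α => hφ α x hx, h2, hfac' x hx, h3⟩

/-- The curvature is holomorphic along a component of the discriminant if and only if the exterior
derivative of the polar part of the fundamental form vanishes. -/
theorem curvatureHolomorphicAlong_iff (hD : IsIrreducibleComponent W.discriminant D)
    (he : e ∈ IsManifold.maximalAtlas 𝓘(ℂ, Plane) ω M)
    (hiff : ∀ m ∈ e.source, m ∈ D ↔ (e m).2 = 0) (hE : W.IsEquation e a) (hV : IsOpen V)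
    (hVc : IsConnected V) (htar : ∀ x ∈ V, (x, (0 : ℂ)) ∈ e.target)
    (hφ : ∀ α, AnalyticOnNhd ℂ (φ α) V) (hν : ∀ α, 1 ≤ ν α)
    (hF : ∀ᶠ x in codiscreteWithin V, EquimultipleAt d a φ ν x) :
    W.CurvatureHolomorphicAlong D ↔ (∀ᶠ x in codiscreteWithin V, residueX d a φ ν x = 0) ∧
      ∀ᶠ x in codiscreteWithin V, deriv (residueY d a φ ν) x = 0 := by
  obtain ⟨m₀, hm₀, hDeq⟩ := hD
  have hd := W.two_le_of_mem_discriminant hm₀.1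
  have hcz : ∀ x : ℂ, ContinuousAt (fun x : ℂ => ((x, 0) : Plane)) x := fun x => by fun_prop
  set K := connectedComponentIn (regularLocus W.discriminant) m₀ with hK
  have hKD : K ⊆ D := hDeq ▸ subset_closure
  have hDΔ : D ⊆ W.discriminant := hDeq ▸ closure_minimal
    (fun m hm => (connectedComponentIn_subset _ _ hm).1) (W.isClosed_discriminant hd)
  have hΔ : ∀ x ∈ V, ∀ᶠ z in 𝓝 ((x, 0) : Plane), z.2 = 0 → z ∈ W.discrIn e := fun x hx => by
    filter_upwards [e.open_target.eventually_mem (htar x hx)] with z h1 h2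
    exact hDΔ ((hiff _ (e.map_target h1)).2 (by rw [e.right_inv h1, h2]))
  have han : ∀ x ∈ V, ∀ᶠ z in 𝓝 ((x, 0) : Plane), ∀ k, AnalyticAt ℂ (a k) z := fun x hx =>
    (hE.exists_isEquationAt (htar x hx)).elim fun _ h => h.analyticAt_coeff
  constructor
  · intro hcurv
    obtain ⟨x₁, hx₁, hF₁⟩ := exists_eventually_nhds_of_codiscreteWithin hV hVc.nonempty hF
    obtain ⟨x, h1, h2, hx⟩ := ((frequently_symm_slice (p := W.CurvatureExtendsAt) (htar x₁ hx₁) hiff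
      hcurv).and_eventually (hF₁.and (hV.eventually_mem hx₁))).exists
    obtain ⟨i, hi⟩ := hE.exists_isEquationAt (htar x hx)
    have h3 := h1 e he (e.map_target (htar x hx)) i hi.mem_dom
    rw [e.right_inv (htar x hx), ← hi.extendsAt_curvature_iff hd he,
      extendsAt_curvature_iff_residue hd he hν hi h2 (hΔ x hx)] at h3
    -- The coefficients vanish near one point; meromorphy on all of V spreads this, even across
    -- points where roots collide.
    have hX : MeromorphicOn (residueX d a φ ν) V := fun y hy =>
      (MeromorphicAt.fun_sum fun α _ => ((MeromorphicAt.const _ y).fun_mul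
        (hφ α y hy).meromorphicAt).fun_mul
          (meromorphicAt_psi (han y hy) (fun α => hφ α y hy) α)).fun_neg
    have hY : MeromorphicOn (residueY d a φ ν) V := fun y hy =>
      MeromorphicAt.fun_sum fun α _ => (MeromorphicAt.const _ y).fun_mul
        ((meromorphicAt_psi (han y hy) (fun α => hφ α y hy) α).fun_add (MeromorphicAt.const _ y))
    exact ⟨eventually_codiscreteWithin_eq_zero hVc.isPreconnected hX hx h3.1,
      eventually_codiscreteWithin_eq_zero hVc.isPreconnected hY.deriv hx h3.2⟩
  · rintro ⟨hX, hY⟩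
    obtain ⟨x₁, hx₁, h1⟩ := exists_eventually_nhds_of_codiscreteWithin hV hVc.nonempty
      (hF.and (hX.and hY))
    -- The point must lie in `K`, not only in its closure D, so that extendability can propagate
    -- along the component.
    obtain ⟨x, hxK, h2, hx⟩ := ((frequently_symm_slice (p := fun m => m ∈ K) (htar x₁ hx₁) hiff
      (by
        conv_lhs => rw [hDeq]
        exact closure_mono fun m hm => ⟨hKD hm, hm⟩)).and_eventually
      (h1.eventually_nhds.and (hV.eventually_mem hx₁))).exists
    obtain ⟨i, hi⟩ := hE.exists_isEquationAt (htar x hx)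
    have h3 := (extendsAt_curvature_iff_residue hd he hν hi h2.self_of_nhds.1 (hΔ x hx)).2
      ⟨h2.mono fun _ h => h.2.1, h2.mono fun _ h => h.2.2⟩
    rw [hi.extendsAt_curvature_iff hd he] at h3
    have h4 := curvatureExtendsAt_of_extendsAt hd he hi.mem_target hi.mem_dom h3
    rw [CurvatureHolomorphicAlong]
    conv_lhs => rw [hDeq]
    exact closure_mono fun m hm => ⟨hKD hm, curvatureExtendsAt_of_mem_component hd hxK hm h4⟩

end Web

end PlanarWeb
end

/-! ### The theorem. -/

theorem theorem2p1 {d : ℕ} {ι M : Type*} [TopologicalSpace M] [T2Space M]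
    [ChartedSpace (ℂ × ℂ) M] [IsManifold 𝓘(ℂ, ℂ × ℂ) ω M]
    (W : PlanarWeb.Web d ι M) (D : Set M)
    (hD : PlanarWeb.IsIrreducibleComponent W.discriminant D)
    (hsmooth : W.SmoothAlong D) :
    W.FundamentalFormSimplePolesAlong D ∧
    ∀ e ∈ IsManifold.maximalAtlas 𝓘(ℂ, ℂ × ℂ) ω M,
      (∀ m ∈ e.source, m ∈ D ↔ (e m).2 = 0) →
    ∀ a : ℕ → ℂ × ℂ → ℂ, W.IsEquation e a →
    ∀ V : Set ℂ, IsOpen V → IsConnected V → (∀ x ∈ V, (x, (0 : ℂ)) ∈ e.target) →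
    ∀ (n : ℕ) (φ : Fin n → ℂ → ℂ) (ν : Fin n → ℕ),
      (∀ α, AnalyticOnNhd ℂ (φ α) V) → (∀ α, 1 ≤ ν α) →
      (∀ α β, α ≠ β → ∃ x ∈ V, φ α x ≠ φ β x) →
      (∀ x ∈ V, ∀ p : ℂ,
        PlanarWeb.webPoly d a x 0 p = a 0 (x, 0) * ∏ α, (p - φ α x) ^ ν α) →
      (∀ᶠ x in Filter.codiscreteWithin V,
        PlanarWeb.ExtendsAt (W.discrIn e)
          (fun z => PlanarWeb.fundamentalForm d (PlanarWeb.symForm d a) z -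
            (1 / (6 * z.2)) • PlanarWeb.residue d a φ ν z.1) (x, 0)) ∧
      (W.CurvatureHolomorphicAlong D ↔
        (∀ᶠ x in Filter.codiscreteWithin V,
          ∑ α, ((ν α : ℂ) - 1) * φ α x * PlanarWeb.psi d a φ ν α x = 0) ∧
        (∀ᶠ x in Filter.codiscreteWithin V,
          ∑ α, ((ν α : ℂ) - 1) * deriv (PlanarWeb.psi d a φ ν α) x = 0)) := by

  refine ⟨W.fundamentalFormSimplePolesAlong hD hsmooth, ?_⟩
  intro e he hiff a hE V hV hVc htar n φ ν hφ hν hne hfac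
  have hd : 2 ≤ d := hD.elim fun m hm => W.two_le_of_mem_discriminant hm.1.1
  have hF := PlanarWeb.Web.eventually_equimultipleAt hsmooth he hiff hE hV hVc htar hφ hne hfac
  refine ⟨?_, ?_⟩
  · filter_upwards [hF, Filter.self_mem_codiscreteWithin V] with x h1 hx
    obtain ⟨i, hi⟩ := hE.exists_isEquationAt (htar x hx)
    exact PlanarWeb.Web.exists_fundamentalForm_sub_residue hd he hν hi h1
  · rw [PlanarWeb.Web.curvatureHolomorphicAlong_iff hD he hiff hE hV hVc htar hφ hν hF]
    refine and_congr (Filter.eventually_congr (Filter.Eventually.of_forall fun x => ?_))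
      (Filter.eventually_congr (hF.mono fun x hx => ?_))
    · rw [PlanarWeb.residueX, neg_eq_zero]
    -- The constants ν_α - 2 in the dy-component disappear under differentiation. Termwise
    -- differentiation needs ψ_α analytic for ν_α ≥ 2, so this equivalence holds at equimultiple
    -- points only.
    · rw [hx.deriv_residueY (by omega) hν]
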